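/- Let $k$ be a field of characteristic zero and let $K\supset k$ be an algebraically closed field of infinite transcendence degree over $k$. For $\sigma\in\mathrm{Aut}(K/k)$ and a $K$-scheme $Y$, let ${}^{\sigma}Y=Y\times_{\mathrm{Spec}\,K,\,\mathrm{Spec}\,\sigma}\mathrm{Spec}\,K$, and similarly ${}^\sigma f$ for a $K$-morphism $f$. A \emph{descent datum} on $Y$ from $K$ to $k$ is a family of $K$-isomorphisms $\varphi_\sigma:{}^{\sigma}Y\to Y$, $\sigma\in\mathrm{Aut}(K/k)$, with $\varphi_{\sigma\tau}=\varphi_\sigma\circ{}^{\sigma}\varphi_\tau$ for all $\sigma,\tau$. It is \emph{continuous} if every rational function $f$ on $Y$ (a section over a dense open subset, up to equality on a smaller dense open subset) is fixed by $\mathrm{Aut}(K/L)$ for some subfield $L\subset K$ finitely generated over $k$, where $\sigma$ acts by $\sigma(f)={}^{\sigma}(\varphi_{\sigma^{-1}}^{*}f)$. Let $\{X_\alpha\}_{\alpha\in\mathcal A}$ be a family of quasi-projective $K$-schemes (schemes admitting a locally closed immersion over $K$ into some $\mathbb P^n_K$), and let $\{f_\beta\}_{\beta\in\mathcal B}$ be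 a family of $K$-morphisms $f_\beta:X_{s(\beta)}\to X_{t(\beta)}$ between them. Suppose that the group $\mathrm{Aut}_K(X_\alpha)$ is finite for every $\alpha$, and that the only family $\{\psi_\alpha\in\mathrm{Aut}_K(X_\alpha)\}_{\alpha\in\mathcal A}$ with $f_\beta\circ\psi_{s(\beta)}=\psi_{t(\beta)}\circ f_\beta$ for all $\beta$ is the trivial one. Then every family of descent data $\{\varphi_{\alpha,\sigma}\}_\sigma$ on the $X_\alpha$ that commutes with all the $f_\beta$, i.e. $\varphi_{t(\beta),\sigma}\circ{}^{\sigma}f_\beta=f_\beta\circ\varphi_{s(\beta),\sigma}$ for all $\beta$ and $\sigma$, is effective: each of these descent data is continuous, and there are $k$-schemes $X^0_\alpha$ and $K$-isomorphisms $X^0_\alpha\times_k K\cong X_\alpha$ carrying the canonical descent datum of $X^0_\alpha\times_k K$ to the given one on $X_\alpha$, such that, under these identifications, every $f_\beta$ is the base change of a morphism of $k$-schemes $X^0_{s(\beta)}\to X^0_{t(\beta)}$. -/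

import Mathlib

open CategoryTheory AlgebraicGeometry

universe u

noncomputable section

namespace WeilDescent

/-! ### Quasi-projective schemes over a field -/

attribute [local instance] MvPolynomial.gradedAlgebra in
/-- Projective space `ℙⁿ` over a field `K`, as a scheme over `Spec K`: the `Proj` of the polynomial
ring in `n + 1` variables, graded by degree. -/
def projectiveSpace (K : Type u) [Field K] (n : ℕ) : Over (Spec (.of K)) :=
  Over.mk (Proj.toSpecZero (MvPolynomial.homogeneousSubmodule (Fin (n + 1)) K) ≫
    Spec.map (CommRingCat.ofHom
      (algebraMap K (MvPolynomial.homogeneousSubmodule (Fin (n + 1)) K 0))))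

/-- A scheme over `K` is quasi-projective if it admits a (locally closed) immersion over `K` into
some projective space over `K`. -/
def IsQuasiProjective {K : Type u} [Field K] (Y : Over (Spec (.of K))) : Prop :=
  ∃ (n : ℕ) (i : Y ⟶ projectiveSpace K n), IsImmersion i.left

section

variable {k K : Type u} [Field k] [Field K] [Algebra k K]

/-! ### Conjugate schemes -/

/-- For `σ ∈ Aut(K/k)`, the morphism `Spec(σ⁻¹) : Spec K ⟶ Spec K`. -/
def specInv (σ : K ≃ₐ[k] K) : Spec (.of K) ⟶ Spec (.of K) :=
  Spec.map (CommRingCat.ofHom (σ.symm : K →+* K))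

/-- The conjugation functor `Y ↦ ^σY` on `K`-schemes, where `^σY = Y ×_{Spec K, Spec σ} Spec K`.
As `σ` is invertible, the base change along `Spec σ` is realised by keeping the scheme `Y` and
composing its structure morphism with `Spec(σ⁻¹)`; see `conj_isPullback`. -/
def conj (σ : K ≃ₐ[k] K) : Over (Spec (.of K)) ⥤ Over (Spec (.of K)) :=
  Over.map (specInv σ)

theorem specInv_comp_spec (σ : K ≃ₐ[k] K) :
    specInv σ ≫ Spec.map (CommRingCat.ofHom (σ : K →+* K)) = 𝟙 _ := by
  rw [specInv, ← Spec.map_comp, ← CommRingCat.ofHom_comp, ← Spec.map_id]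
  congr 1
  ext x
  simp

theorem spec_comp_specInv (σ : K ≃ₐ[k] K) :
    Spec.map (CommRingCat.ofHom (σ : K →+* K)) ≫ specInv σ = 𝟙 _ := by
  rw [specInv, ← Spec.map_comp, ← CommRingCat.ofHom_comp, ← Spec.map_id]
  congr 1
  ext x
  simp

/-- `^σY` is the base change of `Y` along `Spec σ : Spec K ⟶ Spec K`. -/
theorem conj_isPullback (σ : K ≃ₐ[k] K) (Y : Over (Spec (.of K))) :
    IsPullback (𝟙 Y.left) ((conj σ).obj Y).hom Y.hom
      (Spec.map (CommRingCat.ofHom (σ : K →+* K))) := by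
  have : IsIso (Spec.map (CommRingCat.ofHom (σ : K →+* K))) :=
    ⟨specInv σ, spec_comp_specInv σ, specInv_comp_spec σ⟩
  refine IsPullback.of_horiz_isIso ⟨?_⟩
  change 𝟙 _ ≫ Y.hom = (Y.hom ≫ specInv σ) ≫ _
  rw [Category.assoc, specInv_comp_spec, Category.id_comp, Category.comp_id]

theorem specInv_mul (σ τ : K ≃ₐ[k] K) : specInv (σ * τ) = specInv τ ≫ specInv σ := by
  rw [specInv, specInv, specInv, ← Spec.map_comp, ← CommRingCat.ofHom_comp]
  rfl

/-- The canonical identification `^σ(^τY) = ^{στ}Y`. -/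
def conjMul (σ τ : K ≃ₐ[k] K) (Y : Over (Spec (.of K))) :
    (conj σ).obj ((conj τ).obj Y) ≅ (conj (σ * τ)).obj Y :=
  Over.isoMk (Iso.refl Y.left) (by
    change 𝟙 _ ≫ (Y.hom ≫ specInv (σ * τ)) = (Y.hom ≫ specInv τ) ≫ specInv σ
    rw [specInv_mul, Category.id_comp, Category.assoc])

/-! ### Descent data -/

variable (k) in
/-- A descent datum from `K` to `k` on the `K`-scheme `Y`: isomorphisms `φ_σ : ^σY ≅ Y` over `K`
for `σ ∈ Aut(K/k)` with `φ_{στ} = φ_σ ∘ ^σφ_τ`. -/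
structure DescentDatum (Y : Over (Spec (.of K))) where
  φ (σ : K ≃ₐ[k] K) : (conj σ).obj Y ≅ Y
  cocycle (σ τ : K ≃ₐ[k] K) :
    (conjMul σ τ Y).hom ≫ (φ (σ * τ)).hom = (conj σ).map (φ τ).hom ≫ (φ σ).hom

namespace DescentDatum

/-- A morphism `f : Y ⟶ Y'` commutes with descent data on `Y` and `Y'` if
`φ'_σ ∘ ^σf = f ∘ φ_σ` for all `σ`. -/
def Commutes {Y Y' : Over (Spec (.of K))} (D : DescentDatum k Y) (D' : DescentDatum k Y')
    (f : Y ⟶ Y') : Prop :=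
  ∀ σ : K ≃ₐ[k] K, (conj σ).map f ≫ (D'.φ σ).hom = (D.φ σ).hom ≫ f

/-- The automorphism of the scheme `Y` (in general not over `K`) underlying `φ_σ`: the schemes
underlying `^σY` and `Y` are the same. -/
def underlying {Y : Over (Spec (.of K))} (D : DescentDatum k Y) (σ : K ≃ₐ[k] K) :
    Y.left ⟶ Y.left :=
  (D.φ σ).hom.left

/-- A rational function on `Y`, represented by a section `f` over a dense open `U`, is fixed by
`σ` if it agrees on a dense open set with `σ(f) = ^σ(φ_{σ⁻¹}^* f)`. -/
def FixesRational {Y : Over (Spec (.of K))} (D : DescentDatum k Y) (σ : K ≃ₐ[k] K)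
    (U : Y.left.Opens) (f : Γ(Y.left, U)) : Prop :=
  ∃ (W : Y.left.Opens) (h : W ≤ U) (h' : W ≤ D.underlying σ⁻¹ ⁻¹ᵁ U),
    Dense (W : Set Y.left) ∧
      Y.left.presheaf.map (homOfLE h').op ((D.underlying σ⁻¹).app U f) =
        Y.left.presheaf.map (homOfLE h).op f

/-- A descent datum is continuous if every rational function on `Y` is defined over a subfield
`L` of `K` finitely generated over `k`, i.e. is fixed by `Aut(K/L)`. -/
def IsContinuous {Y : Over (Spec (.of K))} (D : DescentDatum k Y) : Prop :=
  ∀ (U : Y.left.Opens), Dense (U : Set Y.left) → ∀ f : Γ(Y.left, U),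
    ∃ L : IntermediateField k K, L.FG ∧ ∀ σ ∈ L.fixingSubgroup, D.FixesRational σ U f

end DescentDatum

/-! ### Effectivity -/

variable (k K) in
/-- The morphism `Spec K ⟶ Spec k`. -/
def specBase : Spec (.of K) ⟶ Spec (.of k) :=
  Spec.map (CommRingCat.ofHom (algebraMap k K))

variable (k K) in
/-- The base change functor `X ↦ X ×_k K`. -/
def baseChange : Over (Spec (.of k)) ⥤ Over (Spec (.of K)) :=
  Over.pullback (specBase k K)

theorem specInv_specBase (σ : K ≃ₐ[k] K) : specInv σ ≫ specBase k K = specBase k K := by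
  rw [specInv, specBase, ← Spec.map_comp, ← CommRingCat.ofHom_comp]
  congr 2
  ext x
  simp

/-- The isomorphism `id_X × Spec(σ⁻¹)` of the scheme `X ×_k K`. -/
def twist (X : Over (Spec (.of k))) (σ : K ≃ₐ[k] K) :
    Limits.pullback X.hom (specBase k K) ⟶ Limits.pullback X.hom (specBase k K) :=
  Limits.pullback.lift (Limits.pullback.fst _ _) (Limits.pullback.snd _ _ ≫ specInv σ)
    (by rw [Category.assoc, specInv_specBase, Limits.pullback.condition])

theorem twist_fst (X : Over (Spec (.of k))) (σ : K ≃ₐ[k] K) :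
    twist X σ ≫ Limits.pullback.fst _ _ = Limits.pullback.fst _ _ :=
  Limits.pullback.lift_fst _ _ _

theorem twist_snd (X : Over (Spec (.of k))) (σ : K ≃ₐ[k] K) :
    twist X σ ≫ Limits.pullback.snd _ _ = Limits.pullback.snd _ _ ≫ specInv σ :=
  Limits.pullback.lift_snd _ _ _

theorem twist_mul (X : Over (Spec (.of k))) (σ τ : K ≃ₐ[k] K) :
    twist X (σ * τ) = twist X τ ≫ twist X σ := by
  apply Limits.pullback.hom_ext
  · rw [Category.assoc, twist_fst, twist_fst, twist_fst]
  · rw [Category.assoc, twist_snd, twist_snd, specInv_mul, ← Category.assoc, ← twist_snd X τ,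
      Category.assoc]

theorem twist_one (X : Over (Spec (.of k))) : twist X (1 : K ≃ₐ[k] K) = 𝟙 _ := by
  have h : specInv (1 : K ≃ₐ[k] K) = 𝟙 _ := Spec.map_id _
  apply Limits.pullback.hom_ext
  · rw [twist_fst, Category.id_comp]
  · rw [twist_snd, h, Category.id_comp, Category.comp_id]

/-- The canonical `K`-isomorphism `^σ(X_K) ≅ X_K`. -/
def canonicalIso (X : Over (Spec (.of k))) (σ : K ≃ₐ[k] K) :
    (conj σ).obj ((baseChange k K).obj X) ≅ (baseChange k K).obj X :=
  Over.isoMk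
    { hom := twist X σ
      inv := twist X σ⁻¹
      hom_inv_id := (twist_mul X σ⁻¹ σ).symm.trans (by rw [inv_mul_cancel, twist_one]; rfl)
      inv_hom_id := (twist_mul X σ σ⁻¹).symm.trans (by rw [mul_inv_cancel, twist_one]; rfl) }
    (twist_snd X σ)

/-- The canonical descent datum on `X_K = X ×_k K` for a `k`-scheme `X`. -/
def canonicalDatum (X : Over (Spec (.of k))) : DescentDatum k ((baseChange k K).obj X) where
  φ := canonicalIso X
  cocycle σ τ := by
    apply Over.OverMorphism.ext
    change 𝟙 _ ≫ twist X (σ * τ) = twist X τ ≫ twist X σ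
    rw [twist_mul, Category.id_comp]

/-- Let `X_α` be `K`-schemes, `f_β : X_{s β} ⟶ X_{t β}` morphisms between them and `D_α` descent
data on the `X_α`. The descent datum on the whole family is effective if it is continuous and comes
from a family over `k`: there are `k`-schemes `X₀_α` and `K`-isomorphisms `X₀_α ×_k K ≅ X_α`
carrying the canonical descent data to the `D_α`, such that each `f_β` is the base change of a
morphism of `k`-schemes `X₀_{s β} ⟶ X₀_{t β}`. -/
def IsEffective {A : Type*} {B : Type*} {X : A → Over (Spec (.of K))} {s t : B → A}
    (f : ∀ β, X (s β) ⟶ X (t β)) (D : ∀ α, DescentDatum k (X α)) : Prop :=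
  (∀ α, (D α).IsContinuous) ∧
    ∃ (X₀ : A → Over (Spec (.of k))) (e : ∀ α, (baseChange k K).obj (X₀ α) ≅ X α),
      (∀ α, (canonicalDatum (X₀ α)).Commutes (D α) (e α).hom) ∧
      ∀ β, ∃ g : X₀ (s β) ⟶ X₀ (t β),
        (baseChange k K).map g ≫ (e (t β)).hom = (e (s β)).hom ≫ f β

end

end WeilDescent

end

open Limits

/-! Fix `α`. The product of the finite groups `Aut (X a)`, each discrete, is compact and the
commutation conditions are closed, so finitely many `f β` already force the component at `α` to be
trivial (`exists_finset_of_forall_eq_one`). The problem becomes one about a finite family, which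
spreads out to a model `Y` over a finitely generated `k`-algebra `B ⊆ K` (`exists_model_family`).

The heart is `exists_isPullback_forall_isAlgebraic`. Choose `σ` moving a transcendence basis of `B`
to elements independent of `B`. The single isomorphism given by the descent datum at `σ` identifies
the base changes of `Y` along the inclusion `B → K` and along `σ : B → K`, already over a finitely
generated algebra `C` containing `B` and `σ(B)`. Now specialise `C → K`, fixing `B` and sending
`σ(B)` to algebraic elements (`exists_algEquiv_specialization`). The first base change remains `X`,
the second becomes a scheme defined over a finite extension of `k`; hence `X` is defined over a
finite normal extension `k'`, and no continuity was needed.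

For `τ` fixing `k'`, the given isomorphism and the canonical one of the model differ by
automorphisms commuting with the morphisms, hence trivial at `α`. So over `k'` the datum is the
canonical one, and descent from `k'` to `k` is a finite problem: orbits lie in affine open subsets
because `X` is quasi-projective, a trace argument shows that constants and invariants generate the
rings of stable affine open subsets (`mem_closure_of_forall_fixingSubgroup`), Artin's argument makes
these rings base changes of their invariants, and the quotients glue
(`exists_isPullback_of_isGood`). All this rests on the fixed field of `Aut(K/k)` being `k`.

A morphism compatible with the data descends because the graphs of the `φ σ` are schematically dense
in the self-product of `X` over the descended scheme (`exists_comp_eq_of_isSemilinear`). Continuity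
comes last: a function on a base change involves only finitely many elements of `K`. -/

noncomputable section

/-! ### Automorphisms and specialisations of an algebraically closed field -/

/-- Over a transcendence basis of an algebraically closed field, a ring automorphism of the base
and a permutation of the basis extend to an automorphism of the field. -/
theorem IsTranscendenceBasis.exists_ringEquiv {R K ι : Type*} [CommRing R] [Field K] [Algebra R K]
    [IsAlgClosed K] {v : ι → K} (hv : IsTranscendenceBasis R v) (τ : R ≃+* R) (e : ι ≃ ι) :
    ∃ σ : K ≃+* K, (∀ r, σ (algebraMap R K r) = algebraMap R K (τ r)) ∧ ∀ i, σ (v i) = v (e i) := by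
  have := IsAlgClosed.isAlgClosure_of_transcendence_basis v hv
  have := hv.1.algebraMap_injective.isDomain (algebraMap R K)
  let a := hv.1.aevalEquiv
  -- `K` is an algebraic closure of the polynomial ring on `v`, so this automorphism (`τ` on
  -- coefficients, `e` on variables) extends to `K`.
  let m : Algebra.adjoin R (Set.range v) ≃+* Algebra.adjoin R (Set.range v) :=
    a.symm.toRingEquiv.trans (((MvPolynomial.mapEquiv ι τ).trans
      (MvPolynomial.renameEquiv R e).toRingEquiv).trans a.toRingEquiv)
  have key : ∀ p : MvPolynomial ι R, IsAlgClosure.equivOfEquiv K K m (MvPolynomial.aeval v p) =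
      MvPolynomial.aeval v (MvPolynomial.rename e (MvPolynomial.map (τ : R →+* R) p)) := by
    intro p
    have h1 : ∀ p, algebraMap (Algebra.adjoin R (Set.range v)) K (a p) = MvPolynomial.aeval v p :=
      fun p ↦ hv.1.algebraMap_aevalEquiv p
    rw [← h1, ← h1, IsAlgClosure.equivOfEquiv_algebraMap]
    congr 1
    simp [m]
  refine ⟨IsAlgClosure.equivOfEquiv K K m, fun r ↦ ?_, fun i ↦ ?_⟩
  · simpa using key (MvPolynomial.C r)
  · simpa using key (MvPolynomial.X i)

/-- An `F`-valued point of `D ⊆ K` extends to the elements of `K` that become elements of `D` after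
multiplication by a fixed element at which the point does not vanish. -/
theorem AlgHom.exists_extend_of_ne_zero {F D K : Type*} [Field F] [CommRing D] [Field K]
    [Algebra F D] [Algebra F K] (i : D →ₐ[F] K) (hi : Function.Injective i) (ρ : D →ₐ[F] F)
    {η : D} (hη : ρ η ≠ 0) :
    ∃ (C : Subalgebra F K) (π : C →ₐ[F] F), (∀ d, ∃ h : i d ∈ C, π ⟨i d, h⟩ = ρ d) ∧
      ∀ x d, i η * x = i d → x ∈ C := by
  have hη0 : i η ≠ 0 := by
    rw [map_ne_zero_iff i hi]
    rintro rfl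
    simp at hη
  have hj' (y : Submonoid.powers η) : IsUnit (i y) := by
    obtain ⟨_, n, rfl⟩ := y
    rw [map_pow]
    exact (isUnit_iff_ne_zero.mpr hη0).pow n
  have hρ' (y : Submonoid.powers η) : IsUnit (ρ y) := by
    obtain ⟨_, n, rfl⟩ := y
    rw [map_pow]
    exact (isUnit_iff_ne_zero.mpr hη).pow n
  let j : Localization.Away η →ₐ[F] K := IsLocalization.liftAlgHom (f := i) hj'
  let ρL : Localization.Away η →ₐ[F] F := IsLocalization.liftAlgHom (f := ρ) hρ'
  have hjD (d : D) : j (algebraMap D _ d) = i d := IsLocalization.lift_eq hj' d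
  have hρD (d : D) : ρL (algebraMap D _ d) = ρ d := IsLocalization.lift_eq hρ' d
  -- Injectivity identifies the localisation at `η` with a subalgebra of `K`; that subalgebra is
  -- `C`.
  have hj : Function.Injective j := by
    rw [injective_iff_map_eq_zero]
    intro x hx
    obtain ⟨⟨d, m⟩, hm⟩ := IsLocalization.surj (Submonoid.powers η) x
    have h4 := congrArg j hm
    rw [map_mul, hx, zero_mul, hjD] at h4
    have hd : d = 0 := hi (by rw [map_zero]; exact h4.symm)
    rw [hd, map_zero] at hm
    exact (IsLocalization.map_units _ m).mul_left_eq_zero.mp hm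
  refine ⟨j.range, ρL.comp (AlgEquiv.ofInjective j hj).symm.toAlgHom, fun d ↦ ?_, fun x d hx ↦ ?_⟩
  · refine ⟨⟨_, hjD d⟩, ?_⟩
    have : (AlgEquiv.ofInjective j hj).symm ⟨i d, ⟨_, hjD d⟩⟩ = algebraMap D _ d := by
      rw [AlgEquiv.symm_apply_eq]
      exact Subtype.ext (hjD d).symm
    change ρL ((AlgEquiv.ofInjective j hj).symm _) = _
    rw [this, hρD]
  · let m : Submonoid.powers η := ⟨η, 1, pow_one η⟩
    refine ⟨IsLocalization.mk' _ d m, mul_left_cancel₀ hη0 ?_⟩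
    have h7 := congrArg j (IsLocalization.mk'_spec (Localization.Away η) d m)
    rw [map_mul, hjD, hjD, mul_comm] at h7
    rw [hx]
    exact h7

/-- Specialisation: elements of `K` can be evaluated at suitable values of a transcendence basis. -/
theorem IsTranscendenceBasis.exists_specialization {F K ι : Type*} [Field F] [IsAlgClosed F]
    [Field K] [Algebra F K] {w : ι → K} (hw : IsTranscendenceBasis F w) {S : Set F}
    (hS : S.Infinite) {h₀ : MvPolynomial ι F} (h₀0 : h₀ ≠ 0) (s : Finset K) :
    ∃ a : ι → F, (∀ i, a i ∈ S) ∧ MvPolynomial.eval a h₀ ≠ 0 ∧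
      ∃ (C : Subalgebra F K) (π : C →ₐ[F] F), (s : Set K) ⊆ C ∧
        ∀ i, ∃ hi : w i ∈ C, π ⟨w i, hi⟩ = a i := by
  classical
  have halg := hw.isAlgebraic
  let e := hw.1.aevalEquiv
  let P := Algebra.adjoin F (Set.range w)
  have hx : ∀ x : K, ∃ h : MvPolynomial ι F, h ≠ 0 ∧ IsIntegral P (MvPolynomial.aeval w h * x) := by
    intro x
    obtain ⟨y, hy, hy'⟩ := (halg.isAlgebraic x).exists_integral_multiple
    refine ⟨e.symm y, by simpa using hy, ?_⟩
    have : MvPolynomial.aeval w (e.symm y) = (y : K) := by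
      have := hw.1.algebraMap_aevalEquiv (e.symm y)
      rw [← this]; simp [e]
    rw [this]
    exact hy'
  choose h hh hint using hx
  -- Where `H` does not vanish, all denominators making the elements of `s` integral can be
  -- inverted.
  let H := h₀ * ∏ x ∈ s, h x
  have hH : H ≠ 0 := mul_ne_zero h₀0 (Finset.prod_ne_zero_iff.mpr fun x _ ↦ hh x)
  obtain ⟨a, haS, haH⟩ : ∃ a : ι → F, (∀ i, a i ∈ S) ∧ MvPolynomial.eval a H ≠ 0 := by
    by_contra! hcon
    exact hH (MvPolynomial.funext_set (fun _ ↦ S) (fun _ ↦ hS) fun x hx ↦ by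
      simpa using hcon x fun i ↦ hx i trivial)
  refine ⟨a, haS, fun h0 ↦ haH (by simp [H, h0]), ?_⟩
  let ev : P →ₐ[F] F := (MvPolynomial.aeval a).comp e.symm.toAlgHom
  have hev : ∀ p, ev (e p) = MvPolynomial.eval a p := by
    intro p; simp [ev, MvPolynomial.aeval_eq_eval]
  have hevs : Function.Surjective ev := fun c ↦ ⟨algebraMap F P c, by simp⟩
  have hmax : (RingHom.ker ev).IsMaximal := RingHom.ker_isMaximal_of_surjective ev hevs
  let D := integralClosure P K
  have hPD : Function.Injective (algebraMap P D) := fun p q hpq ↦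
    Subtype.ext (congrArg (fun d : D ↦ (d : K)) hpq)
  have hker : RingHom.ker (algebraMap P D) ≤ RingHom.ker ev := by
    rw [(RingHom.injective_iff_ker_eq_bot _).mp hPD]
    exact bot_le
  -- Lying over extends the evaluation at `a` to the integral closure `D`: the residue field `D ⧸ M`
  -- is algebraic over the algebraically closed `F`, hence equal to it.
  obtain ⟨M, hM, hMc⟩ := Ideal.exists_ideal_over_maximal_of_isIntegral (S := D) _ hker
  let : Field (D ⧸ M) := Ideal.Quotient.field M
  let : Algebra F D := ((algebraMap P D).comp (algebraMap F P)).toAlgebra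
  have tow : IsScalarTower F P D := IsScalarTower.of_algebraMap_eq fun _ ↦ rfl
  have tow2 : IsScalarTower F D K := IsScalarTower.of_algebraMap_eq fun _ ↦ rfl
  have hPm : ∀ p : P, algebraMap D (D ⧸ M) (algebraMap P D p) =
      algebraMap F (D ⧸ M) (ev p) := by
    intro p
    have : p - algebraMap F P (ev p) ∈ Ideal.comap (algebraMap P D) M := by
      rw [hMc]; simp [RingHom.mem_ker]
    have h2 : algebraMap D (D ⧸ M) (algebraMap P D (p - algebraMap F P (ev p))) = 0 :=
      Ideal.Quotient.eq_zero_iff_mem.mpr this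
    rw [map_sub, map_sub, sub_eq_zero] at h2
    rw [h2]; rfl
  have : Algebra.IsIntegral F (D ⧸ M) := by
    refine ⟨fun q ↦ ?_⟩
    obtain ⟨d, rfl⟩ := Ideal.Quotient.mk_surjective q
    obtain ⟨f, hf, hfd⟩ := Algebra.IsIntegral.isIntegral (R := P) d
    refine ⟨f.map ev.toRingHom, hf.map _, ?_⟩
    have h3 := congrArg (algebraMap D (D ⧸ M)) hfd
    rw [Polynomial.hom_eval₂, map_zero] at h3
    rw [Polynomial.eval₂_map]
    have h8 : (algebraMap F (D ⧸ M)).comp (ev : P →+* F) =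
        (algebraMap D (D ⧸ M)).comp (algebraMap P D) := RingHom.ext fun p ↦ (hPm p).symm
    exact (congrArg (fun g ↦ Polynomial.eval₂ g _ f) h8).trans h3
  have hbij := IsAlgClosed.algebraMap_bijective_of_isIntegral (k := F) (K := D ⧸ M)
  let r : (D ⧸ M) ≃ₐ[F] F := (AlgEquiv.ofBijective (Algebra.ofId F (D ⧸ M)) hbij).symm
  let ρ : D →ₐ[F] F := r.toAlgHom.comp (Ideal.Quotient.mkₐ F M)
  have hρ : ∀ p : P, ρ (algebraMap P D p) = ev p := by
    intro p
    change r (algebraMap D (D ⧸ M) (algebraMap P D p)) = _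
    rw [hPm]; simp
  let η : D := algebraMap P D (e H)
  have hη : ρ η ≠ 0 := by rw [hρ, hev]; exact haH
  have hηK : (η : K) = MvPolynomial.aeval w H := hw.1.algebraMap_aevalEquiv H
  obtain ⟨C, π, hC, hCx⟩ := AlgHom.exists_extend_of_ne_zero (IsScalarTower.toAlgHom F D K)
    Subtype.val_injective ρ hη
  refine ⟨C, π, fun x hxs ↦ ?_, fun i ↦ ?_⟩
  · obtain ⟨q, hq⟩ : h x ∣ H := Dvd.dvd.mul_left (Finset.dvd_prod_of_mem h hxs) h₀
    have hDx : (η : K) * x = (algebraMap P D (e q) : D) * (MvPolynomial.aeval w (h x) * x) := by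
      have h6 : ((algebraMap P D (e q) : D) : K) = MvPolynomial.aeval w q :=
        hw.1.algebraMap_aevalEquiv q
      rw [hηK, h6, hq, map_mul]
      ring
    exact hCx x (algebraMap P D (e q) * (⟨_, hint x⟩ : D)) hDx
  · obtain ⟨hi, hπ⟩ := hC (algebraMap P D (e (MvPolynomial.X i)))
    have hwi : IsScalarTower.toAlgHom F D K (algebraMap P D (e (MvPolynomial.X i))) = w i :=
      (hw.1.algebraMap_aevalEquiv _).trans (MvPolynomial.aeval_X _ _)
    simp only [hwi] at hi hπ
    exact ⟨hi, by rw [hπ, hρ, hev, MvPolynomial.eval_X]⟩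

/-- The field fixed by all automorphisms of an algebraically closed field of infinite transcendence
degree over a field of characteristic zero is the base field. -/
theorem mem_range_algebraMap_of_forall_algEquiv {k K : Type u} [Field k] [CharZero k] [Field K]
    [IsAlgClosed K] [Algebra k K] (htr : Cardinal.aleph0 ≤ Algebra.trdeg k K) {x : K}
    (hx : ∀ σ : K ≃ₐ[k] K, σ x = x) : x ∈ Set.range (algebraMap k K) := by
  classical
  -- An algebraic element is moved by Galois theory, every automorphism of the algebraic closure of
  -- `k` extending to `K`. A transcendental one belongs to a transcendence basis and is swapped with
  -- another member.
  by_cases hxa : IsAlgebraic k x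
  · have : CharZero K := charZero_of_injective_algebraMap (algebraMap k K).injective
    let F := algebraicClosure k K
    have : IsAlgClosure k F := algebraicClosure.isAlgClosure k K
    have hxF : x ∈ F := mem_algebraicClosure_iff'.mpr hxa.isIntegral
    have : IsGalois k F := {}
    obtain ⟨ι, v, hv⟩ := exists_isTranscendenceBasis' F K
    obtain ⟨y, hy⟩ := (InfiniteGalois.mem_range_algebraMap_iff_fixed (k := k) (K := F)
      ⟨x, hxF⟩).mpr fun τ ↦ by
        obtain ⟨σ, hσ, -⟩ := hv.exists_ringEquiv τ.toRingEquiv (Equiv.refl ι)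
        have h1 := hx (AlgEquiv.ofRingEquiv (f := σ) fun c ↦ by
          rw [IsScalarTower.algebraMap_apply k F K, hσ]
          exact congrArg _ (τ.commutes c))
        refine Subtype.ext ((hσ ⟨x, hxF⟩).symm.trans ?_)
        exact h1
    exact ⟨y, congrArg (fun z : F ↦ (z : K)) hy⟩
  · have hxi : AlgebraicIndepOn k id ({x} : Set K) := by
      rw [AlgebraicIndepOn]
      exact (algebraicIndependent_singleton_iff (⟨x, rfl⟩ : ({x} : Set K))).mpr hxa
    obtain ⟨T, hxT, hT⟩ := exists_isTranscendenceBasis_superset hxi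
    have hTinf : Infinite T := by
      rw [Cardinal.infinite_iff, hT.cardinalMk_eq_trdeg]
      exact htr
    obtain ⟨y, hy⟩ := exists_ne (⟨x, hxT rfl⟩ : T)
    obtain ⟨σ, hσ, hσT⟩ := hT.exists_ringEquiv (RingEquiv.refl k) (Equiv.swap ⟨x, hxT rfl⟩ y)
    have h1 := hx (AlgEquiv.ofRingEquiv (f := σ) hσ)
    have h2 := hσT ⟨x, hxT rfl⟩
    rw [Equiv.swap_apply_left] at h2
    exact absurd (Subtype.ext (h2.symm.trans h1) : y = ⟨x, hxT rfl⟩) hy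


/-- Permutations act highly transitively, and the complement of `s` has room for `s`. This serves to
move finitely many members of a transcendence basis away from themselves. -/
theorem Equiv.Perm.exists_forall_notMem {α : Type*} [Infinite α] (s : Finset α) :
    ∃ e : Equiv.Perm α, ∀ x ∈ s, e x ∉ s := by
  classical
  let x : Fin s.card ↪ α := s.equivFin.symm.toEmbedding.trans (Function.Embedding.subtype _)
  have hinf : Infinite {a // a ∉ s} := s.finite_toSet.infinite_compl.to_subtype
  let y : Fin s.card ↪ α := (Fin.valEmbedding.trans (Infinite.natEmbedding {a // a ∉ s})).trans
    (Function.Embedding.subtype _)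
  obtain ⟨g, hg⟩ := (Equiv.Perm.isMultiplyPretransitive α s.card).exists_smul_eq x y
  refine ⟨g, fun a ha ↦ ?_⟩
  have h1 := DFunLike.congr_fun hg (s.equivFin ⟨a, ha⟩)
  have h2 : g a = y (s.equivFin ⟨a, ha⟩) := by
    rw [← h1]
    simp [x]
  rw [h2]
  exact ((Infinite.natEmbedding {a // a ∉ s}) _).2

/-- Take for `F` the algebraic closure in `K` of the field generated by the part of the basis
indexed by `s`. A specialisation of the other basis elements over `F` then leaves everything
algebraic over that part untouched. -/
theorem IsTranscendenceBasis.exists_intermediateField_isAlgClosed {k K ι : Type*} [Field k]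
    [Field K] [IsAlgClosed K] [Algebra k K] {v : ι → K} (hv : IsTranscendenceBasis k v)
    (s : Set ι) : ∃ F : IntermediateField k K, IsAlgClosed F ∧
      (∀ x, IsAlgebraic (Algebra.adjoin k (v '' s)) x → x ∈ F) ∧
      IsTranscendenceBasis F fun i : (sᶜ : Set ι) ↦ v i := by
  let F₀ := algebraicClosure (IntermediateField.adjoin k (v '' s)) K
  let F : IntermediateField k K := F₀.restrictScalars k
  have hF : IsAlgClosed F :=
    (algebraicClosure.isAlgClosure (IntermediateField.adjoin k (v '' s)) K).1
  have hmem : ∀ x, IsAlgebraic (Algebra.adjoin k (v '' s)) x → x ∈ F := fun x hx ↦ by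
    rw [← IntermediateField.isAlgebraic_adjoin_iff] at hx
    exact mem_algebraicClosure_iff.mpr hx
  have h1 : AlgebraicIndependent F₀ fun i : (sᶜ : Set ι) ↦ v i :=
    (IntermediateField.algebraicIndependent_adjoin_iff.mpr
      (hv.1.adjoin_of_disjoint (disjoint_compl_right (a := s)))).algebraicClosure
  replace h1 : AlgebraicIndependent F fun i : (sᶜ : Set ι) ↦ v i := h1
  clear_value F
  refine ⟨F, hF, hmem, ?_⟩
  rw [h1.isTranscendenceBasis_iff_isAlgebraic]
  have halg := hv.isAlgebraic
  let E := Algebra.adjoin F (Set.range fun i : (sᶜ : Set ι) ↦ v i)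
  have hle : Algebra.adjoin k (Set.range v) ≤ (E.restrictScalars k) := by
    refine Algebra.adjoin_le ?_
    rintro _ ⟨i, rfl⟩
    by_cases hi : i ∈ s
    · have h2 : v i ∈ Algebra.adjoin k (v '' s) := Algebra.subset_adjoin ⟨i, hi, rfl⟩
      have h3 : v i ∈ F := hmem _ (isAlgebraic_algebraMap (⟨_, h2⟩ : Algebra.adjoin k (v '' s)))
      have h4 : algebraMap F K ⟨v i, h3⟩ ∈ E := E.algebraMap_mem _
      exact Subalgebra.mem_restrictScalars (R := k) |>.mpr h4
    · have h4 : v i ∈ E := Algebra.subset_adjoin ⟨⟨i, hi⟩, rfl⟩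
      exact Subalgebra.mem_restrictScalars (R := k) |>.mpr h4
  refine ⟨fun x ↦ ?_⟩
  obtain ⟨p, hp, hpx⟩ := halg.isAlgebraic x
  let j : Algebra.adjoin k (Set.range v) →+* E := (Subalgebra.inclusion hle).toRingHom
  have hj : Function.Injective j := Subalgebra.inclusion_injective hle
  refine ⟨p.map j, by rwa [Ne, Polynomial.map_eq_zero_iff hj], ?_⟩
  rw [Polynomial.aeval_def, Polynomial.eval₂_map]
  exact hpx

/-- A finitely generated algebra over `k` inside `K` can be moved by an automorphism of `K` to a
position where it can be specialised to algebraic elements, keeping the original algebra fixed. -/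
theorem exists_algEquiv_specialization {k K : Type u} [Field k] [CharZero k] [Field K]
    [IsAlgClosed K] [Algebra k K] (htr : Cardinal.aleph0 ≤ Algebra.trdeg k K) {B : Subalgebra k K}
    (hB : B.FG) : ∃ σ : K ≃ₐ[k] K, ∀ C : Subalgebra k K, C.FG → ∀ (hBC : B ≤ C)
      (hσC : ∀ b : B, σ b ∈ C), ∃ π : C →ₐ[k] K, (∀ b : B, π ⟨b, hBC b.2⟩ = b) ∧
      ∀ b : B, IsAlgebraic k (π ⟨σ b, hσC b⟩) := by
  classical
  obtain ⟨s, rfl⟩ := hB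
  -- `T₀` is a maximal independent subset of the generators of `B`, extended to a transcendence
  -- basis `T` of `K`. The automorphism will send `T₀` into `T \ T₀`; it is fixed before `C`,
  -- because in the application `C` depends on it.
  obtain ⟨T₀, hT₀⟩ := (AlgebraicIndependent.matroid k K).exists_isBasis (s : Set K)
    (Set.subset_univ _)
  have hT₀s : T₀ ⊆ s := hT₀.subset
  rw [AlgebraicIndependent.matroid_isBasis_iff] at hT₀
  obtain ⟨hind, -, hs⟩ := hT₀
  obtain ⟨T, hT₀T, hT⟩ := exists_isTranscendenceBasis_superset hind
  have hTinf : Infinite T := by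
    rw [Cardinal.infinite_iff, hT.cardinalMk_eq_trdeg]
    exact htr
  have hfin : T₀.Finite := s.finite_toSet.subset hT₀s
  let S : Set T := {t | (t : K) ∈ T₀}
  have hS : S.Finite := hfin.preimage Subtype.val_injective.injOn
  have hST : ((↑) : T → K) '' S = T₀ := by
    ext x
    exact ⟨fun ⟨t, ht, hx⟩ ↦ hx ▸ ht, fun hx ↦ ⟨⟨x, hT₀T hx⟩, hx, rfl⟩⟩
  obtain ⟨e, he⟩ := Equiv.Perm.exists_forall_notMem hS.toFinset
  simp only [Set.Finite.mem_toFinset] at he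
  obtain ⟨σ₀, hσ₀, hσT⟩ := hT.exists_ringEquiv (RingEquiv.refl k) e
  obtain ⟨F, hF, hmem, hw⟩ := hT.exists_intermediateField_isAlgClosed S
  rw [hST] at hmem
  let σ : K ≃ₐ[k] K := AlgEquiv.ofRingEquiv (f := σ₀) hσ₀
  refine ⟨σ, fun C hC hBC hσC ↦ ?_⟩
  -- polynomial relations for the elements of `s`, over the polynomial ring in `S`
  have hp : ∀ x : s, ∃ p : Polynomial (MvPolynomial S k), p ≠ 0 ∧
      Polynomial.eval₂ (MvPolynomial.aeval fun i : S ↦ ((i : T) : K)).toRingHom (x : K) p = 0 := by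
    intro x
    have hSi : AlgebraicIndependent k fun i : S ↦ ((i : T) : K) :=
      hT.1.comp _ Subtype.val_injective
    have hrange : Set.range (fun i : S ↦ ((i : T) : K)) = T₀ := by
      rw [← hST, Set.image_eq_range]
    have hx : IsAlgebraic (Algebra.adjoin k (Set.range (fun i : S ↦ ((i : T) : K)))) (x : K) := by
      rw [hrange]
      exact hs x x.2
    obtain ⟨p, hp, hpx⟩ := hx
    refine ⟨p.map hSi.aevalEquiv.symm.toRingEquiv.toRingHom,
      by rwa [Ne, Polynomial.map_eq_zero_iff hSi.aevalEquiv.symm.injective], ?_⟩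
    rw [Polynomial.eval₂_map]
    refine Eq.trans (congrArg (fun g ↦ Polynomial.eval₂ g _ p) ?_) hpx
    ext y
    have := hSi.algebraMap_aevalEquiv (hSi.aevalEquiv.symm y)
    rw [AlgEquiv.apply_symm_apply] at this
    exact this.symm
  choose p hp hpx using hp
  let f : S → (Sᶜ : Set T) := fun i ↦ ⟨e i, he i i.2⟩
  have hf : Function.Injective f := fun i j hij ↦
    Subtype.ext (e.injective (congrArg Subtype.val hij))
  let m : MvPolynomial S k →+* MvPolynomial (Sᶜ : Set T) F :=
    (MvPolynomial.rename f).toRingHom.comp (MvPolynomial.map (algebraMap k F))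
  have hm : Function.Injective m := (MvPolynomial.rename_injective f hf).comp
    (MvPolynomial.map_injective _ (algebraMap k F).injective)
  have hσm : ∀ q : MvPolynomial S k, σ (MvPolynomial.aeval (fun i : S ↦ ((i : T) : K)) q) =
      MvPolynomial.aeval (fun i : (Sᶜ : Set T) ↦ ((i : T) : K)) (m q) := by
    intro q
    have : ((σ : K →ₐ[k] K).comp (MvPolynomial.aeval fun i : S ↦ ((i : T) : K))).toRingHom =
        (MvPolynomial.aeval (R := F) (fun i : (Sᶜ : Set T) ↦ ((i : T) : K))).toRingHom.comp m := by
      refine MvPolynomial.ringHom_ext (fun r ↦ ?_) fun i ↦ ?_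
      · simp [m]
      · simp [m, f]
        exact hσT i
    exact congrArg (fun g ↦ g q) this
  obtain ⟨t, rfl⟩ := hC
  have hkinf : (Set.range (algebraMap k F)).Infinite :=
    Set.infinite_range_of_injective (algebraMap k F).injective
  -- The variables outside `T₀`, among them `σ(T₀)`, are specialised to values in `k`. The
  -- polynomial `h₀` keeps the leading coefficients of the relations of the `σ x` nonzero.
  obtain ⟨a, ha, ha0, C', π, hC', hπ⟩ := hw.exists_specialization hkinf
    (h₀ := ∏ x : s, m (p x).leadingCoeff)
    (Finset.prod_ne_zero_iff.mpr fun x _ ↦ by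
      rw [Ne, map_eq_zero_iff m hm]
      exact Polynomial.leadingCoeff_ne_zero.mpr (hp x)) t
  choose c hc using ha
  have htC : Algebra.adjoin k (t : Set K) ≤ C'.restrictScalars k := Algebra.adjoin_le hC'
  let π' : Algebra.adjoin k (t : Set K) →ₐ[k] K :=
    (F.val.comp (π.restrictScalars k)).comp (Subalgebra.inclusion htC)
  have hBF : Algebra.adjoin k (s : Set K) ≤ F.toSubalgebra :=
    Algebra.adjoin_le fun x hx ↦ hmem x (hs x hx)
  -- `B` is fixed since it lies in `F` and `π` is `F`-linear. For `σ(B)` it suffices to treat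
  -- generators, as the algebraic elements form a subalgebra.
  refine ⟨π', fun b ↦ ?_, ?_⟩
  · have := π.commutes (⟨b, hBF b.2⟩ : F)
    exact congrArg (fun z : F ↦ (z : K)) this
  · let ψ : Algebra.adjoin k (s : Set K) →ₐ[k] K :=
      π'.comp (((σ : K →ₐ[k] K).comp (Subalgebra.val _)).codRestrict _ hσC)
    change ∀ b, IsAlgebraic k (ψ b)
    have hle : (⊤ : Subalgebra k (Algebra.adjoin k (s : Set K))) ≤
        (integralClosure k K).comap ψ := by
      rw [← Algebra.adjoin_adjoin_coe_preimage, Algebra.adjoin_le_iff]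
      intro x hx
      refine IsAlgebraic.isIntegral ?_
      let x' : s := ⟨x, hx⟩
      let evc : MvPolynomial S k →+* k := MvPolynomial.eval fun i ↦ c (f i)
      have hev : ∀ q, algebraMap k F (evc q) = MvPolynomial.eval a (m q) := by
        intro q
        have : (algebraMap k F).comp evc = (MvPolynomial.eval a).comp m := by
          refine MvPolynomial.ringHom_ext (fun r ↦ ?_) fun i ↦ ?_
          · simp [m, evc]
          · simp [m, evc, hc]
        exact congrArg (fun g ↦ g q) this
      -- The relation of `x` over `k[T₀]`, transported by `σ` and specialised, has coefficients in
      -- `k`.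
      refine ⟨(p x').map evc, fun h0 ↦ ?_, ?_⟩
      · have := congrArg (fun q ↦ q.coeff (p x').natDegree) h0
        simp only [Polynomial.coeff_map, Polynomial.coeff_zero, Polynomial.coeff_natDegree] at this
        refine ha0 ?_
        rw [map_prod]
        refine Finset.prod_eq_zero (Finset.mem_univ x') ?_
        rw [← hev, this, map_zero]
      · have hx0 := hpx x'
        let g : MvPolynomial S k →+* C' := MvPolynomial.eval₂Hom
          ((algebraMap F C').comp (algebraMap k F)) fun i ↦ ⟨_, (hπ (f i)).choose⟩
        have hg1 : (C'.val : C' →+* K).comp g = (σ : K →+* K).comp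
            (MvPolynomial.aeval fun i : S ↦ ((i : T) : K)).toRingHom := by
          refine MvPolynomial.ringHom_ext (fun r ↦ ?_) fun i ↦ ?_
          · simp [g]
          · simp [g, f]
            exact (hσT i).symm
        have hg2 : (π : C' →+* F).comp g = (algebraMap k F).comp evc := by
          refine MvPolynomial.ringHom_ext (fun r ↦ ?_) fun i ↦ ?_
          · simp [g, evc]
          · simp [g, evc]
            rw [hc]
            exact (hπ (f i)).choose_spec
        have hσx : σ x ∈ C' := htC (hσC x)
        have h1 : Polynomial.eval₂ g ⟨σ x, hσx⟩ (p x') = 0 := by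
          refine Subtype.ext ?_
          change (C'.val : C' →+* K) _ = 0
          rw [Polynomial.hom_eval₂, hg1]
          have h2 := congrArg (σ : K →+* K) hx0
          rw [Polynomial.hom_eval₂, map_zero] at h2
          exact h2
        have h3 := congrArg (fun z ↦ ((π : C' →+* F) z : K)) h1
        change F.val.toRingHom ((π : C' →+* F) _) = F.val.toRingHom ((π : C' →+* F) 0) at h3
        rw [Polynomial.hom_eval₂, hg2, Polynomial.hom_eval₂, map_zero, map_zero] at h3
        rw [Polynomial.aeval_def, Polynomial.eval₂_map]
        exact h3
    intro b
    exact IsIntegral.isAlgebraic (hle (Algebra.mem_top (x := b)))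

/-! ### Limits over finitely generated subalgebras and spreading out -/

/-- The directed set of finitely generated subalgebras of an algebra. -/
abbrev FGSubalgebra (R K : Type u) [CommRing R] [CommRing K] [Algebra R K] : Type u :=
  {C : Subalgebra R K // C.FG}

namespace FGSubalgebra

variable {R K : Type u} [CommRing R] [CommRing K] [Algebra R K]

instance : SemilatticeSup (FGSubalgebra R K) :=
  Subtype.semilatticeSup fun {_ _} hx hy ↦ hx.sup hy

instance : OrderBot (FGSubalgebra R K) where
  bot := ⟨⊥, Subalgebra.fg_bot⟩
  bot_le C := (bot_le : ⊥ ≤ C.1)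

theorem exists_mem (x : K) : ∃ C : FGSubalgebra R K, x ∈ C.1 :=
  ⟨⟨Algebra.adjoin R {x}, ⟨{x}, by simp⟩⟩, Algebra.self_mem_adjoin_singleton R x⟩

variable (R K)

/-- The finitely generated subalgebras, as a diagram of rings. -/
@[simps]
def ringDiagram : FGSubalgebra R K ⥤ CommRingCat.{u} where
  obj C := .of C.1
  map f := CommRingCat.ofHom (Subalgebra.inclusion f.le).toRingHom

/-- A ring is the union of its finitely generated subalgebras. -/
def ringCocone : Cocone (ringDiagram R K) where
  pt := .of K
  ι := { app C := CommRingCat.ofHom C.1.val.toRingHom }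

theorem iSup_eq_top : ⨆ C : FGSubalgebra R K, C.1 = ⊤ := by
  refine top_le_iff.mp fun x _ ↦ ?_
  obtain ⟨C, hC⟩ := exists_mem (R := R) x
  exact (le_iSup (fun C : FGSubalgebra R K ↦ C.1) C) hC

/-- A ring is the colimit of its finitely generated subalgebras. -/
def isColimitRingCocone : IsColimit (ringCocone R K) := by
  have key : ∀ s : Cocone (ringDiagram R K), ∃ g : CommRingCat.of K ⟶ s.pt,
      ∀ C : FGSubalgebra R K, (ringCocone R K).ι.app C ≫ g = s.ι.app C := by
    intro s
    let : Algebra R s.pt := ((s.ι.app ⊥).hom.comp (algebraMap R (⊥ : FGSubalgebra R K).1)).toAlgebra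
    let f (C : FGSubalgebra R K) : C.1 →ₐ[R] s.pt :=
      { (s.ι.app C).hom with
        commutes' r := by
          have := s.w (homOfLE (bot_le : ⊥ ≤ C))
          exact (congrArg (fun g ↦ g.hom (algebraMap R (⊥ : FGSubalgebra R K).1 r)) this) }
    have hf : ∀ (C C' : FGSubalgebra R K) (h : C.1 ≤ C'.1),
        f C = (f C').comp (Subalgebra.inclusion h) := by
      intro C C' h
      ext x
      have := s.w (homOfLE (show C ≤ C' from h))
      exact (congrArg (fun g ↦ g.hom x) this).symm
    have hdir : Directed (· ≤ ·) fun C : FGSubalgebra R K ↦ C.1 :=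
      Monotone.directed_le fun _ _ h ↦ h
    let g := Subalgebra.iSupLift (fun C : FGSubalgebra R K ↦ C.1) hdir f hf
      (⊤ : Subalgebra R K) (iSup_eq_top R K).symm.le
    refine ⟨CommRingCat.ofHom (g.comp (Algebra.toTop : K →ₐ[R] _)).toRingHom, fun C ↦ ?_⟩
    ext x
    exact Subalgebra.iSupLift_mk (dir := hdir) (hf := hf) (T := (⊤ : Subalgebra R K)) _ x trivial
  refine ⟨fun s ↦ (key s).choose, fun s ↦ (key s).choose_spec, fun s m hm ↦ ?_⟩
  ext x
  obtain ⟨C, hC⟩ := exists_mem (R := R) (show K from x)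
  have h1 := (hm C).trans ((key s).choose_spec C).symm
  exact congrArg (fun g ↦ g.hom ⟨x, hC⟩) h1

variable {R K}

/-- The morphism `Spec C ⟶ Spec R`. -/
def toSpec (C : FGSubalgebra R K) : Spec (.of C.1) ⟶ Spec (.of R) :=
  Spec.map (CommRingCat.ofHom (algebraMap R C.1))

/-- The morphism `Spec K ⟶ Spec C`. -/
def fromSpec (C : FGSubalgebra R K) : Spec (.of K) ⟶ Spec (.of C.1) :=
  Spec.map (CommRingCat.ofHom C.1.val.toRingHom)

/-- The morphism `Spec C' ⟶ Spec C` for `C ≤ C'`. -/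
def specMap {C C' : FGSubalgebra R K} (h : C ≤ C') : Spec (.of C'.1) ⟶ Spec (.of C.1) :=
  Spec.map (CommRingCat.ofHom (Subalgebra.inclusion h).toRingHom)

@[simp]
theorem specMap_toSpec {C C' : FGSubalgebra R K} (h : C ≤ C') :
    specMap h ≫ C.toSpec = C'.toSpec := by
  rw [specMap, toSpec, ← Spec.map_comp]
  rfl

@[simp]
theorem fromSpec_specMap {C C' : FGSubalgebra R K} (h : C ≤ C') :
    C'.fromSpec ≫ specMap h = C.fromSpec := by
  rw [specMap, fromSpec, ← Spec.map_comp]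
  rfl

@[simp]
theorem specMap_specMap {C C' C'' : FGSubalgebra R K} (h : C ≤ C') (h' : C' ≤ C'') :
    specMap h' ≫ specMap h = specMap (h.trans h') := by
  rw [specMap, specMap, ← Spec.map_comp]
  rfl

@[simp]
theorem specMap_refl (C : FGSubalgebra R K) : specMap (le_refl C) = 𝟙 _ :=
  Spec.map_id _

@[simp]
theorem fromSpec_toSpec (C : FGSubalgebra R K) :
    C.fromSpec ≫ C.toSpec = Spec.map (CommRingCat.ofHom (algebraMap R K)) := by
  rw [fromSpec, toSpec, ← Spec.map_comp]
  rfl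

/-- `Spec` turns the filtered union of subalgebras into a limit of schemes. -/
theorem exists_lift_fromSpec {T : Scheme.{u}} (t : ∀ C : FGSubalgebra R K, T ⟶ Spec (.of C.1))
    (ht : ∀ C C' (h : C ≤ C'), t C' ≫ specMap h = t C) :
    ∃ g : T ⟶ Spec (.of K), ∀ C, g ≫ fromSpec C = t C := by
  let c : Cone ((ringDiagram R K).op ⋙ Scheme.Spec) :=
    { pt := T
      π := { app C := t C.unop
             naturality C C' f := by
              simpa [specMap] using! (ht _ _ f.unop.le).symm } }
  have hl := isLimitOfPreserves Scheme.Spec (isColimitRingCocone R K).op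
  exact ⟨hl.lift c, fun C ↦ hl.fac c (.op C)⟩

theorem hom_ext_fromSpec {T : Scheme.{u}} {g g' : T ⟶ Spec (.of K)}
    (h : ∀ C : FGSubalgebra R K, g ≫ fromSpec C = g' ≫ fromSpec C) : g = g' :=
  (isLimitOfPreserves Scheme.Spec (isColimitRingCocone R K).op).hom_ext fun C ↦ h C.unop

section BaseChange

variable {Y : Scheme.{u}} (f : Y ⟶ Spec (.of R))

/-- The base change of an `R`-scheme to a finitely generated subalgebra. -/
abbrev baseScheme (C : FGSubalgebra R K) : Scheme.{u} := pullback f C.toSpec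

/-- The transition morphisms between the base changes. -/
def baseMap {C C' : FGSubalgebra R K} (h : C ≤ C') : baseScheme f C' ⟶ baseScheme f C :=
  pullback.lift (pullback.fst _ _) (pullback.snd _ _ ≫ specMap h)
    (by rw [Category.assoc, specMap_toSpec, pullback.condition])

@[simp]
theorem baseMap_fst {C C' : FGSubalgebra R K} (h : C ≤ C') :
    baseMap f h ≫ pullback.fst _ _ = pullback.fst _ _ := pullback.lift_fst _ _ _

@[simp]
theorem baseMap_fst_assoc {C C' : FGSubalgebra R K} (h : C ≤ C') {Z : Scheme.{u}} (g : _ ⟶ Z) :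
    baseMap f h ≫ pullback.fst _ _ ≫ g = (pullback.fst _ _) ≫ g := by
  rw [← Category.assoc, baseMap_fst]

@[simp]
theorem baseMap_snd {C C' : FGSubalgebra R K} (h : C ≤ C') :
    baseMap f h ≫ pullback.snd _ _ = pullback.snd _ _ ≫ specMap h := pullback.lift_snd _ _ _

@[simp]
theorem baseMap_snd_assoc {C C' : FGSubalgebra R K} (h : C ≤ C') {Z : Scheme.{u}} (g : _ ⟶ Z) :
    baseMap f h ≫ pullback.snd _ _ ≫ g = pullback.snd _ _ ≫ specMap h ≫ g := by
  rw [← Category.assoc, baseMap_snd, Category.assoc]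

@[simp]
theorem baseMap_baseMap {C C' C'' : FGSubalgebra R K} (h : C ≤ C') (h' : C' ≤ C'') :
    baseMap f h' ≫ baseMap f h = baseMap f (h.trans h') := by
  apply pullback.hom_ext <;> simp

@[simp]
theorem baseMap_baseMap_assoc {C C' C'' : FGSubalgebra R K} (h : C ≤ C') (h' : C' ≤ C'')
    {Z : Scheme.{u}} (g : _ ⟶ Z) :
    baseMap f h' ≫ baseMap f h ≫ g = baseMap f (h.trans h') ≫ g := by
  rw [← Category.assoc, baseMap_baseMap]

theorem isPullback_baseMap {C C' : FGSubalgebra R K} (h : C ≤ C') :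
    IsPullback (baseMap f h) (pullback.snd _ _) (pullback.snd _ _) (specMap h) := by
  refine (IsPullback.of_right (h₁₂ := pullback.fst f C.toSpec) (v₁₃ := f) (h₂₂ := C.toSpec) ?_
    (baseMap_snd f h) (IsPullback.of_hasPullback f C.toSpec))
  rw [baseMap_fst, specMap_toSpec]
  exact IsPullback.of_hasPullback f C'.toSpec

variable (K) in
/-- The base changes to the finitely generated subalgebras, as a diagram of schemes. -/
def baseDiagram : (FGSubalgebra R K)ᵒᵖ ⥤ Scheme.{u} where
  obj C := baseScheme f C.unop
  map g := baseMap f g.unop.le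
  map_id C := by apply pullback.hom_ext <;> simp
  map_comp g g' := by apply pullback.hom_ext <;> simp

instance {C C' : FGSubalgebra R K} (h : C ≤ C') : IsAffineHom (baseMap f h) :=
  MorphismProperty.of_isPullback (isPullback_baseMap f h).flip
    (inferInstanceAs (IsAffineHom (Spec.map _)))

instance {C C' : (FGSubalgebra R K)ᵒᵖ} (g : C ⟶ C') : IsAffineHom ((baseDiagram K f).map g) :=
  inferInstanceAs (IsAffineHom (baseMap f g.unop.le))

variable {f} {X : Scheme.{u}} {a : X ⟶ Y} {hX : X ⟶ Spec (.of K)}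
  (H : IsPullback a hX f (Spec.map (CommRingCat.ofHom (algebraMap R K))))

/-- The projection from the base change to `K` to the base change to a subalgebra. -/
def baseProj (C : FGSubalgebra R K) : X ⟶ baseScheme f C :=
  pullback.lift a (hX ≫ C.fromSpec) (by rw [Category.assoc, fromSpec_toSpec, H.w])

@[simp]
theorem baseProj_fst (C : FGSubalgebra R K) : baseProj H C ≫ pullback.fst _ _ = a :=
  pullback.lift_fst _ _ _

@[simp]
theorem baseProj_fst_assoc (C : FGSubalgebra R K) {Z : Scheme.{u}} (g : _ ⟶ Z) :
    baseProj H C ≫ pullback.fst _ _ ≫ g = a ≫ g := by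
  rw [← Category.assoc, baseProj_fst]

@[simp]
theorem baseProj_snd (C : FGSubalgebra R K) :
    baseProj H C ≫ pullback.snd _ _ = hX ≫ C.fromSpec := pullback.lift_snd _ _ _

@[simp]
theorem baseProj_snd_assoc (C : FGSubalgebra R K) {Z : Scheme.{u}} (g : _ ⟶ Z) :
    baseProj H C ≫ pullback.snd _ _ ≫ g = hX ≫ C.fromSpec ≫ g := by
  rw [← Category.assoc, baseProj_snd, Category.assoc]

@[simp]
theorem baseProj_baseMap {C C' : FGSubalgebra R K} (h : C ≤ C') :
    baseProj H C' ≫ baseMap f h = baseProj H C := by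
  apply pullback.hom_ext <;> simp

@[simp]
theorem baseProj_baseMap_assoc {C C' : FGSubalgebra R K} (h : C ≤ C') {Z : Scheme.{u}} (g : _ ⟶ Z) :
    baseProj H C' ≫ baseMap f h ≫ g = (baseProj H C) ≫ g := by
  rw [← Category.assoc, baseProj_baseMap]

/-- The base change to `K`, as a cone over the base changes to the subalgebras. -/
def baseCone : Cone (baseDiagram K f) where
  pt := X
  π := { app C := baseProj H C.unop
         naturality C C' g := by simp [baseDiagram] }

/-- A morphism to the fibre product `X` is one to `Y`, read off at the least subalgebra, together
with one to `Spec K`, assembled from the components over the subalgebras. -/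
theorem exists_lift_baseProj {T : Scheme.{u}} (y : ∀ C : FGSubalgebra R K, T ⟶ baseScheme f C)
    (hy : ∀ C C' (h : C ≤ C'), y C' ≫ baseMap f h = y C) :
    ∃ g : T ⟶ X, ∀ C, g ≫ baseProj H C = y C := by
  obtain ⟨t, ht⟩ := exists_lift_fromSpec
    (fun C : FGSubalgebra R K ↦ y C ≫ pullback.snd f C.toSpec)
    fun C C' h ↦ by rw [← hy C C' h, Category.assoc, Category.assoc, baseMap_snd]
  refine ⟨H.lift (y ⊥ ≫ pullback.fst _ _) t ?_, fun C ↦ ?_⟩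
  · rw [← fromSpec_toSpec ⊥, reassoc_of% ht, Category.assoc, pullback.condition]
  · apply pullback.hom_ext
    · rw [Category.assoc, baseProj_fst, IsPullback.lift_fst, ← hy ⊥ C bot_le,
        Category.assoc, baseMap_fst]
    · rw [Category.assoc, baseProj_snd, IsPullback.lift_snd_assoc, ht]

theorem hom_ext_baseProj {T : Scheme.{u}} {g g' : T ⟶ X}
    (h : ∀ C, g ≫ baseProj H C = g' ≫ baseProj H C) : g = g' := by
  apply H.hom_ext
  · simpa using h (⊥ : FGSubalgebra R K) =≫ pullback.fst _ _
  · refine hom_ext_fromSpec (R := R) fun C ↦ ?_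
    simpa using h C =≫ pullback.snd _ _

/-- The base change to `K` is the limit of the base changes to finitely generated subalgebras. -/
def isLimitBaseCone : IsLimit (baseCone H) := by
  have key (s : Cone (baseDiagram K f)) :
      ∃ g : s.pt ⟶ X, ∀ C : FGSubalgebra R K, g ≫ baseProj H C = s.π.app (.op C) :=
    exists_lift_baseProj H _ fun C C' h ↦ s.w (homOfLE h).op
  exact ⟨fun s ↦ (key s).choose, fun s C ↦ (key s).choose_spec C.unop, fun s m hm ↦
    hom_ext_baseProj H fun C ↦ (hm (.op C)).trans ((key s).choose_spec C).symm⟩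

section Spread

variable [CompactSpace Y] {S Z : Scheme.{u}} (s : Y ⟶ S) {g : Z ⟶ S}

instance (C : (FGSubalgebra R K)ᵒᵖ) : CompactSpace ((baseDiagram K f).obj C) :=
  inferInstanceAs (CompactSpace (baseScheme f C.unop))

variable (K) (f) in
/-- The structure morphisms of the diagram of base changes over a base of the original scheme. -/
def baseDiagramHom : baseDiagram K f ⟶ (Functor.const _).obj S where
  app C := (pullback.fst f C.unop.toSpec ≫ s : baseScheme f C.unop ⟶ S)
  naturality C C' h := by
    exact (baseMap_fst_assoc f h.unop.le s).trans (Category.comp_id _).symm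

/-- Two morphisms from the base change to a finitely generated subalgebra that agree over `K`
agree over a larger finitely generated subalgebra. -/
theorem exists_baseMap_comp_eq [LocallyOfFiniteType g] {C : FGSubalgebra R K}
    (ρ ρ' : baseScheme f C ⟶ Z) (hρ : ρ ≫ g = pullback.fst _ _ ≫ s)
    (hρ' : ρ' ≫ g = pullback.fst _ _ ≫ s) (h : baseProj H C ≫ ρ = baseProj H C ≫ ρ') :
    ∃ (C' : FGSubalgebra R K) (hC : C ≤ C'), baseMap f hC ≫ ρ = baseMap f hC ≫ ρ' := by
  obtain ⟨C', hC, h'⟩ := Scheme.exists_hom_comp_eq_comp_of_locallyOfFiniteType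
    (baseDiagram K f) (baseDiagramHom K f s) g (baseCone H) (isLimitBaseCone H) (i := .op C)
    ρ ρ' hρ.symm hρ'.symm h
  exact ⟨C'.unop, hC.unop.le, h'⟩

variable [QuasiSeparatedSpace Y]

instance (C : FGSubalgebra R K) : QuasiSeparatedSpace (baseScheme f C) :=
  quasiSeparatedSpace_of_quasiSeparated (pullback.fst f C.toSpec)

instance (C : (FGSubalgebra R K)ᵒᵖ) : QuasiSeparatedSpace ((baseDiagram K f).obj C) :=
  inferInstanceAs (QuasiSeparatedSpace (baseScheme f C.unop))

/-- A morphism from the base change to `K` to a scheme locally of finite presentation is defined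
over a finitely generated subalgebra. -/
theorem exists_baseProj_comp_eq [LocallyOfFinitePresentation g] (b : X ⟶ Z) (hb : b ≫ g = a ≫ s) :
    ∃ (C : FGSubalgebra R K) (ρ : baseScheme f C ⟶ Z),
      baseProj H C ≫ ρ = b ∧ ρ ≫ g = pullback.fst _ _ ≫ s := by
  obtain ⟨C, ρ, h, h'⟩ := Scheme.exists_π_app_comp_eq_of_locallyOfFinitePresentation
    (baseDiagram K f) (baseDiagramHom K f s) g (baseCone H) (isLimitBaseCone H) b (by
      ext C : 2
      exact (baseProj_fst_assoc H C.unop s).trans hb.symm)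
  exact ⟨C.unop, ρ, h, h'⟩

/-- An isomorphism over `K` between two schemes of finite presentation is defined over a
finitely generated subalgebra. -/
theorem exists_isPullback_baseProj_comp_eq [LocallyOfFinitePresentation f] [CompactSpace Z]
    [QuasiSeparatedSpace Z] {g : Z ⟶ Spec (.of R)} [LocallyOfFinitePresentation g] {b : X ⟶ Z}
    (H' : IsPullback b hX g (Spec.map (CommRingCat.ofHom (algebraMap R K)))) :
    ∃ (C : FGSubalgebra R K) (ρ : baseScheme f C ⟶ Z),
      IsPullback ρ (pullback.snd _ _) g C.toSpec ∧ baseProj H C ≫ ρ = b := by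
  have hw : b ≫ g = a ≫ f := H'.w.trans H.w.symm
  obtain ⟨C₁, ρ₁, h₁, h₁'⟩ := exists_baseProj_comp_eq H f b hw
  obtain ⟨C₂, θ₂, h₂, h₂'⟩ := exists_baseProj_comp_eq H' g a hw.symm
  have key (C : FGSubalgebra R K) (h1 : C₁ ≤ C) (h2 : C₂ ≤ C) :
      ∃ (r : baseScheme f C ⟶ baseScheme g C) (t : baseScheme g C ⟶ baseScheme f C),
        r ≫ pullback.fst _ _ = baseMap f h1 ≫ ρ₁ ∧ r ≫ pullback.snd _ _ = pullback.snd _ _ ∧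
        t ≫ pullback.fst _ _ = baseMap g h2 ≫ θ₂ ∧ t ≫ pullback.snd _ _ = pullback.snd _ _ ∧
        baseProj H C ≫ r = baseProj H' C ∧ baseProj H' C ≫ t = baseProj H C := by
    refine ⟨pullback.lift (baseMap f h1 ≫ ρ₁) (pullback.snd _ _) ?_,
      pullback.lift (baseMap g h2 ≫ θ₂) (pullback.snd _ _) ?_, pullback.lift_fst _ _ _,
      pullback.lift_snd _ _ _, pullback.lift_fst _ _ _, pullback.lift_snd _ _ _, ?_, ?_⟩
    · rw [Category.assoc, h₁', baseMap_fst_assoc, pullback.condition]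
    · rw [Category.assoc, h₂', baseMap_fst_assoc, pullback.condition]
    · apply pullback.hom_ext
      · rw [Category.assoc, pullback.lift_fst, baseProj_baseMap_assoc, h₁, baseProj_fst]
      · rw [Category.assoc, pullback.lift_snd, baseProj_snd, baseProj_snd]
    · apply pullback.hom_ext
      · rw [Category.assoc, pullback.lift_fst, baseProj_baseMap_assoc, h₂, baseProj_fst]
      · rw [Category.assoc, pullback.lift_snd, baseProj_snd, baseProj_snd]
  -- The spread-out morphisms are mutually inverse only after base change to `K`; two further
  -- enlargements make each composite the identity.
  obtain ⟨r₀, t₀, hr₀, hr₀', ht₀, ht₀', hrp, htp⟩ := key (C₁ ⊔ C₂) le_sup_left le_sup_right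
  obtain ⟨C₃, h₃, e₃⟩ := exists_baseMap_comp_eq H f (g := f) (r₀ ≫ t₀ ≫ pullback.fst _ _)
    (pullback.fst _ _) (by
      rw [Category.assoc, Category.assoc, pullback.condition, reassoc_of% ht₀', reassoc_of% hr₀'])
    rfl (by rw [reassoc_of% hrp, reassoc_of% htp])
  obtain ⟨C₄, h₄, e₄⟩ := exists_baseMap_comp_eq H' g (g := g) (t₀ ≫ r₀ ≫ pullback.fst _ _)
    (pullback.fst _ _) (by
      rw [Category.assoc, Category.assoc, pullback.condition, reassoc_of% hr₀', reassoc_of% ht₀'])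
    rfl (by rw [reassoc_of% htp, reassoc_of% hrp])
  have h3 : C₁ ⊔ C₂ ≤ C₃ ⊔ C₄ := h₃.trans le_sup_left
  obtain ⟨r, t, hr, hr', ht, ht', hrp', htp'⟩ := key (C₃ ⊔ C₄) (le_sup_left.trans h3)
    (le_sup_right.trans h3)
  have er : r ≫ baseMap g h3 = baseMap f h3 ≫ r₀ := by
    apply pullback.hom_ext
    · rw [Category.assoc, Category.assoc, baseMap_fst, hr, hr₀, baseMap_baseMap_assoc]
    · rw [Category.assoc, Category.assoc, baseMap_snd, reassoc_of% hr', hr₀', baseMap_snd]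
  have et : t ≫ baseMap f h3 = baseMap g h3 ≫ t₀ := by
    apply pullback.hom_ext
    · rw [Category.assoc, Category.assoc, baseMap_fst, ht, ht₀, baseMap_baseMap_assoc]
    · rw [Category.assoc, Category.assoc, baseMap_snd, reassoc_of% ht', ht₀', baseMap_snd]
  have hrt : r ≫ t = 𝟙 _ := by
    apply pullback.hom_ext
    · rw [Category.assoc, ← baseMap_fst f h3, reassoc_of% et, reassoc_of% er,
        ← baseMap_baseMap f h₃ le_sup_left, Category.assoc, e₃]
      simp
    · rw [Category.assoc, ht', hr', Category.id_comp]
  have htr : t ≫ r = 𝟙 _ := by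
    apply pullback.hom_ext
    · rw [Category.assoc, ← baseMap_fst g h3, reassoc_of% er, reassoc_of% et,
        ← baseMap_baseMap g h₄ le_sup_right, Category.assoc, e₄]
      simp
    · rw [Category.assoc, hr', ht', Category.id_comp]
  refine ⟨_, r ≫ pullback.fst _ _, ?_, by rw [reassoc_of% hrp', baseProj_fst]⟩
  refine IsPullback.of_iso_pullback ⟨?_⟩ ⟨r, t, hrt, htr⟩ rfl hr'
  rw [Category.assoc, pullback.condition, reassoc_of% hr']

end Spread

end BaseChange

end FGSubalgebra

open scoped TensorProduct

/-! ### Semilinear actions on algebras -/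

section Algebra

variable {k K R : Type*} [Field k] [Field K] [CommRing R] [Algebra k K] [Algebra K R] [Algebra k R]
  [IsScalarTower k K R] {G : Type*} [Group G] [MulSemiringAction G K]

/-- Fixed elements of a semilinear action that are linearly independent over the fixed field are
linearly independent over the whole field. -/
theorem LinearIndependent.of_semilinear (hK : ∀ x : K, (∀ σ : G, σ • x = x) →
      x ∈ Set.range (algebraMap k K))
    (ρ : G → R →+* R) (hρ : ∀ σ c, ρ σ (algebraMap K R c) = algebraMap K R (σ • c))
    {ι : Type*} {v : ι → R} (hv : LinearIndependent k v) (h0 : ∀ σ i, ρ σ (v i) = v i) :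
    LinearIndependent K v := by
  classical
  rw [linearIndependent_iff']
  intro s
  induction s using Finset.strongInduction with
  | H s ih =>
    intro c hc
    by_contra! hne
    obtain ⟨i₀, hi₀, hci₀⟩ := hne
    -- Artin's argument: with one coefficient normalised to `1`, the difference of the relation and
    -- its conjugate is shorter, so all coefficients are fixed and lie in `k`.
    set d : ι → K := fun i ↦ (c i₀)⁻¹ * c i with hd
    have hd0 : d i₀ = 1 := inv_mul_cancel₀ hci₀
    have hdsum : ∑ i ∈ s, d i • v i = 0 := by
      simp_rw [hd, mul_smul, ← Finset.smul_sum, hc, smul_zero]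
    have hfix : ∀ i ∈ s, ∀ σ : G, σ • d i = d i := by
      intro i hi σ
      have h1 : ∑ i ∈ s, (σ • d i) • v i = 0 := by
        have := congrArg (ρ σ) hdsum
        simpa [Algebra.smul_def, hρ, h0] using this
      have h2 : ∑ i ∈ s.erase i₀, (σ • d i - d i) • v i = 0 := by
        rw [Finset.sum_erase _ (by simp [hd0])]
        simp_rw [sub_smul, Finset.sum_sub_distrib, h1, hdsum, sub_zero]
      by_cases h : i = i₀
      · rw [h, hd0, smul_one]
      · exact sub_eq_zero.mp (ih _ (Finset.erase_ssubset hi₀) _ h2 i (Finset.mem_erase.mpr ⟨h, hi⟩))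
    choose! e he using fun i hi ↦ hK (d i) (hfix i hi)
    have h3 : ∑ i ∈ s, e i • v i = 0 := by
      rw [← hdsum]
      refine Finset.sum_congr rfl fun i hi ↦ ?_
      rw [← he i hi, algebraMap_smul]
    have h4 := linearIndependent_iff'.mp hv s e h3 i₀ hi₀
    have h5 := he i₀ hi₀
    rw [h4, map_zero, hd0] at h5
    exact zero_ne_one h5

/-- An algebra with a semilinear action that is spanned by fixed elements is the base change of
its subalgebra of fixed elements. -/
theorem Algebra.IsPushout.of_semilinear (hK : ∀ x : K, (∀ σ : G, σ • x = x) →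
      x ∈ Set.range (algebraMap k K))
    (ρ : G → R →+* R) (hρ : ∀ σ c, ρ σ (algebraMap K R c) = algebraMap K R (σ • c))
    {R₀ : Type*} [CommRing R₀] [Algebra k R₀] [Algebra R₀ R] [IsScalarTower k R₀ R]
    (hinj : Function.Injective (algebraMap R₀ R))
    (h0 : ∀ σ r, ρ σ (algebraMap R₀ R r) = algebraMap R₀ R r)
    (hspan : Submodule.span K (Set.range (algebraMap R₀ R)) = ⊤) : Algebra.IsPushout k K R₀ R := by
  constructor
  -- A `k`-basis of the fixed ring stays independent over `K` and spans, hence is a `K`-basis of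
  -- `R`.
  let b := Module.Basis.ofVectorSpace k R₀
  let f := (Algebra.linearMap R₀ R).restrictScalars k
  have hli : LinearIndependent K (fun i ↦ algebraMap R₀ R (b i)) :=
    LinearIndependent.of_semilinear hK ρ hρ
      (b.linearIndependent.map' f (LinearMap.ker_eq_bot.mpr hinj)) fun σ i ↦ h0 σ _
  have hsp : ⊤ ≤ Submodule.span K (Set.range fun i ↦ algebraMap R₀ R (b i)) := by
    rw [← hspan, Submodule.span_le]
    rintro _ ⟨r, rfl⟩
    have h1 : r ∈ Submodule.span k (Set.range b) := b.span_eq.symm ▸ trivial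
    have h2 := Submodule.mem_map_of_mem (f := f) h1
    rw [Submodule.map_span, ← Set.range_comp] at h2
    exact Submodule.span_le_restrictScalars k K _ h2
  let e := (b.baseChange K).equiv (Module.Basis.mk hli hsp) (Equiv.refl _)
  have key : (e.toLinearMap.restrictScalars k) ∘ₗ TensorProduct.mk k K R₀ 1 = f := by
    refine b.ext fun i ↦ ?_
    have := (b.baseChange K).equiv_apply i (Module.Basis.mk hli hsp) (Equiv.refl _)
    rw [Module.Basis.baseChange_apply, Module.Basis.mk_apply] at this
    exact this
  exact IsBaseChange.of_equiv e fun x ↦ congrArg (fun g ↦ g x) key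

end Algebra

/-! ### Good open subsets and their quotients -/

section Good

variable {K : Type u} [Field K] {X : Scheme.{u}} (hX : X ⟶ Spec (.of K))
  {G : Type*} (φ : G → (X ⟶ X))

/-- The constant functions on an open subset of a `K`-scheme. -/
def constants (U : X.Opens) : CommRingCat.of K ⟶ Γ(X, U) :=
  (Scheme.ΓSpecIso (.of K)).inv ≫ hX.appLE ⊤ U (le_top.trans_eq hX.preimage_top.symm)

theorem constants_map {U V : X.Opens} (h : V ≤ U) :
    constants hX U ≫ X.presheaf.map (homOfLE h).op = constants hX V := by
  rw [constants, Category.assoc, Scheme.Hom.appLE_map, constants]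

theorem toSpecΓ_map_constants (U : X.Opens) :
    U.toSpecΓ ≫ Spec.map (constants hX U) = U.ι ≫ hX := by
  rw [constants, Spec.map_comp, Scheme.Opens.toSpecΓ_SpecMap_appLE_assoc]
  simp

theorem fromSpec_comp_eq {U : X.Opens} (hU : IsAffineOpen U) :
    hU.fromSpec ≫ hX = Spec.map (constants hX U) := by
  rw [← cancel_epi hU.isoSpec.hom, ← Category.assoc, hU.isoSpec_hom_fromSpec,
    ← toSpecΓ_map_constants, hU.isoSpec_hom]

variable [Group G] [MulSemiringAction G K] in
/-- The condition that a group acts on a `K`-scheme compatibly with its action on `K`. -/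
def IsSemilinear : Prop :=
  ∀ σ, φ σ ≫ hX = hX ≫ Spec.map (CommRingCat.ofHom (MulSemiringAction.toRingHom G K σ⁻¹))

variable {hX φ} [Group G] [MulSemiringAction G K] in
theorem IsSemilinear.constants_appLE (h : IsSemilinear hX φ) (σ : G) (U V : X.Opens)
    (hU : V ≤ φ σ ⁻¹ᵁ U) (c : K) :
    (φ σ).appLE U V hU (constants hX U c) = constants hX V (σ⁻¹ • c) := by
  have : constants hX U ≫ (φ σ).appLE U V hU =
      CommRingCat.ofHom (MulSemiringAction.toRingHom G K σ⁻¹) ≫ constants hX V := by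
    rw [constants, constants, Category.assoc, Scheme.Hom.appLE_comp_appLE,
      Scheme.ΓSpecIso_inv_naturality_assoc]
    simp_rw [h σ]
    exact congrArg (_ ≫ ·) (Scheme.Hom.comp_appLE _ _ ⊤ V _)
  exact congrArg (fun g ↦ g.hom c) this

/-- The sections over an open subset that are fixed by a group of automorphisms. -/
def invariants (U : X.Opens) : Subring Γ(X, U) where
  -- Stability under `σ` is a hypothesis of the condition so that it makes sense for every open
  -- subset; on a good one it always holds.
  carrier := {s | ∀ (σ : G) (h : U ≤ φ σ ⁻¹ᵁ U), (φ σ).appLE U U h s = s}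
  mul_mem' ha hb σ h := by rw [map_mul, ha, hb]
  one_mem' σ h := map_one _
  add_mem' ha hb σ h := by rw [map_add, ha, hb]
  zero_mem' σ h := map_zero _
  neg_mem' ha σ h := by rw [map_neg, ha]

/-- An affine open subset is good for a group of automorphisms if it is stable under the group and
its ring is generated by constants and invariants. -/
structure IsGood (U : X.Opens) : Prop where
  isAffineOpen : IsAffineOpen U
  le_preimage (σ : G) : U ≤ φ σ ⁻¹ᵁ U
  closure_eq_top : Subring.closure (Set.range (constants hX U) ∪ invariants φ U) = ⊤

theorem map_mem_invariants {U V : X.Opens} (h : V ≤ U) (hU : ∀ σ, U ≤ φ σ ⁻¹ᵁ U) {s : Γ(X, U)}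
    (hs : s ∈ invariants φ U) : X.presheaf.map (homOfLE h).op s ∈ invariants φ V := by
  intro σ hσ
  have h1 : X.presheaf.map (homOfLE h).op ≫ (φ σ).appLE V V hσ =
      (φ σ).appLE U U (hU σ) ≫ X.presheaf.map (homOfLE h).op := by
    rw [Scheme.Hom.map_appLE, Scheme.Hom.appLE_map]
  exact (congrArg (fun g ↦ g.hom s) h1).trans (congrArg (fun x ↦ X.presheaf.map (homOfLE h).op x) (hs σ (hU σ)))

theorem IsAffineOpen.isPullback_fromSpec {U V W : X.Opens} (hU : IsAffineOpen U)
    (hV : IsAffineOpen V) (hW : IsAffineOpen W) (h : W = U ⊓ V) :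
    IsPullback (Spec.map (X.presheaf.map (homOfLE (h.le.trans inf_le_left)).op))
      (Spec.map (X.presheaf.map (homOfLE (h.le.trans inf_le_right)).op))
      hU.fromSpec hV.fromSpec := by
  subst h
  refine (isPullback_opens_inf U V).of_iso hW.isoSpec hU.isoSpec hV.isoSpec (Iso.refl _) ?_ ?_ ?_ ?_
  · simp [IsAffineOpen.isoSpec_hom]
  · simp [IsAffineOpen.isoSpec_hom]
  · simp
  · simp

theorem surjective_of_isClosedImmersion_specMap {A B : CommRingCat.{u}} (f : A ⟶ B)
    (hf : IsClosedImmersion (Spec.map f)) : Function.Surjective f := by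
  intro y
  obtain ⟨-, h⟩ := IsClosedImmersion.isAffine_surjective_of_isAffine (Spec.map f)
  obtain ⟨x, hx⟩ := h ((Scheme.ΓSpecIso B).inv y)
  refine ⟨(Scheme.ΓSpecIso A).hom x, ?_⟩
  have := ConcreteCategory.congr_hom (Scheme.ΓSpecIso_naturality f) x
  simp only [CommRingCat.comp_apply] at this
  rw [← this, hx]
  simp

attribute [local instance] Algebra.TensorProduct.rightAlgebra in
/-- On a separated scheme, the ring of the intersection of two affine open subsets is generated by
the restrictions of the sections on the two open subsets. -/
theorem closure_map_union_eq_top (hX : X ⟶ Spec (.of K)) [X.IsSeparated] {U V : X.Opens} (hU : IsAffineOpen U)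
    (hV : IsAffineOpen V) :
    Subring.closure (Set.range (X.presheaf.map (homOfLE (inf_le_left : U ⊓ V ≤ U)).op) ∪
      Set.range (X.presheaf.map (homOfLE (inf_le_right : U ⊓ V ≤ V)).op)) = ⊤ := by
  have hUV : IsAffineOpen (U ⊓ V) := hU.inf hV
  have : IsSeparated hX := inferInstance
  let := (constants hX U).hom.toAlgebra
  let := (constants hX V).hom.toAlgebra
  let := (constants hX (U ⊓ V)).hom.toAlgebra
  let rU : Γ(X, U) →ₐ[K] Γ(X, U ⊓ V) :=
    { (X.presheaf.map (homOfLE (inf_le_left : U ⊓ V ≤ U)).op).hom with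
      commutes' c := ConcreteCategory.congr_hom (constants_map hX (inf_le_left : U ⊓ V ≤ U)) c }
  let rV : Γ(X, V) →ₐ[K] Γ(X, U ⊓ V) :=
    { (X.presheaf.map (homOfLE (inf_le_right : U ⊓ V ≤ V)).op).hom with
      commutes' c := ConcreteCategory.congr_hom (constants_map hX (inf_le_right : U ⊓ V ≤ V)) c }
  let ψ := Algebra.TensorProduct.productMap rU rV
  have hψ : Function.Surjective ψ := by
    have H := IsAffineOpen.isPullback_fromSpec hU hV hUV rfl
    have hfst : (pullbackSpecIso K Γ(X, U) Γ(X, V)).inv ≫ pullback.fst _ _ =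
        Spec.map (CommRingCat.ofHom Algebra.TensorProduct.includeLeftRingHom) :=
      pullbackSpecIso_inv_fst ..
    have hsnd : (pullbackSpecIso K Γ(X, U) Γ(X, V)).inv ≫ pullback.snd _ _ =
        Spec.map (CommRingCat.ofHom (Algebra.TensorProduct.includeRight : _ →ₐ[K] _).toRingHom) :=
      pullbackSpecIso_inv_snd ..
    let m : pullback (Spec.map (CommRingCat.ofHom (algebraMap K Γ(X, U))))
        (Spec.map (CommRingCat.ofHom (algebraMap K Γ(X, V)))) ⟶
        pullback (hU.fromSpec ≫ hX) (hV.fromSpec ≫ hX) :=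
      (pullback.congrHom (fromSpec_comp_eq hX hU) (fromSpec_comp_eq hX hV)).inv
    -- `U ⊓ V → U ×_K V` is a base change of the diagonal of `X`, hence a closed immersion of affine
    -- schemes, so `ψ` is surjective.
    have key : Spec.map (CommRingCat.ofHom ψ.toRingHom) ≫
        (pullbackSpecIso K Γ(X, U) Γ(X, V)).inv ≫ m = H.isoPullback.hom ≫
          pullback.mapDesc hU.fromSpec hV.fromSpec hX := by
      apply pullback.hom_ext
      · have h1 : m ≫ pullback.fst _ _ = pullback.fst _ _ := by
          simp only [m, pullback.congrHom_inv]
          exact (pullback.lift_fst _ _ _).trans (Category.comp_id _)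
        rw [Category.assoc, Category.assoc, Category.assoc, h1, hfst, pullback.mapDesc,
          pullback.lift_fst, Category.comp_id, IsPullback.isoPullback_hom_fst, ← Spec.map_comp,
          ← CommRingCat.ofHom_comp]
        congr 2
        ext x
        exact (Algebra.TensorProduct.productMap_left_apply rU rV x)
      · have h1 : m ≫ pullback.snd _ _ = pullback.snd _ _ := by
          simp only [m, pullback.congrHom_inv]
          exact (pullback.lift_snd _ _ _).trans (Category.comp_id _)
        rw [Category.assoc, Category.assoc, Category.assoc, h1, hsnd, pullback.mapDesc,
          pullback.lift_snd, Category.comp_id, IsPullback.isoPullback_hom_snd, ← Spec.map_comp,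
          ← CommRingCat.ofHom_comp]
        congr 2
        ext x
        exact (Algebra.TensorProduct.productMap_right_apply rU rV x)
    have hc : IsClosedImmersion (Spec.map (CommRingCat.ofHom ψ.toRingHom)) := by
      rw [← MorphismProperty.cancel_right_of_respectsIso @IsClosedImmersion _
        ((pullbackSpecIso K Γ(X, U) Γ(X, V)).inv ≫ m), key]
      infer_instance
    exact surjective_of_isClosedImmersion_specMap _ hc
  rw [eq_top_iff]
  rintro x -
  obtain ⟨y, rfl⟩ := hψ x
  induction y with
  | zero => rw [map_zero]; exact zero_mem _
  | add a b ha hb => rw [map_add]; exact add_mem ha hb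
  | tmul a b =>
    rw [Algebra.TensorProduct.productMap_apply_tmul]
    exact mul_mem (Subring.subset_closure (.inl ⟨a, rfl⟩)) (Subring.subset_closure (.inr ⟨b, rfl⟩))


variable {hX φ} in
-- By separatedness the ring of `U ⊓ V` is generated by restrictions from `U` and from `V`, and
-- restriction preserves constants and invariants.
theorem IsGood.inf [X.IsSeparated] {U V : X.Opens} (hU : IsGood hX φ U) (hV : IsGood hX φ V) :
    IsGood hX φ (U ⊓ V) where
  isAffineOpen := hU.isAffineOpen.inf hV.isAffineOpen
  le_preimage σ := le_inf (inf_le_left.trans (hU.le_preimage σ))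
    (inf_le_right.trans (hV.le_preimage σ))
  closure_eq_top := by
    have key {W W' : X.Opens} (h : W' ≤ W) (hW : IsGood hX φ W) :
        Set.range (X.presheaf.map (homOfLE h).op) ⊆
          Subring.closure (Set.range (constants hX W') ∪ invariants φ W') := by
      rintro _ ⟨x, rfl⟩
      have hx : x ∈ Subring.closure (Set.range (constants hX W) ∪ invariants φ W) :=
        hW.closure_eq_top ▸ trivial
      have h1 : Subring.closure (Set.range (constants hX W) ∪ invariants φ W) ≤
          (Subring.closure (Set.range (constants hX W') ∪ invariants φ W')).comap
            (X.presheaf.map (homOfLE h).op).hom := by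
        rw [Subring.closure_le]
        rintro _ (⟨c, rfl⟩ | hy)
        · refine Subring.subset_closure (.inl ⟨c, ?_⟩)
          exact (ConcreteCategory.congr_hom (constants_map hX h) c).symm
        · exact Subring.subset_closure (.inr (map_mem_invariants φ h hW.le_preimage hy))
      exact h1 hx
    rw [eq_top_iff, ← closure_map_union_eq_top hX hU.isAffineOpen hV.isAffineOpen,
      Subring.closure_le]
    exact Set.union_subset (key _ hU) (key _ hV)

/-- The quotient of an open subset by a group of automorphisms, as an affine scheme. -/
abbrev quotientSpec (U : X.Opens) : Scheme.{u} := Spec (.of (invariants φ U))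

/-- The projection from an open subset to its quotient. -/
def quotientProj (U : X.Opens) : U.toScheme ⟶ quotientSpec φ U :=
  U.toSpecΓ ≫ Spec.map (CommRingCat.ofHom (invariants φ U).subtype)

variable {φ} in
/-- The morphism between the quotients of two open subsets. -/
def quotientMap {U V : X.Opens} (h : V ≤ U) (hU : ∀ σ, U ≤ φ σ ⁻¹ᵁ U) :
    quotientSpec φ V ⟶ quotientSpec φ U :=
  Spec.map (CommRingCat.ofHom (((X.presheaf.map (homOfLE h).op).hom.comp
    (invariants φ U).subtype).codRestrict (invariants φ V)
      fun s ↦ map_mem_invariants φ h hU s.2))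

theorem quotientProj_quotientMap {U V : X.Opens} (h : V ≤ U) (hU : ∀ σ, U ≤ φ σ ⁻¹ᵁ U) :
    quotientProj φ V ≫ quotientMap h hU = X.homOfLE h ≫ quotientProj φ U := by
  rw [quotientProj, quotientProj, Category.assoc, quotientMap, ← Spec.map_comp,
    ← Scheme.Opens.toSpecΓ_SpecMap_presheaf_map_assoc, ← Spec.map_comp]
  rfl

theorem quotientMap_quotientMap {U V W : X.Opens} (h : V ≤ U) (h' : W ≤ V)
    (hU : ∀ σ, U ≤ φ σ ⁻¹ᵁ U) (hV : ∀ σ, V ≤ φ σ ⁻¹ᵁ V) :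
    quotientMap h' hV ≫ quotientMap h hU = quotientMap (h'.trans h) hU := by
  rw [quotientMap, quotientMap, ← Spec.map_comp, quotientMap]
  congr 1
  ext s
  exact (ConcreteCategory.congr_hom (X.presheaf.map_comp (homOfLE h).op (homOfLE h').op) s.1).symm

theorem quotientMap_refl {U : X.Opens} (hU : ∀ σ, U ≤ φ σ ⁻¹ᵁ U) :
    quotientMap (le_refl U) hU = 𝟙 _ := by
  rw [quotientMap, ← Spec.map_id]
  congr 1
  ext s
  exact ConcreteCategory.congr_hom (X.presheaf.map_id (.op U)) s.1

theorem resLE_quotientProj {U : X.Opens} (σ : G) (h : U ≤ φ σ ⁻¹ᵁ U) :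
    (φ σ).resLE U U h ≫ quotientProj φ U = quotientProj φ U := by
  rw [quotientProj, ← Scheme.Opens.toSpecΓ_SpecMap_appLE_assoc, ← Spec.map_comp]
  congr 2
  ext s
  exact s.2 σ h

section Base

variable [Group G] [MulSemiringAction G K] {k : Type u} [Field k] [Algebra k K]
  [SMulCommClass G k K]

variable {hX φ} in
theorem IsSemilinear.constants_mem_invariants (h : IsSemilinear hX φ) (U : X.Opens) (c : k) :
    constants hX U (algebraMap k K c) ∈ invariants φ U := by
  intro σ hσ
  rw [h.constants_appLE, smul_algebraMap]

variable {hX φ} in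
/-- The quotient of an open subset is a scheme over the fixed field. -/
def IsSemilinear.quotientHom (h : IsSemilinear hX φ) (U : X.Opens) :
    quotientSpec φ U ⟶ Spec (.of k) :=
  Spec.map (CommRingCat.ofHom (((constants hX U).hom.comp (algebraMap k K)).codRestrict
    (invariants φ U) (h.constants_mem_invariants U)))

variable {hX φ} in
theorem IsSemilinear.quotientMap_quotientHom (h : IsSemilinear hX φ) {U V : X.Opens} (hV : V ≤ U)
    (hU : ∀ σ, U ≤ φ σ ⁻¹ᵁ U) :
    quotientMap hV hU ≫ h.quotientHom (k := k) U = h.quotientHom V := by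
  rw [IsSemilinear.quotientHom, quotientMap, ← Spec.map_comp, IsSemilinear.quotientHom]
  congr 1
  ext c
  exact ConcreteCategory.congr_hom (constants_map hX hV) (algebraMap k K c)

variable {hX φ} in
/-- A good open subset is the base change of its quotient. -/
theorem IsGood.isPullback (h : IsSemilinear hX φ)
    (hK : ∀ x : K, (∀ σ : G, σ • x = x) → x ∈ Set.range (algebraMap k K)) {U : X.Opens}
    (hU : IsGood hX φ U) :
    IsPullback (quotientProj φ U) (U.ι ≫ hX) (h.quotientHom U)
      (Spec.map (CommRingCat.ofHom (algebraMap k K))) := by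
  let R := Γ(X, U)
  let := (constants hX U).hom.toAlgebra
  let := ((constants hX U).hom.comp (algebraMap k K)).toAlgebra
  have : IsScalarTower k K R := .of_algebraMap_eq fun _ ↦ rfl
  let : Algebra k (invariants φ U) := (((constants hX U).hom.comp (algebraMap k K)).codRestrict
    (invariants φ U) (h.constants_mem_invariants U)).toAlgebra
  have : IsScalarTower k (invariants φ U) R := .of_algebraMap_eq fun _ ↦ rfl
  -- The invariants are closed under multiplication, so the `K`-algebra they generate is their
  -- linear span.
  have hspan : Submodule.span K (Set.range (algebraMap (invariants φ U) R)) = ⊤ := by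
    have h1 : (Submonoid.closure (Set.range (algebraMap (invariants φ U) R)) : Set R) =
        Set.range (algebraMap (invariants φ U) R) :=
      congrArg (fun S : Submonoid R ↦ (S : Set R))
        (Submonoid.closure_eq (MonoidHom.mrange (algebraMap (invariants φ U) R)))
    rw [← h1, ← Algebra.adjoin_eq_span, eq_top_iff]
    rintro x -
    have h2 : Subring.closure (Set.range (constants hX U) ∪ invariants φ U) ≤
        (Algebra.adjoin K (Set.range (algebraMap (invariants φ U) R))).toSubring := by
      rw [Subring.closure_le]
      rintro _ (⟨c, rfl⟩ | hy)
      · exact (Algebra.adjoin K _).algebraMap_mem c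
      · exact Algebra.subset_adjoin ⟨⟨_, hy⟩, rfl⟩
    exact h2 (hU.closure_eq_top ▸ trivial)
  have hpush : Algebra.IsPushout k K (invariants φ U) R :=
    Algebra.IsPushout.of_semilinear hK (fun σ : G ↦ ((φ σ⁻¹).appLE U U (hU.le_preimage σ⁻¹)).hom)
      (fun σ c ↦ (h.constants_appLE σ⁻¹ U U (hU.le_preimage σ⁻¹) c).trans (by rw [inv_inv]; rfl))
      Subtype.val_injective (fun σ r ↦ r.2 σ⁻¹ (hU.le_preimage σ⁻¹)) hspan
  have h1 := isPullback_SpecMap_of_isPushout _ _ _ _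
    (CommRingCat.isPushout_of_isPushout k K (invariants φ U) R)
  refine h1.flip.of_iso hU.isAffineOpen.isoSpec.symm (Iso.refl _) (Iso.refl _) (Iso.refl _) ?_ ?_
    ?_ ?_
  · rw [Iso.symm_hom, quotientProj, ← hU.isAffineOpen.isoSpec_hom, Iso.inv_hom_id_assoc]
    exact Category.comp_id _
  · rw [Iso.symm_hom, ← toSpecΓ_map_constants, ← hU.isAffineOpen.isoSpec_hom, Iso.inv_hom_id_assoc]
    exact Category.comp_id _
  · exact (Category.comp_id _).trans (Category.id_comp _).symm
  · exact (Category.comp_id _).trans (Category.id_comp _).symm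

end Base

end Good

/-! ### Flat descent and gluing of the quotients -/

theorem surjective_flat_quasiCompact_specMap (k K : Type u) [Field k] [Field K] [Algebra k K] :
    (@Surjective ⊓ @Flat ⊓ @QuasiCompact : MorphismProperty Scheme.{u})
      (Spec.map (CommRingCat.ofHom (algebraMap k K))) := by
  obtain ⟨h1, h2⟩ := (flat_and_surjective_SpecMap_iff (CommRingCat.ofHom (algebraMap k K))).mpr
    (RingHom.faithfullyFlat_algebraMap_iff.mpr inferInstance)
  exact ⟨⟨h2, h1⟩, inferInstance⟩

theorem schemeHom_congr_apply {X Y : Scheme.{u}} {f g : X ⟶ Y} (h : f = g) (x : X) : f x = g x :=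
  h ▸ rfl

theorem surjective_flat_quasiCompact_of_isPullback {k K : Type u} [Field k] [Field K] [Algebra k K]
    {X X₀ : Scheme.{u}} {p : X ⟶ X₀} {hX : X ⟶ Spec (.of K)} {hX₀ : X₀ ⟶ Spec (.of k)}
    (H : IsPullback p hX hX₀ (Spec.map (CommRingCat.ofHom (algebraMap k K)))) :
    (@Surjective ⊓ @Flat ⊓ @QuasiCompact : MorphismProperty Scheme.{u}) p :=
  have h := surjective_flat_quasiCompact_specMap k K
  ⟨⟨MorphismProperty.of_isPullback H.flip h.1.1, MorphismProperty.of_isPullback H.flip h.1.2⟩,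
    MorphismProperty.of_isPullback H.flip h.2⟩

theorem exists_preimage_of_isPullback {P X Y Z : Scheme.{u}} {fst : P ⟶ X} {snd : P ⟶ Y}
    {f : X ⟶ Z} {g : Y ⟶ Z} (H : IsPullback fst snd f g) {x : X} {y : Y} (hxy : f x = g y) :
    ∃ z, fst z = x ∧ snd z = y := by
  obtain ⟨z, rfl, rfl⟩ := Scheme.Pullback.exists_preimage_pullback x y hxy
  refine ⟨H.isoPullback.inv z, ?_, ?_⟩
  · rw [← Scheme.Hom.comp_apply, H.isoPullback_inv_fst]
  · rw [← Scheme.Hom.comp_apply, H.isoPullback_inv_snd]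

theorem exists_glue_of_isOpenCover {X Y : Scheme.{u}} {I : Type u} {U : I → X.Opens}
    (hU : TopologicalSpace.IsOpenCover U) (f : ∀ i, (U i).toScheme ⟶ Y)
    (hf : ∀ i j, X.homOfLE (inf_le_left : U i ⊓ U j ≤ U i) ≫ f i =
      X.homOfLE (inf_le_right : U i ⊓ U j ≤ U j) ≫ f j) :
    ∃ p : X ⟶ Y, ∀ i, (U i).ι ≫ p = f i := by
  let 𝒰 := Scheme.openCoverOfIsOpenCover X U hU
  have h (i j : I) : pullback.fst (U i).ι (U j).ι ≫ f i = pullback.snd (U i).ι (U j).ι ≫ f j := by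
    rw [← cancel_epi (isPullback_opens_inf (U i) (U j)).isoPullback.hom]
    simpa using hf i j
  exact ⟨𝒰.glueMorphisms f h, fun i ↦ 𝒰.ι_glueMorphisms f h i⟩

theorem hom_ext_of_isOpenCover {X Y : Scheme.{u}} {I : Type u} {U : I → X.Opens}
    (hU : TopologicalSpace.IsOpenCover U) {f g : X ⟶ Y} (h : ∀ i, (U i).ι ≫ f = (U i).ι ≫ g) :
    f = g :=
  (Scheme.openCoverOfIsOpenCover X U hU).hom_ext _ _ h

theorem isPullback_of_isOpenImmersion_cover {X X₀ S T : Scheme.{u}} {p : X ⟶ X₀} {hX : X ⟶ S}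
    {hX₀ : X₀ ⟶ T} {b : S ⟶ T} {I : Type u} {U Q : I → Scheme.{u}} (ι : ∀ i, Q i ⟶ X₀)
    (hι : ∀ i, IsOpenImmersion (ι i)) (hsurj : ∀ x, ∃ i y, ι i y = x) (j : ∀ i, U i ⟶ X)
    (q : ∀ i, U i ⟶ Q i) (hsq : ∀ i, IsPullback (q i) (j i) (ι i) p)
    (H : ∀ i, IsPullback (q i) (j i ≫ hX) (ι i ≫ hX₀) b) : IsPullback p hX hX₀ b := by
  let 𝒰 : X₀.OpenCover :=
    { I₀ := I, X := Q, f := ι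
      mem₀ := by
        rw [Scheme.presieve₀_mem_precoverage_iff]
        exact ⟨hsurj, hι⟩ }
  refine Scheme.isPullback_of_openCover _ _ _ _ 𝒰 fun i ↦ ?_
  let e : U i ≅ pullback p (ι i) := (hsq i).flip.isoPullback
  refine (H i).of_iso e (Iso.refl _) (Iso.refl _) (Iso.refl _) ?_ ?_ ?_ ?_
  · exact (Category.comp_id _).trans (hsq i).flip.isoPullback_hom_snd.symm
  · refine (Category.comp_id _).trans ?_
    refine Eq.trans ?_ (Category.assoc _ _ _)
    exact congrArg (· ≫ hX) (hsq i).flip.isoPullback_hom_fst.symm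
  · exact (Category.comp_id _).trans (Category.id_comp _).symm
  · exact (Category.comp_id _).trans (Category.id_comp _).symm

section Glue

variable {K : Type u} [Field K] {X : Scheme.{u}} {hX : X ⟶ Spec (.of K)}
  {G : Type*} {φ : G → (X ⟶ X)} [Group G] [MulSemiringAction G K] {k : Type u} [Field k]
  [Algebra k K] [SMulCommClass G k K] (h : IsSemilinear hX φ)
  (hK : ∀ x : K, (∀ σ : G, σ • x = x) → x ∈ Set.range (algebraMap k K))

include h hK

/-- Both `U` and `V` are base changes of their quotients along the same `Spec K → Spec k`, so the
square relating them is cartesian by cancellation. -/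
theorem IsGood.isPullback_quotientMap {U V : X.Opens} (hV : IsGood hX φ V) (hU : IsGood hX φ U)
    (hle : V ≤ U) :
    IsPullback (X.homOfLE hle) (quotientProj φ V) (quotientProj φ U)
      (quotientMap hle hU.le_preimage) := by
  refine IsPullback.of_right (h₁₂ := U.ι ≫ hX) (h₂₂ := h.quotientHom (k := k) U)
    (v₁₃ := Spec.map (CommRingCat.ofHom (algebraMap k K))) ?_
    (quotientProj_quotientMap φ hle hU.le_preimage).symm (hU.isPullback h hK).flip
  rw [h.quotientMap_quotientHom, Scheme.homOfLE_ι_assoc]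
  exact (hV.isPullback h hK).flip

theorem IsGood.quotientProj_property {U : X.Opens} (hU : IsGood hX φ U) :
    (@Surjective ⊓ @Flat ⊓ @QuasiCompact : MorphismProperty Scheme.{u}) (quotientProj φ U) :=
  surjective_flat_quasiCompact_of_isPullback (hU.isPullback h hK)

/-- Flat descent: the base change along the covering `U → U/G` is the open immersion `V → U`. -/
theorem IsGood.isOpenImmersion_quotientMap {U V : X.Opens} (hV : IsGood hX φ V)
    (hU : IsGood hX φ U) (hle : V ≤ U) : IsOpenImmersion (quotientMap hle hU.le_preimage) :=
  MorphismProperty.of_isPullback_of_descendsAlong (P := @IsOpenImmersion)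
    (hV.isPullback_quotientMap h hK hU hle) (hU.quotientProj_property h hK) inferInstance

/-- By the cartesian square, `V` is the full preimage in `U` of the image of its quotient. -/
theorem IsGood.mem_of_quotientProj_eq {U V : X.Opens} (hV : IsGood hX φ V) (hU : IsGood hX φ U)
    (hle : V ≤ U) {x : U} {y : quotientSpec φ V}
    (hxy : quotientProj φ U x = quotientMap hle hU.le_preimage y) : x.1 ∈ V := by
  obtain ⟨z, rfl, -⟩ := exists_preimage_of_isPullback (hV.isPullback_quotientMap h hK hU hle) hxy
  have : (X.homOfLE hle z).1 = z.1 := by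
    change U.ι _ = V.ι _
    rw [← Scheme.Hom.comp_apply, Scheme.homOfLE_ι]
  exact this ▸ z.2

/-- Lift the common image to a point of `W`; being in both preimages, it lies in `U ⊓ V`. This is
the local directedness needed to glue along intersections. -/
theorem IsGood.exists_quotientMap_eq [X.IsSeparated] {U V W : X.Opens} (hU : IsGood hX φ U)
    (hV : IsGood hX φ V) (hW : IsGood hX φ W) (hUW : U ≤ W) (hVW : V ≤ W) {x : quotientSpec φ U}
    {y : quotientSpec φ V}
    (hxy : quotientMap hUW hW.le_preimage x = quotientMap hVW hW.le_preimage y) :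
    ∃ z : quotientSpec φ (U ⊓ V), quotientMap inf_le_left hU.le_preimage z = x ∧
      quotientMap inf_le_right hV.le_preimage z = y := by
  obtain ⟨w, hw⟩ := (hW.quotientProj_property h hK).1.1.surj (quotientMap hUW hW.le_preimage x)
  have hwU := hU.mem_of_quotientProj_eq h hK hW hUW hw
  have hwV := hV.mem_of_quotientProj_eq h hK hW hVW (hw.trans hxy)
  let z : (U ⊓ V : X.Opens) := ⟨w.1, hwU, hwV⟩
  have key {U' : X.Opens} (hU' : IsGood hX φ U') (f : U' ≤ W) (g : U ⊓ V ≤ U')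
      (x : quotientSpec φ U') (hx : quotientProj φ W w = quotientMap f hW.le_preimage x) :
      quotientMap g hU'.le_preimage (quotientProj φ (U ⊓ V) z) = x := by
    have := hU'.isOpenImmersion_quotientMap h hK hW f
    apply (quotientMap f hW.le_preimage).isOpenEmbedding.injective
    have h1 : X.homOfLE (g.trans f) z = w :=
      W.ι.isOpenEmbedding.injective (schemeHom_congr_apply (X.homOfLE_ι (g.trans f)) z)
    have h2 : quotientProj φ (U ⊓ V) ≫ quotientMap g hU'.le_preimage ≫
        quotientMap f hW.le_preimage = X.homOfLE (g.trans f) ≫ quotientProj φ W := by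
      rw [quotientMap_quotientMap φ f g hW.le_preimage hU'.le_preimage, quotientProj_quotientMap]
    exact (schemeHom_congr_apply h2 z).trans ((congrArg (quotientProj φ W) h1).trans hx)
  exact ⟨quotientProj φ (U ⊓ V) z, key hU hUW _ _ hw, key hV hVW _ _ (hw.trans hxy)⟩

/-- The quotients of the good open subsets glue. -/
theorem exists_glue_quotientSpec [X.IsSeparated] :
    ∃ (X₀ : Scheme.{u}) (hX₀ : X₀ ⟶ Spec (.of k))
      (ι : ∀ U : {U : X.Opens // IsGood hX φ U}, quotientSpec φ U.1 ⟶ X₀),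
      (∀ U, IsOpenImmersion (ι U)) ∧ (∀ U, ι U ≫ hX₀ = h.quotientHom U.1) ∧
      (∀ U V (hle : V.1 ≤ U.1), quotientMap hle U.2.le_preimage ≫ ι U = ι V) ∧
      (∀ x, ∃ U y, ι U y = x) ∧
      ∀ U V x y, ι U x = ι V y → ∃ (W : {U : X.Opens // IsGood hX φ U}) (hU : W.1 ≤ U.1)
        (hV : W.1 ≤ V.1) (z : quotientSpec φ W.1), quotientMap hU U.2.le_preimage z = x ∧
          quotientMap hV V.2.le_preimage z = y := by
  let F : {U : X.Opens // IsGood hX φ U} ⥤ Scheme.{u} :=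
    { obj U := quotientSpec φ U.1
      map {V U} f := quotientMap (U := U.1) (V := V.1) f.le U.2.le_preimage
      map_id U := quotientMap_refl φ U.2.le_preimage
      map_comp {W V U} f g :=
        (quotientMap_quotientMap φ (U := U.1) (V := V.1) (W := W.1) g.le f.le
          U.2.le_preimage V.2.le_preimage).symm }
  have hF {U V} (f : V ⟶ U) : IsOpenImmersion (F.map f) :=
    V.2.isOpenImmersion_quotientMap h hK U.2 f.le
  have hF' : (F ⋙ Scheme.forget).IsLocallyDirected := by
    constructor
    intro U V W fU fV x y hxy
    have hxy' : quotientMap fU.le W.2.le_preimage x = quotientMap fV.le W.2.le_preimage y := hxy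
    obtain ⟨z, hz, hz'⟩ := U.2.exists_quotientMap_eq h hK V.2 W.2 fU.le fV.le hxy'
    exact ⟨⟨U.1 ⊓ V.1, U.2.inf V.2⟩, homOfLE (inf_le_left : U.1 ⊓ V.1 ≤ U.1),
      homOfLE (inf_le_right : U.1 ⊓ V.1 ≤ V.1), z, hz, hz'⟩
  let c : Cocone F :=
    { pt := Spec (.of k)
      ι := { app U := h.quotientHom U.1
             naturality V U f := by
              exact (h.quotientMap_quotientHom (k := k) f.le U.2.le_preimage).trans
                (Category.comp_id _).symm } }
  refine ⟨colimit F, colimit.desc F c, colimit.ι F, fun U ↦ inferInstance,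
    fun U ↦ colimit.ι_desc c U, fun U V hle ↦ colimit.w F (homOfLE hle),
    Scheme.IsLocallyDirected.ι_jointly_surjective F, fun U V x y hxy ↦ ?_⟩
  obtain ⟨W, hU, hV, z, hz, hz'⟩ := (Scheme.IsLocallyDirected.ι_eq_ι_iff F).mp hxy
  exact ⟨W, hU.le, hV.le, z, hz, hz'⟩


/-- A scheme with a semilinear action that is covered by good open subsets is the base change of a
scheme over the fixed field. -/
theorem exists_isPullback_of_isGood [X.IsSeparated] (hcov : ∀ x : X, ∃ U, IsGood hX φ U ∧ x ∈ U) :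
    ∃ (X₀ : Scheme.{u}) (hX₀ : X₀ ⟶ Spec (.of k)) (p : X ⟶ X₀),
      IsPullback p hX hX₀ (Spec.map (CommRingCat.ofHom (algebraMap k K))) ∧ ∀ σ, φ σ ≫ p = p := by
  obtain ⟨X₀, hX₀, ι, hι, hιX, hιι, hsurj, hinj⟩ := exists_glue_quotientSpec h hK
  let U (i : {U : X.Opens // IsGood hX φ U}) : X.Opens := i.1
  have hU : TopologicalSpace.IsOpenCover U := by
    refine TopologicalSpace.IsOpenCover.mk (top_le_iff.mp fun x _ ↦ ?_)
    obtain ⟨V, hV, hx⟩ := hcov x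
    exact TopologicalSpace.Opens.mem_iSup.mpr ⟨⟨V, hV⟩, hx⟩
  obtain ⟨p, hp⟩ := exists_glue_of_isOpenCover hU (fun i ↦ quotientProj φ i.1 ≫ ι i) fun i j ↦ by
    rw [← reassoc_of% (quotientProj_quotientMap φ (inf_le_left : i.1 ⊓ j.1 ≤ i.1) i.2.le_preimage),
      ← reassoc_of% (quotientProj_quotientMap φ (inf_le_right : i.1 ⊓ j.1 ≤ j.1) j.2.le_preimage),
      hιι i ⟨_, i.2.inf j.2⟩ inf_le_left, hιι j ⟨_, i.2.inf j.2⟩ inf_le_right]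
  -- The preimage under `p` of the chart of a good open subset is that subset and no more; this
  -- makes the squares over the charts cartesian.
  have hmem (i : {U : X.Opens // IsGood hX φ U}) (x : X) (y : quotientSpec φ i.1)
      (hxy : p x = ι i y) : x ∈ i.1 := by
    obtain ⟨V, hV, hx⟩ := hcov x
    have h1 : p x = ι ⟨V, hV⟩ (quotientProj φ V ⟨x, hx⟩) :=
      schemeHom_congr_apply (hp ⟨V, hV⟩) (⟨x, hx⟩ : V.toScheme)
    obtain ⟨W, hWV, hWi, z, hz, -⟩ := hinj ⟨V, hV⟩ i _ y (h1.symm.trans hxy)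
    exact hWi (W.2.mem_of_quotientProj_eq h hK hV hWV (x := ⟨x, hx⟩) hz.symm)
  have hsq (i) : IsPullback (quotientProj φ i.1) (U i).ι (ι i) p := by
    refine IsOpenImmersion.isPullback _ _ _ _ (hp i) ?_
    rw [Scheme.Opens.opensRange_ι]
    ext x
    refine ⟨fun ⟨y, hy⟩ ↦ hmem i x y hy.symm, fun hx ↦ ⟨quotientProj φ i.1 ⟨x, hx⟩, ?_⟩⟩
    exact (schemeHom_congr_apply (hp i) (⟨x, hx⟩ : (U i).toScheme)).symm
  refine ⟨X₀, hX₀, p, isPullback_of_isOpenImmersion_cover ι hι hsurj _ _ hsq fun i ↦ ?_,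
    fun σ ↦ hom_ext_of_isOpenCover hU fun i ↦ ?_⟩
  · rw [hιX]
    exact i.2.isPullback h hK
  · have h1 : (U i).ι ≫ φ σ = (φ σ).resLE (U i) (U i) (i.2.le_preimage σ) ≫ (U i).ι := by simp
    rw [reassoc_of% h1, hp, reassoc_of% (resLE_quotientProj φ σ (i.2.le_preimage σ))]

end Glue

/-! ### From a finite normal extension to the whole automorphism group -/

section Algebra

variable {k K R : Type*} [Field k] [Field K] [CommRing R] [Algebra k K] [Algebra K R]

/-- In the situation of a semilinear action of the automorphism group, an element fixed by the
automorphisms over a finite extension is a combination of fixed elements. -/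
theorem mem_closure_of_forall_fixingSubgroup (k' : IntermediateField k K) [FiniteDimensional k k']
    (L : (K ≃ₐ[k] K) → R →+* R) (hL : ∀ σ c, L σ (algebraMap K R c) = algebraMap K R (σ c))
    (hmul : ∀ σ τ x, L (σ * τ) x = L σ (L τ x)) (hone : ∀ x, L 1 x = x) {r : R}
    (hr : ∀ ν ∈ k'.fixingSubgroup, L ν r = r) :
    r ∈ Subring.closure (Set.range (algebraMap K R) ∪ {x | ∀ σ, L σ x = x}) := by
  classical
  -- By invariance of `r` under the fixing subgroup, `L σ r` depends only on the restriction of `σ`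
  -- to `k'`; `E` is the finite set of these restrictions.
  let E := {e : k' →ₐ[k] K // ∃ σ : K ≃ₐ[k] K, ∀ x : k', e x = σ x}
  have : Fintype E := Fintype.ofFinite _
  choose s hs using fun e : E ↦ e.2
  -- The trace of `c r`; the group permutes its terms, so it is invariant.
  let T (c : k') : R := ∑ e : E, algebraMap K R (e.1 c) * L (s e) r
  have hLr {σ τ : K ≃ₐ[k] K} (h : ∀ x : k', σ x = τ x) : L σ r = L τ r := by
    have h1 : L (τ⁻¹ * σ) r = r := hr _ fun x ↦ by
      change τ.symm (σ x) = x
      rw [h x, AlgEquiv.symm_apply_apply]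
    rw [← mul_inv_cancel_left τ σ, hmul, h1]
  let perm (σ : K ≃ₐ[k] K) : E ≃ E :=
    { toFun e := ⟨σ.toAlgHom.comp e.1, σ * s e, fun x ↦ congrArg σ (hs e x)⟩
      invFun e := ⟨σ.symm.toAlgHom.comp e.1, σ⁻¹ * s e, fun x ↦ congrArg σ.symm (hs e x)⟩
      left_inv e := by
        apply Subtype.ext
        ext x
        exact σ.symm_apply_apply _
      right_inv e := by
        apply Subtype.ext
        ext x
        exact σ.apply_symm_apply _ }
  have hT (c : k') (σ : K ≃ₐ[k] K) : L σ (T c) = T c := by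
    simp only [T, map_sum, map_mul, hL]
    refine Fintype.sum_equiv (perm σ) _ _ fun e ↦ ?_
    rw [← hmul]
    congr 1
    exact hLr fun x ↦ ((congrArg σ (hs e x)).symm.trans (hs (perm σ e) x) : _)
  let b := Module.finBasis k k'
  let v (e : E) : Fin (Module.finrank k k') → K := fun j ↦ e.1 (b j)
  -- Dedekind's independence of characters, evaluated on a basis of `k'`. A functional `d` isolating
  -- the inclusion `e₀` then recovers `r` as a `K`-combination of the traces `T (b j)`.
  have hv : LinearIndependent K v := by
    have h1 := linearIndependent_monoidHom k' K
    have h2 : LinearIndependent K (fun e : E ↦ ((e.1 : k' →* K) : k' → K)) :=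
      h1.comp (fun e : E ↦ (e.1 : k' →* K)) fun e e' h ↦
        Subtype.ext (AlgHom.ext fun x ↦ DFunLike.congr_fun h x)
    rw [Fintype.linearIndependent_iff] at h2 ⊢
    intro a ha
    apply h2 a
    have h3 : ∑ e : E, a e • e.1.toLinearMap = 0 := by
      refine b.ext fun j ↦ ?_
      simpa [v] using congrFun ha j
    ext x
    simpa using congrArg (fun f ↦ f x) h3
  let e₀ : E := ⟨k'.val, 1, fun _ ↦ rfl⟩
  obtain ⟨d, hd⟩ : ∃ d : Module.Dual K (Fin (Module.finrank k k') → K),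
      ∀ e, d (v e) = if e = e₀ then 1 else 0 := by
    obtain ⟨d, hd⟩ := ((Finsupp.lapply e₀).comp hv.repr).exists_extend
    refine ⟨d, fun e ↦ ?_⟩
    have := congrArg (fun f ↦ f ⟨v e, Submodule.subset_span ⟨e, rfl⟩⟩) hd
    simp only [LinearMap.comp_apply, Submodule.subtype_apply] at this
    rw [this]
    have h4 := hv.repr_eq_single e ⟨v e, Submodule.subset_span ⟨e, rfl⟩⟩ rfl
    simp [h4, Finsupp.single_apply]
  have hfin : r = ∑ j, algebraMap K R (d (Pi.single j 1)) * T (b j) := by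
    have h5 (e : E) : ∑ j, d (Pi.single j 1) * e.1 (b j) = if e = e₀ then 1 else 0 := by
      rw [← hd, d.pi_apply_eq_sum_univ]
      refine Finset.sum_congr rfl fun j _ ↦ ?_
      rw [smul_eq_mul, mul_comm]
      congr 2
      ext i
      simp [Pi.single_apply, eq_comm]
    have h6 : ∑ e : E, algebraMap K R (∑ j, d (Pi.single j 1) * e.1 (b j)) * L (s e) r = r := by
      simp_rw [h5]
      rw [Fintype.sum_eq_single e₀ fun e he ↦ by simp [he]]
      rw [if_pos rfl, map_one, one_mul]
      exact (hLr fun x ↦ (hs e₀ x).symm : _ = L 1 r).trans (hone r)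
    rw [← h6]
    simp only [T, map_sum, map_mul, Finset.mul_sum, Finset.sum_mul]
    rw [Finset.sum_comm]
    refine Finset.sum_congr rfl fun j _ ↦ Finset.sum_congr rfl fun e _ ↦ mul_assoc _ _ _
  rw [hfin]
  exact sum_mem fun j _ ↦ mul_mem (Subring.subset_closure (.inl ⟨_, rfl⟩))
    (Subring.subset_closure (.inr (hT _)))

end Algebra

/-- The generated subring `S` receives both maps, so the universal property gives a map `P ⟶ S`
whose composite with the inclusion is the identity. -/
theorem closure_union_eq_top_of_isPushout {A B C P : CommRingCat.{u}} {f : A ⟶ B} {g : A ⟶ C}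
    {inl : B ⟶ P} {inr : C ⟶ P} (h : IsPushout f g inl inr) :
    Subring.closure (Set.range inl ∪ Set.range inr) = ⊤ := by
  set S := Subring.closure (Set.range inl ∪ Set.range inr) with hS
  let l : B ⟶ .of S := CommRingCat.ofHom (inl.hom.codRestrict S fun x ↦
    Subring.subset_closure (.inl ⟨x, rfl⟩))
  let r : C ⟶ .of S := CommRingCat.ofHom (inr.hom.codRestrict S fun x ↦
    Subring.subset_closure (.inr ⟨x, rfl⟩))
  let i : .of S ⟶ P := CommRingCat.ofHom S.subtype
  have hl : l ≫ i = inl := rfl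
  have hr : r ≫ i = inr := rfl
  have hi : Mono i := ConcreteCategory.mono_of_injective _ Subtype.val_injective
  obtain ⟨d, hdl, hdr⟩ : ∃ d : P ⟶ .of S, inl ≫ d = l ∧ inr ≫ d = r :=
    ⟨h.desc l r (by rw [← cancel_mono i, Category.assoc, Category.assoc, hl, hr, h.w]),
      h.inl_desc _ _ _, h.inr_desc _ _ _⟩
  have hd : d ≫ i = 𝟙 _ := by
    apply h.hom_ext
    · rw [reassoc_of% hdl, hl, Category.comp_id]
    · rw [reassoc_of% hdr, hr, Category.comp_id]
  rw [eq_top_iff]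
  rintro x -
  have := ConcreteCategory.congr_hom hd x
  exact (show i (d x) = x from this) ▸ (d x).2

/-- The ring of the preimage of an affine open subset under a base change of affine schemes is
generated by the pullbacks of functions. -/
theorem closure_range_appLE_eq_top {X X' S T : Scheme.{u}} [IsAffine S] [IsAffine T] {q : X ⟶ X'}
    {hX : X ⟶ T} {hX' : X' ⟶ S} {b : T ⟶ S} (H : IsPullback q hX hX' b) {U : X'.Opens}
    (hU : IsAffineOpen U) : Subring.closure (Set.range (q.appLE U (q ⁻¹ᵁ U) le_rfl) ∪
      Set.range (hX.appLE ⊤ (q ⁻¹ᵁ U) (le_top.trans_eq hX.preimage_top.symm))) = ⊤ := by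
  have h1 : IsPushout _ _ _ _ := (isIso_pushoutSection_iff H (US := ⊤) (UT := ⊤) (UX := U)
    (UY := q ⁻¹ᵁ U) (le_top.trans_eq b.preimage_top.symm) (le_top.trans_eq hX'.preimage_top.symm)
    (by simp)).mp
    (isIso_pushoutSection_of_isAffineOpen H _ _ _ (isAffineOpen_top _) (isAffineOpen_top _) hU)
  exact closure_union_eq_top_of_isPushout h1

section Good

variable {K : Type u} [Field K] {X : Scheme.{u}} {hX : X ⟶ Spec (.of K)}

/-- Functions pulled back from `X'` are invariant, since `φ σ ≫ q = q`, and with the constants they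
generate the ring of a base change. -/
theorem IsGood.of_isPullback {G : Type*} {φ : G → (X ⟶ X)} {S X' : Scheme.{u}} [IsAffine S]
    {q : X ⟶ X'} {hX' : X' ⟶ S}
    {b : Spec (.of K) ⟶ S} (H : IsPullback q hX hX' b) (hq : ∀ σ, φ σ ≫ q = q) {U : X'.Opens}
    (hU : IsAffineOpen U) : IsGood hX φ (q ⁻¹ᵁ U) where
  isAffineOpen := by
    have : IsAffineHom q := by
      have : IsAffineHom b := inferInstance
      exact MorphismProperty.of_isPullback H.flip this
    exact hU.preimage q
  le_preimage σ := by rw [← Scheme.Hom.comp_preimage, hq]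
  closure_eq_top := by
    rw [eq_top_iff, ← closure_range_appLE_eq_top H hU, Subring.closure_le]
    rintro _ (⟨x, rfl⟩ | ⟨c, rfl⟩)
    · refine Subring.subset_closure (.inr fun σ h ↦ ?_)
      have h2 : q.appLE U (q ⁻¹ᵁ U) le_rfl ≫ (φ σ).appLE (q ⁻¹ᵁ U) (q ⁻¹ᵁ U) h =
          q.appLE U (q ⁻¹ᵁ U) le_rfl := by
        rw [Scheme.Hom.appLE_comp_appLE]
        simp_rw [hq σ]
      exact ConcreteCategory.congr_hom h2 x
    · refine Subring.subset_closure (.inl ⟨(Scheme.ΓSpecIso (.of K)).hom c, ?_⟩)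
      exact congrArg (hX.appLE ⊤ (q ⁻¹ᵁ U) (le_top.trans_eq hX.preimage_top.symm))
        (ConcreteCategory.congr_hom (Scheme.ΓSpecIso (.of K)).hom_inv_id c)

variable {k : Type u} [Field k] [Algebra k K] {φ : (K ≃ₐ[k] K) → (X ⟶ X)}

/-- A stable affine open subset that is good for the automorphisms over a finite extension is good
for the whole automorphism group. -/
theorem IsGood.of_fixingSubgroup (h : IsSemilinear hX φ) (hone : φ 1 = 𝟙 X)
    (hmul : ∀ σ τ, φ (σ * τ) = φ τ ≫ φ σ) (k' : IntermediateField k K) [FiniteDimensional k k']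
    {U : X.Opens} (hU : IsGood hX (fun ν : k'.fixingSubgroup ↦ φ ν) U)
    (hs : ∀ σ, U ≤ φ σ ⁻¹ᵁ U) : IsGood hX φ U where
  isAffineOpen := hU.isAffineOpen
  le_preimage := hs
  closure_eq_top := by
    let := (constants hX U).hom.toAlgebra
    -- Pullback along `φ σ` is a right action, semilinear for `σ⁻¹`; inverting `σ` gives a left
    -- action, semilinear for `σ`.
    let L (σ : K ≃ₐ[k] K) : Γ(X, U) →+* Γ(X, U) := ((φ σ⁻¹).appLE U U (hs _)).hom
    have hL (σ : K ≃ₐ[k] K) (c : K) : L σ (algebraMap K Γ(X, U) c) = algebraMap K Γ(X, U) (σ c) := by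
      have := h.constants_appLE σ⁻¹ U U (hs _) c
      rw [inv_inv] at this
      exact this
    have hLmul (σ τ : K ≃ₐ[k] K) (x) : L (σ * τ) x = L σ (L τ x) := by
      have : (φ (σ * τ)⁻¹).appLE U U (hs _) =
          (φ τ⁻¹).appLE U U (hs _) ≫ (φ σ⁻¹).appLE U U (hs _) := by
        rw [Scheme.Hom.appLE_comp_appLE]
        simp_rw [mul_inv_rev, hmul]
      exact ConcreteCategory.congr_hom this x
    have hLone (x) : L 1 x = x := by
      have : (φ 1⁻¹).appLE U U (hs _) = 𝟙 _ := by
        simp_rw [inv_one, hone]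
        exact (Scheme.Hom.appLE_eq_app (𝟙 X)).trans (Scheme.Hom.id_app U)
      exact ConcreteCategory.congr_hom this x
    rw [eq_top_iff, ← hU.closure_eq_top, Subring.closure_le, Set.union_subset_iff]
    refine ⟨Set.subset_union_left.trans Subring.subset_closure, fun r hr ↦ ?_⟩
    have := mem_closure_of_forall_fixingSubgroup k' L hL hLmul hLone (r := r)
      fun ν hν ↦ hr ⟨ν⁻¹, inv_mem hν⟩ (hs _)
    refine Subring.closure_mono (Set.union_subset_union_right _ fun x hx σ _ ↦ ?_) this
    have h1 := hx σ⁻¹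
    simp only [L, inv_inv] at h1
    exact h1

/-- A scheme with a semilinear action of the automorphism group of `K` over `k` which comes, as
far as the automorphisms over a finite normal extension `k'` are concerned, from a scheme over `k'`
whose finite sets of points lie in affine open subsets is covered by good open subsets. -/
theorem exists_isGood_mem [X.IsSeparated] (h : IsSemilinear hX φ) (hone : φ 1 = 𝟙 X)
    (hmul : ∀ σ τ, φ (σ * τ) = φ τ ≫ φ σ) (k' : IntermediateField k K) [FiniteDimensional k k']
    [Normal k k'] {S X' : Scheme.{u}} [IsAffine S] {q : X ⟶ X'} {hX' : X' ⟶ S}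
    {b : Spec (.of K) ⟶ S} (H : IsPullback q hX hX' b) (hq : ∀ σ ∈ k'.fixingSubgroup, φ σ ≫ q = q)
    (haf : ∀ s : Set X', s.Finite → ∃ U : X'.Opens, IsAffineOpen U ∧ s ⊆ U) (x : X) :
    ∃ U, IsGood hX φ U ∧ x ∈ U := by
  classical
  -- `φ σ ≫ q` depends only on the restriction of `σ⁻¹` to `k'`, and `k'` has finitely many
  -- embeddings.
  have hfin : (Set.range fun σ ↦ φ σ ≫ q).Finite := by
    have h1 : (Set.range fun σ : K ≃ₐ[k] K ↦ (σ⁻¹.toAlgHom.comp k'.val : k' →ₐ[k] K)).Finite :=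
      Set.toFinite _
    rw [Set.finite_coe_iff.symm] at h1 ⊢
    choose g hg using fun y : Set.range
      fun σ : K ≃ₐ[k] K ↦ (σ⁻¹.toAlgHom.comp k'.val : k' →ₐ[k] K) ↦ y.2
    refine Finite.of_surjective (fun y ↦ (⟨φ (g y) ≫ q, g y, rfl⟩ : Set.range fun σ ↦ φ σ ≫ q)) ?_
    rintro ⟨_, σ, rfl⟩
    refine ⟨⟨_, σ, rfl⟩, Subtype.ext ?_⟩
    set τ := g ⟨_, σ, rfl⟩ with hτ
    have h2 := hg ⟨_, σ, rfl⟩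
    rw [← hτ] at h2
    have h3 : τ * σ⁻¹ ∈ k'.fixingSubgroup := fun y ↦ by
      change τ (σ⁻¹ y) = y
      rw [← show τ⁻¹ (y : K) = σ⁻¹ y from DFunLike.congr_fun h2 y]
      exact τ.apply_symm_apply _
    change φ τ ≫ q = φ σ ≫ q
    rw [← inv_mul_cancel_right τ σ, hmul, Category.assoc, hq _ h3]
  -- One affine open subset contains the images of `x` under the finitely many conjugates of `q`.
  -- The intersection of its preimages under these conjugates is stable and contains `x`.
  obtain ⟨U', hU', hxU'⟩ := haf ((fun g : X ⟶ X' ↦ g x) '' (Set.range fun σ ↦ φ σ ≫ q))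
    (hfin.image _)
  let T := hfin.toFinset
  have hT : T.Nonempty := ⟨φ 1 ≫ q, by simp [T]⟩
  let U := T.inf' hT fun g ↦ g ⁻¹ᵁ U'
  have hmem (y : X) : y ∈ U ↔ ∀ σ, (φ σ ≫ q) y ∈ U' := by
    have h1 : U = T.inf fun g ↦ g ⁻¹ᵁ U' := Finset.inf'_eq_inf _ _
    rw [h1, ← SetLike.mem_coe, TopologicalSpace.Opens.coe_finset_inf]
    simp [T]
  have hs (σ) : U ≤ φ σ ⁻¹ᵁ U := by
    intro y hy
    rw [hmem] at hy
    refine (hmem _).mpr fun τ ↦ ?_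
    have := hy (τ * σ)
    rw [hmul, Category.assoc, Scheme.Hom.comp_apply] at this
    exact this
  refine ⟨U, IsGood.of_fixingSubgroup h hone hmul k' ?_ hs, (hmem x).mpr fun σ ↦
    hxU' ⟨_, ⟨σ, rfl⟩, rfl⟩⟩
  refine Finset.inf'_induction hT _ (fun U hU V hV ↦ hU.inf hV) fun g hg ↦ ?_
  obtain ⟨σ, rfl⟩ := hfin.mem_toFinset.mp hg
  have hiso : IsIso (φ σ) := ⟨φ σ⁻¹, by rw [← hmul, inv_mul_cancel, hone],
    by rw [← hmul, mul_inv_cancel, hone]⟩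
  have hiso' : IsIso (Spec.map (CommRingCat.ofHom
      (MulSemiringAction.toRingHom (K ≃ₐ[k] K) K σ⁻¹))) := by
    have : IsIso (CommRingCat.ofHom (MulSemiringAction.toRingHom (K ≃ₐ[k] K) K σ⁻¹)) :=
      (ConcreteCategory.isIso_iff_bijective _).mpr (σ⁻¹).bijective
    infer_instance
  refine IsGood.of_isPullback ((IsPullback.of_horiz_isIso ⟨h σ⟩).paste_horiz H) (fun ν ↦ ?_) hU'
  -- Normality of `k'` makes the fixing subgroup normal, so every conjugate `φ σ ≫ q` is again
  -- invariant under it.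
  have hN : σ * ν * σ⁻¹ ∈ k'.fixingSubgroup := by
    intro y
    have h1 : σ⁻¹ (y : K) ∈ k' := by
      have := AlgHom.fieldRange_of_normal (σ⁻¹.toAlgHom.comp k'.val : k' →ₐ[k] K)
      exact this.le ⟨y, rfl⟩
    change σ ((ν : K ≃ₐ[k] K) (σ⁻¹ y)) = y
    rw [show (ν : K ≃ₐ[k] K) (σ⁻¹ y) = σ⁻¹ y from ν.2 ⟨_, h1⟩]
    exact σ.apply_symm_apply _
  rw [← Category.assoc, ← hmul, ← inv_mul_cancel_right (σ * (ν : K ≃ₐ[k] K)) σ, hmul,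
    Category.assoc, hq _ hN]

end Good

/-! ### Spreading out sections, ideal sheaves and immersions -/

namespace AlgebraicGeometry.Scheme.IdealSheafData

variable {X Y : Scheme.{u}}

theorem appLE_mem_comap_ideal (J : Y.IdealSheafData) (f : X ⟶ Y) {V : Y.Opens}
    (hV : IsAffineOpen V) {U : X.Opens} (hU : IsAffineOpen U) (h : U ≤ f ⁻¹ᵁ V) {x : Γ(Y, V)}
    (hx : x ∈ J.ideal ⟨V, hV⟩) : f.appLE V U h x ∈ (J.comap f).ideal ⟨U, hU⟩ := by
  have h1 : x ∈ ((J.comap f).subschemeι ≫ f).ker.ideal ⟨V, hV⟩ := le_map_comap J f ⟨V, hV⟩ hx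
  have h2 : ((J.comap f).subschemeι ≫ f).app V x = 0 :=
    Hom.ideal_ker_le _ _ h1
  rw [← ker_subschemeι_app, RingHom.mem_ker]
  have h3 : f.appLE V U h ≫ (J.comap f).subschemeι.app U =
      ((J.comap f).subschemeι ≫ f).app V ≫ (J.comap f).subscheme.presheaf.map
        (homOfLE (Hom.preimage_mono (J.comap f).subschemeι h)).op := by
    rw [Hom.app_eq_appLE, Hom.app_eq_appLE, Hom.appLE_comp_appLE]
    exact (Hom.appLE_map _ _ _).symm
  refine (ConcreteCategory.congr_hom h3 x).trans ?_
  exact (congrArg ((J.comap f).subscheme.presheaf.map (homOfLE _).op) h2).trans (map_zero _)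

theorem mem_map_ideal_of_appLE_mem (I : X.IdealSheafData) (f : X ⟶ Y) [QuasiCompact f]
    {V : Y.Opens} (hV : IsAffineOpen V) {U : X.Opens} (hU : IsAffineOpen U) (h : U = f ⁻¹ᵁ V)
    {x : Γ(Y, V)} (hx : f.appLE V U h.le x ∈ I.ideal ⟨U, hU⟩) : x ∈ (I.map f).ideal ⟨V, hV⟩ := by
  subst h
  rw [ideal_map I f ⟨V, hV⟩ hU, Ideal.mem_comap]
  rwa [Hom.appLE_eq_app] at hx

end AlgebraicGeometry.Scheme.IdealSheafData

theorem AlgebraicGeometry.Scheme.exists_fintype_isAffineOpen_iSup_eq_top (Y : Scheme.{u}) [CompactSpace Y] :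
    ∃ (ι : Type u) (_ : Fintype ι) (V : ι → Y.Opens), (∀ i, IsAffineOpen (V i)) ∧ ⨆ i, V i = ⊤ :=
  ⟨Y.affineCover.finiteSubcover.I₀, inferInstance,
    fun i ↦ (Y.affineCover.finiteSubcover.f i).opensRange, fun _ ↦ isAffineOpen_opensRange _,
    Y.affineCover.finiteSubcover.iSup_opensRange⟩

namespace FGSubalgebra

variable {R K : Type u} [CommRing R] [CommRing K] [Algebra R K] {X Y : Scheme.{u}}
  {f : Y ⟶ Spec (.of R)} {a : X ⟶ Y} {hX : X ⟶ Spec (.of K)}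
  (H : IsPullback a hX f (Spec.map (CommRingCat.ofHom (algebraMap R K))))

theorem preimage_eq_baseProj_preimage (C : FGSubalgebra R K) (V : Y.Opens) :
    a ⁻¹ᵁ V = baseProj H C ⁻¹ᵁ pullback.fst f C.toSpec ⁻¹ᵁ V := by
  rw [← Scheme.Hom.comp_preimage, baseProj_fst]

instance (C : FGSubalgebra R K) : IsAffineHom (pullback.fst f C.toSpec) :=
  MorphismProperty.of_isPullback (IsPullback.of_hasPullback f C.toSpec).flip
    (inferInstanceAs (IsAffineHom (Spec.map _)))

theorem isPullback_baseProj (C : FGSubalgebra R K) :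
    IsPullback (baseProj H C) hX (pullback.snd _ _) C.fromSpec := by
  refine IsPullback.of_right (h₁₂ := pullback.fst f C.toSpec) (v₁₃ := f) (h₂₂ := C.toSpec) ?_
    (baseProj_snd H C) (IsPullback.of_hasPullback f C.toSpec)
  rw [baseProj_fst, fromSpec_toSpec]
  exact H

include H in
theorem isAffineHom_of_isPullback_algebraMap : IsAffineHom a :=
  MorphismProperty.of_isPullback H.flip (inferInstanceAs (IsAffineHom (Spec.map _)))

instance (C : FGSubalgebra R K) : IsAffineHom (baseProj H C) :=
  MorphismProperty.of_isPullback (isPullback_baseProj H C).flip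
    (inferInstanceAs (IsAffineHom (Spec.map _)))

/-- A section of the base change to `K` over an affine open subset is defined over a finitely
generated subalgebra. -/
theorem exists_appLE_baseProj_eq {V : Y.Opens} (hV : IsAffineOpen V) (t : Γ(X, a ⁻¹ᵁ V)) :
    ∃ C : FGSubalgebra R K, ∀ C', C ≤ C' → ∃ s : Γ(baseScheme f C', pullback.fst f C'.toSpec ⁻¹ᵁ V),
      (baseProj H C').appLE (pullback.fst f C'.toSpec ⁻¹ᵁ V) (a ⁻¹ᵁ V)
        (preimage_eq_baseProj_preimage H C' V).le s = t := by
  -- Sections are polynomials in functions from `V` and constants, and each constant lies in a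
  -- finitely generated subalgebra. Allowing every `C' ≥ C` lets the bounds be joined.
  have hcl := closure_range_appLE_eq_top H hV
  have ht := hcl.ge (Subring.mem_top t)
  induction ht using Subring.closure_induction with
  | mem t ht =>
    obtain ⟨x, rfl⟩ | ⟨c, rfl⟩ := ht
    · refine ⟨⊥, fun C' _ ↦ ⟨(pullback.fst f C'.toSpec).appLE V _ le_rfl x, ?_⟩⟩
      have h2 : (pullback.fst f C'.toSpec).appLE V _ le_rfl ≫
          (baseProj H C').appLE (pullback.fst f C'.toSpec ⁻¹ᵁ V) (a ⁻¹ᵁ V)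
            (preimage_eq_baseProj_preimage H C' V).le = a.appLE V (a ⁻¹ᵁ V) le_rfl := by
        rw [Scheme.Hom.appLE_comp_appLE]
        simp_rw [baseProj_fst]
      exact ConcreteCategory.congr_hom h2 x
    · obtain ⟨C, hC⟩ := exists_mem (R := R) ((Scheme.ΓSpecIso (.of K)).hom c)
      refine ⟨C, fun C' hC' ↦ ⟨(pullback.snd f C'.toSpec).appLE ⊤ _
            (le_top.trans_eq (pullback.snd f C'.toSpec).preimage_top.symm)
        ((Scheme.ΓSpecIso (.of C'.1)).inv ⟨_, hC' hC⟩), ?_⟩⟩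
      have h2 : (pullback.snd f C'.toSpec).appLE ⊤ _
            (le_top.trans_eq (pullback.snd f C'.toSpec).preimage_top.symm) ≫
          (baseProj H C').appLE (pullback.fst f C'.toSpec ⁻¹ᵁ V) (a ⁻¹ᵁ V)
            (preimage_eq_baseProj_preimage H C' V).le =
          C'.fromSpec.appLE ⊤ ⊤ C'.fromSpec.preimage_top.ge ≫ hX.appLE ⊤ (a ⁻¹ᵁ V) (le_top.trans_eq hX.preimage_top.symm) := by
        rw [Scheme.Hom.appLE_comp_appLE, Scheme.Hom.appLE_comp_appLE]
        simp_rw [baseProj_snd]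
      refine (ConcreteCategory.congr_hom h2 _).trans ?_
      refine congrArg (hX.appLE ⊤ (a ⁻¹ᵁ V) (le_top.trans_eq hX.preimage_top.symm)) ?_
      have h3 : (Scheme.ΓSpecIso (.of C'.1)).inv ≫ C'.fromSpec.appLE ⊤ ⊤ C'.fromSpec.preimage_top.ge =
          CommRingCat.ofHom C'.1.val.toRingHom ≫ (Scheme.ΓSpecIso (.of K)).inv := by
        rw [Scheme.ΓSpecIso_inv_naturality]
        exact congrArg (_ ≫ ·) (Scheme.Hom.appLE_eq_app C'.fromSpec (U := ⊤))
      refine (ConcreteCategory.congr_hom h3 _).trans ?_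
      exact ConcreteCategory.congr_hom (Scheme.ΓSpecIso (.of K)).hom_inv_id c
  | zero => exact ⟨⊥, fun C' _ ↦ ⟨0, map_zero _⟩⟩
  | one => exact ⟨⊥, fun C' _ ↦ ⟨1, map_one _⟩⟩
  | add x y _ _ hx hy =>
    obtain ⟨C₁, h₁⟩ := hx
    obtain ⟨C₂, h₂⟩ := hy
    refine ⟨C₁ ⊔ C₂, fun C' hC' ↦ ?_⟩
    obtain ⟨s, rfl⟩ := h₁ C' (le_sup_left.trans hC')
    obtain ⟨t, rfl⟩ := h₂ C' (le_sup_right.trans hC')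
    exact ⟨s + t, map_add _ _ _⟩
  | neg x _ hx =>
    obtain ⟨C₁, h₁⟩ := hx
    refine ⟨C₁, fun C' hC' ↦ ?_⟩
    obtain ⟨s, rfl⟩ := h₁ C' hC'
    exact ⟨-s, map_neg _ _⟩
  | mul x y _ _ hx hy =>
    obtain ⟨C₁, h₁⟩ := hx
    obtain ⟨C₂, h₂⟩ := hy
    refine ⟨C₁ ⊔ C₂, fun C' hC' ↦ ?_⟩
    obtain ⟨s, rfl⟩ := h₁ C' (le_sup_left.trans hC')
    obtain ⟨t, rfl⟩ := h₂ C' (le_sup_right.trans hC')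
    exact ⟨s * t, map_mul _ _ _⟩

theorem exists_forall_of_finite {ι : Type*} [Finite ι] {P : ι → FGSubalgebra R K → Prop}
    (h : ∀ i, ∃ C, ∀ C', C ≤ C' → P i C') : ∃ C, ∀ C', C ≤ C' → ∀ i, P i C' := by
  classical
  have := Fintype.ofFinite ι
  choose C hC using h
  exact ⟨Finset.univ.sup C, fun C' hC' i ↦ hC i C' ((Finset.le_sup (Finset.mem_univ i)).trans hC')⟩

/-- A quasi-coherent ideal sheaf on the base change to `K` is defined over a finitely generated
subalgebra. -/
theorem exists_comap_map_eq [CompactSpace Y] [IsLocallyNoetherian X] (I : X.IdealSheafData) :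
    ∃ C : FGSubalgebra R K, ∀ C', C ≤ C' →
      (I.map (baseProj H C')).comap (baseProj H C') = I := by
  classical
  obtain ⟨ι, _, V, hV, hVtop⟩ := Y.exists_fintype_isAffineOpen_iSup_eq_top
  have := isAffineHom_of_isPullback_algebraMap H
  have key (i : ι) : ∃ C : FGSubalgebra R K, ∀ C', C ≤ C' → I.ideal ⟨a ⁻¹ᵁ V i, (hV i).preimage a⟩ ≤
      ((I.map (baseProj H C')).comap (baseProj H C')).ideal ⟨a ⁻¹ᵁ V i, (hV i).preimage a⟩ := by
    have : IsNoetherianRing Γ(X, a ⁻¹ᵁ V i) :=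
      IsLocallyNoetherian.component_noetherian ⟨a ⁻¹ᵁ V i, (hV i).preimage a⟩
    obtain ⟨S, hS⟩ := IsNoetherian.noetherian (I.ideal ⟨a ⁻¹ᵁ V i, (hV i).preimage a⟩)
    -- On each of finitely many affine pieces the ideal has finitely many generators, all defined
    -- over one `C`.
    obtain ⟨C, hC⟩ := exists_forall_of_finite fun t : S ↦ exists_appLE_baseProj_eq H (hV i) t.1
    refine ⟨C, fun C' hC' ↦ ?_⟩
    rw [← hS]
    refine Submodule.span_le.mpr fun t ht ↦ ?_
    have htI : t ∈ I.ideal ⟨a ⁻¹ᵁ V i, (hV i).preimage a⟩ := hS ▸ Submodule.subset_span ht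
    obtain ⟨s, hs⟩ := hC C' hC' ⟨t, ht⟩
    obtain rfl : _ = t := hs
    exact Scheme.IdealSheafData.appLE_mem_comap_ideal _ _ ((hV i).preimage (pullback.fst f C'.toSpec)) _ _
      (Scheme.IdealSheafData.mem_map_ideal_of_appLE_mem I _ _ ((hV i).preimage a)
        (preimage_eq_baseProj_preimage H C' (V i)) htI)
  obtain ⟨C, hC⟩ := exists_forall_of_finite key
  refine ⟨C, fun C' hC' ↦ le_antisymm (Scheme.IdealSheafData.comap_map_le _ _) ?_⟩
  refine Scheme.IdealSheafData.le_of_iSup_eq_top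
    (fun i ↦ ⟨a ⁻¹ᵁ V i, (hV i).preimage a⟩) ?_ (hC C' hC')
  exact (a.preimage_iSup V).symm.trans (by rw [hVtop, Scheme.Hom.preimage_top])

/-- A quasi-compact open subset of the base change to `K` is defined over a finitely generated
subalgebra. -/
theorem exists_baseProj_preimage_eq [CompactSpace Y] [QuasiSeparatedSpace Y] {U : X.Opens}
    (hU : IsCompact (U : Set X)) :
    ∃ (C : FGSubalgebra R K) (V : (baseScheme f C).Opens), baseProj H C ⁻¹ᵁ V = U := by
  obtain ⟨C, V, -, hV⟩ := AlgebraicGeometry.exists_preimage_eq (baseDiagram K f) (baseCone H)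
    (isLimitBaseCone H) U hU
  exact ⟨C.unop, V, hV⟩

/-- A scheme with an immersion into the base change to `K` of a scheme `Y` over a ring is the base
change of a scheme with an immersion into the base change of `Y` to a finitely generated
subalgebra. -/
theorem exists_isImmersion_isPullback [CompactSpace Y] [QuasiSeparatedSpace Y]
    [IsLocallyNoetherian X] {Z : Scheme.{u}} (i : Z ⟶ X) [IsImmersion i] :
    ∃ (C : FGSubalgebra R K) (Z' : Scheme.{u}) (i' : Z' ⟶ baseScheme f C) (r : Z ⟶ Z'),
      IsImmersion i' ∧ IsPullback r i i' (baseProj H C) := by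
  have := isAffineHom_of_isPullback_algebraMap H
  have : CompactSpace X := QuasiCompact.compactSpace_of_compactSpace a
  have : IsNoetherian X := { }
  have : QuasiCompact i := by
    rw [← i.liftCoborder_ι]
    infer_instance
  obtain ⟨C₁, V, hV⟩ := exists_baseProj_preimage_eq H (U := i.coborderRange)
    (TopologicalSpace.NoetherianSpace.isCompact _)
  obtain ⟨C₂, hC₂⟩ := exists_comap_map_eq H i.ker
  -- The immersion is closed in the open `coborderRange`. The open subset descends to `C₁`, the
  -- ideal sheaf of the scheme-theoretic image to `C₂`, and `Z'` is the intersection of the two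
  -- models over `C`.
  let C := C₁ ⊔ C₂
  let U : (baseScheme f C).Opens := baseMap f (le_sup_left : C₁ ≤ C) ⁻¹ᵁ V
  have hU : i.coborderRange = baseProj H C ⁻¹ᵁ U := by
    rw [← hV, ← Scheme.Hom.comp_preimage, baseProj_baseMap]
  let J := i.ker.map (baseProj H C)
  have hJ : J.comap (baseProj H C) = i.ker := hC₂ C le_sup_right
  have hi : i.imageι.ker = i.ker := i.ker.ker_subschemeι
  let z := IsClosedImmersion.lift J.subschemeι (i.imageι ≫ baseProj H C) (by
    rw [J.ker_subschemeι, ← Scheme.IdealSheafData.map_ker, hi])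
  have P1 : IsPullback i.imageι z (baseProj H C) J.subschemeι :=
    isPullback_of_isClosedImmersion _ _ _ _ (IsClosedImmersion.lift_fac _ _ _).symm
      (by rw [J.ker_subschemeι, hJ, hi])
  let u : i.coborderRange.toScheme ⟶ U.toScheme := (baseProj H C).resLE U i.coborderRange hU.le
  have P2 : IsPullback i.coborderRange.ι u (baseProj H C) U.ι :=
    (IsOpenImmersion.isPullback u i.coborderRange.ι U.ι (baseProj H C)
      (Scheme.Hom.resLE_comp_ι _ _).symm (by simp [hU])).flip
  have P3 := (IsImmersion.isPullback_toImage_liftCoborder i).paste_horiz P1.flip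
  have P4 := IsPullback.of_hasPullback J.subschemeι U.ι
  let r := P4.lift (i.toImage ≫ z) (i.liftCoborder ≫ u) (by
    rw [P3.w, Category.assoc, P2.w])
  have P5 : IsPullback r i.liftCoborder (pullback.snd J.subschemeι U.ι) u := by
    refine IsPullback.of_right ?_ (P4.lift_snd _ _ _) P4
    rw [P4.lift_fst, ← P2.w]
    exact P3
  refine ⟨C, _, pullback.snd J.subschemeι U.ι ≫ U.ι, r, inferInstance, ?_⟩
  have := P5.paste_vert P2.flip
  rwa [i.liftCoborder_ι] at this

end FGSubalgebra

/-! ### Finite sets of points in affine open subsets -/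

section FinitePoints

/-- The condition that every finite set of points lies in an affine open subset. -/
def AlgebraicGeometry.Scheme.FiniteInAffine (X : Scheme.{u}) : Prop :=
  ∀ s : Set X, s.Finite → ∃ U : X.Opens, IsAffineOpen U ∧ s ⊆ U

namespace AlgebraicGeometry.Scheme.FiniteInAffine

variable {X Y : Scheme.{u}}

theorem of_isAffineHom (h : Y.FiniteInAffine) (f : X ⟶ Y) [IsAffineHom f] : X.FiniteInAffine := by
  intro s hs
  obtain ⟨U, hU, hsU⟩ := h _ (hs.image f)
  exact ⟨f ⁻¹ᵁ U, hU.preimage f, fun x hx ↦ hsU ⟨x, hx, rfl⟩⟩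

/-- Prime avoidance inside an affine `V ⊇ s`: some function vanishes on `V \ W` but at no point of
`s`, and its basic open subset works. -/
theorem exists_isAffineOpen_le (h : Y.FiniteInAffine) (W : Y.Opens) {s : Set Y} (hs : s.Finite)
    (hsW : s ⊆ W) : ∃ U : Y.Opens, IsAffineOpen U ∧ s ⊆ U ∧ U ≤ W := by
  classical
  obtain ⟨V, hV, hsV⟩ := h s hs
  obtain ⟨J, hJ⟩ : ∃ J : Ideal Γ(Y, V), (hV.fromSpec ⁻¹ᵁ W).1 =
      (PrimeSpectrum.zeroLocus (J : Set Γ(Y, V)))ᶜ := by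
    obtain ⟨J, hJ⟩ := (PrimeSpectrum.isClosed_iff_zeroLocus_ideal _).mp
      (hV.fromSpec ⁻¹ᵁ W).2.isClosed_compl
    exact ⟨J, (compl_compl _).symm.trans (congrArg compl hJ)⟩
  have hp (y : s) : ∃ p : PrimeSpectrum Γ(Y, V), hV.fromSpec p = y.1 := by
    have : y.1 ∈ Set.range hV.fromSpec := hV.range_fromSpec ▸ hsV y.2
    exact this
  choose p hp using hp
  have := hs.fintype
  obtain ⟨g, hgJ, hg⟩ : ∃ g ∈ J, ∀ y : s, g ∉ (p y).asIdeal := by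
    by_contra! hcon
    have h1 : (J : Set Γ(Y, V)) ⊆ ⋃ y ∈ ((Finset.univ : Finset s) : Set s), (p y).asIdeal :=
      fun g hg ↦ by
        obtain ⟨y, hy⟩ := hcon g hg
        exact Set.mem_biUnion (by simp) hy
    rcases isEmpty_or_nonempty s with he | ⟨⟨y₀⟩⟩
    · simpa using h1 J.zero_mem
    · obtain ⟨y, -, hy⟩ := (Ideal.subset_union_prime y₀ y₀ fun y _ _ _ ↦ (p y).2).mp h1
      have h2 : p y ∈ (PrimeSpectrum.zeroLocus (J : Set Γ(Y, V)))ᶜ := by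
        rw [← hJ]
        change hV.fromSpec (p y) ∈ W
        rw [hp]
        exact hsW y.2
      exact h2 hy
  have hb := hV.fromSpec_image_basicOpen g
  refine ⟨Y.basicOpen g, hV.basicOpen g, fun y hy ↦ ?_, ?_⟩
  · rw [← hb]
    exact ⟨p ⟨y, hy⟩, hg ⟨y, hy⟩, hp ⟨y, hy⟩⟩
  · rw [← hb]
    rintro _ ⟨q, hq, rfl⟩
    have h2 : q ∈ (PrimeSpectrum.zeroLocus (J : Set Γ(Y, V)))ᶜ := fun h3 ↦ hq (h3 hgJ)
    rw [← hJ] at h2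
    exact h2

/-- An immersion is a closed, hence affine, immersion into an open subset, to which the property
passes by shrinking. -/
theorem of_isImmersion (h : Y.FiniteInAffine) (i : X ⟶ Y) [IsImmersion i] :
    X.FiniteInAffine := by
  refine of_isAffineHom (Y := i.coborderRange) (fun s hs ↦ ?_) i.liftCoborder
  obtain ⟨U, hU, hsU, hUW⟩ := h.exists_isAffineOpen_le i.coborderRange
    (hs.image i.coborderRange.ι) (by
      rintro _ ⟨x, -, rfl⟩
      exact x.2)
  refine ⟨i.coborderRange.ι ⁻¹ᵁ U, hU.preimage_of_isOpenImmersion _ (by simpa using hUW),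
    fun x hx ↦ hsU ⟨x, hx, rfl⟩⟩

end AlgebraicGeometry.Scheme.FiniteInAffine

end FinitePoints

/-! ### Models of quasi-projective schemes -/

section ClosedImmersion

variable {X Y S T : Scheme.{u}}

/-- A morphism to a fibre product that is affine over one factor and such that functions are
generated by the functions coming from the two factors is a closed immersion. -/
theorem isClosedImmersion_of_closure_eq_top {p : X ⟶ Y} {hX : X ⟶ T} {f : Y ⟶ S} {s : T ⟶ S}
    [IsAffine S] [IsAffine T] (m : X ⟶ pullback f s) (hp : m ≫ pullback.fst _ _ = p)
    (hm : m ≫ pullback.snd _ _ = hX) {ι : Type*} (V : ι → Y.Opens) (hV : ∀ i, IsAffineOpen (V i))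
    (hVtop : ⨆ i, V i = ⊤) (hpV : ∀ i, IsAffineOpen (p ⁻¹ᵁ V i))
    (hcl : ∀ i, Subring.closure (Set.range (p.appLE (V i) (p ⁻¹ᵁ V i) le_rfl) ∪
      Set.range (hX.appLE ⊤ (p ⁻¹ᵁ V i) (le_top.trans_eq hX.preimage_top.symm))) = ⊤) :
    IsClosedImmersion m := by
  have : IsAffineHom (pullback.fst f s) :=
    MorphismProperty.of_isPullback (IsPullback.of_hasPullback f s).flip inferInstance
  let W (i : ι) : (pullback f s).Opens := pullback.fst f s ⁻¹ᵁ V i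
  have hWtop : ⨆ i, W i = ⊤ := by
    rw [← Scheme.Hom.preimage_iSup, hVtop, Scheme.Hom.preimage_top]
  have hW (i : ι) : IsAffineOpen (W i) := (hV i).preimage _
  have hmW (i : ι) : m ⁻¹ᵁ W i = p ⁻¹ᵁ V i := by
    rw [← hp, Scheme.Hom.comp_preimage]
  refine (IsZariskiLocalAtTarget.iff_of_iSup_eq_top (P := @IsClosedImmersion) W hWtop).mpr
    fun i ↦ ?_
  have h1 : IsAffine (W i).toScheme := hW i
  have h2 : IsAffine (m ⁻¹ᵁ W i).toScheme := by
    have := hpV i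
    rw [← hmW i] at this
    exact this
  refine IsClosedImmersion.of_surjective_of_isAffine _ ?_
  have key : Function.Surjective (m.appLE (W i) (p ⁻¹ᵁ V i) (hmW i).ge) := by
    rw [← RingHom.range_eq_top, eq_top_iff, ← hcl i, Subring.closure_le]
    rintro _ (⟨x, rfl⟩ | ⟨x, rfl⟩)
    · refine ⟨(pullback.fst f s).appLE (V i) (W i) le_rfl x, ?_⟩
      have h3 : (pullback.fst f s).appLE (V i) (W i) le_rfl ≫
          m.appLE (W i) (p ⁻¹ᵁ V i) (hmW i).ge = p.appLE (V i) (p ⁻¹ᵁ V i) le_rfl := by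
        rw [Scheme.Hom.appLE_comp_appLE]
        simp_rw [hp]
      exact ConcreteCategory.congr_hom h3 x
    · refine ⟨(pullback.snd f s).appLE ⊤ (W i)
        (le_top.trans_eq (pullback.snd f s).preimage_top.symm) x, ?_⟩
      have h3 : (pullback.snd f s).appLE ⊤ (W i)
          (le_top.trans_eq (pullback.snd f s).preimage_top.symm) ≫
          m.appLE (W i) (p ⁻¹ᵁ V i) (hmW i).ge =
          hX.appLE ⊤ (p ⁻¹ᵁ V i) (le_top.trans_eq hX.preimage_top.symm) := by
        rw [Scheme.Hom.appLE_comp_appLE]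
        simp_rw [hm]
      exact ConcreteCategory.congr_hom h3 x
  have key' (W' : (pullback f s).Opens) (hW' : W' = W i) : Function.Surjective (m.app W') := by
    have h4 (U : X.Opens) (h : m ⁻¹ᵁ W i = U) (hs : Function.Surjective (m.appLE (W i) U h.ge)) :
        Function.Surjective (m.app (W i)) := by
      subst h
      rwa [Scheme.Hom.appLE_eq_app] at hs
    exact hW' ▸ h4 _ (hmW i) key
  rw [morphismRestrict_appTop]
  exact (ConcreteCategory.bijective_of_isIso (X.presheaf.map _)).surjective.comp
    (key' _ (W i).ι_image_top)

end ClosedImmersion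

section ProjectiveSpace

attribute [local instance] MvPolynomial.gradedAlgebra

open MvPolynomial HomogeneousIdeal

variable {σ : Type}

theorem MvPolynomial.irrelevant_le_span_X (k : Type u) [CommRing k] :
    (HomogeneousIdeal.irrelevant (homogeneousSubmodule σ k)).toIdeal ≤
      Ideal.span (Set.range (X : σ → MvPolynomial σ k)) := by
  refine (toIdeal_irrelevant_le _).mpr fun i hi x hx ↦ ?_
  rw [← Set.image_univ]
  refine mem_ideal_span_X_image.mpr fun m hm ↦ ?_
  have h1 := hx (mem_support_iff.mp hm)
  by_contra! h2
  have : m = 0 := Finsupp.ext fun j ↦ by simpa using h2 j trivial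
  rw [this, map_zero] at h1
  exact hi.ne h1

/-- The linear forms vanishing at a point form a proper subspace. Over an infinite field finitely
many of these do not cover all linear forms, so some hyperplane avoids `s`. -/
theorem finiteInAffine_proj (k : Type u) [Field k] [Infinite k] :
    (Proj (homogeneousSubmodule σ k)).FiniteInAffine := by
  intro s hs
  have := hs.to_subtype
  let p (x : Proj (homogeneousSubmodule σ k)) : Submodule k (homogeneousSubmodule σ k 1) :=
    (x.asHomogeneousIdeal.toIdeal.restrictScalars k).comap (Submodule.subtype _)
  have hp (x) : p x ≠ ⊤ := by
    intro h
    refine x.not_irrelevant_le ((irrelevant_le_span_X k).trans (Ideal.span_le.mpr ?_))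
    rintro _ ⟨i, rfl⟩
    exact (h.ge trivial : (⟨X i, isHomogeneous_X k i⟩ : homogeneousSubmodule σ k 1) ∈ p x)
  obtain ⟨l, hl⟩ : ∃ l : homogeneousSubmodule σ k 1, ∀ x ∈ s, l ∉ p x := by
    have := Subspace.biUnion_ne_univ_of_top_notMem (s := (hs.image p).toFinset) (by
      simp only [Set.Finite.mem_toFinset, Set.mem_image, not_exists, not_and]
      exact fun x _ ↦ hp x)
    obtain ⟨l, hl⟩ := (Set.ne_univ_iff_exists_notMem _).mp this
    refine ⟨l, fun x hx h ↦ hl ?_⟩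
    exact Set.mem_biUnion (by simpa using ⟨x, hx, rfl⟩) h
  exact ⟨Proj.basicOpen _ l.1, Proj.isAffineOpen_basicOpen _ l.1 l.2 one_pos, fun x hx ↦ hl x hx⟩

/-- The extension of scalars of polynomials, as a homomorphism of graded rings. -/
def MvPolynomial.gradedMap (σ : Type) (k K : Type u) [CommRing k] [CommRing K] [Algebra k K] :
    GradedRingHom (homogeneousSubmodule σ k) (homogeneousSubmodule σ K) where
  __ := MvPolynomial.map (algebraMap k K)
  map_mem h := IsHomogeneous.map h _

variable (σ) (k K : Type u) [CommRing k] [CommRing K] [Algebra k K]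

theorem MvPolynomial.irrelevant_le_map :
    HomogeneousIdeal.irrelevant (homogeneousSubmodule σ K) ≤
      (HomogeneousIdeal.irrelevant (homogeneousSubmodule σ k)).map (gradedMap σ k K) := by
  refine (irrelevant_le_span_X K).trans (Ideal.span_le.mpr ?_)
  rintro _ ⟨i, rfl⟩
  have : (X i : MvPolynomial σ K) = gradedMap σ k K (X i) := (map_X _ i).symm
  rw [this]
  exact Ideal.mem_map_of_mem _ (mem_irrelevant_of_mem _ one_pos (isHomogeneous_X k i))

/-- The structure morphism of projective space. -/
def projStructure : Proj (homogeneousSubmodule σ k) ⟶ Spec (.of k) :=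
  Proj.toSpecZero (homogeneousSubmodule σ k) ≫
    Spec.map (CommRingCat.ofHom (algebraMap k (homogeneousSubmodule σ k 0)))

/-- The projection from projective space over an algebra. -/
def projMap : Proj (homogeneousSubmodule σ K) ⟶ Proj (homogeneousSubmodule σ k) :=
  Proj.map (gradedMap σ k K) (irrelevant_le_map σ k K)

theorem awayMap_fromZeroRingHom (s : MvPolynomial σ k) (c : k) :
    HomogeneousLocalization.Away.map (gradedMap σ k K) s
      (HomogeneousLocalization.fromZeroRingHom (homogeneousSubmodule σ k) _
        (algebraMap k (homogeneousSubmodule σ k 0) c)) =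
      HomogeneousLocalization.fromZeroRingHom (homogeneousSubmodule σ K) _
        (algebraMap K (homogeneousSubmodule σ K 0) (algebraMap k K c)) := by
  refine congrArg HomogeneousLocalization.mk ?_
  refine HomogeneousLocalization.NumDenSameDeg.ext _ rfl ?_ ?_
  · exact MvPolynomial.map_C (algebraMap k K) c
  · exact map_one (gradedMap σ k K)

theorem awayι_projMap {i : ℕ} (hi : 0 < i) {s : MvPolynomial σ k}
    (hs : s ∈ homogeneousSubmodule σ k i) :
    Proj.awayι (homogeneousSubmodule σ K) (gradedMap σ k K s) ((gradedMap σ k K).2 hs) hi ≫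
      projMap σ k K = Spec.map (CommRingCat.ofHom
        (HomogeneousLocalization.Away.map (gradedMap σ k K) s)) ≫
        Proj.awayι (homogeneousSubmodule σ k) s hs hi :=
  Proj.awayι_comp_map _ _ hi s hs

theorem awayι_projStructure {i : ℕ} (hi : 0 < i) {s : MvPolynomial σ k}
    (hs : s ∈ homogeneousSubmodule σ k i) :
    Proj.awayι (homogeneousSubmodule σ k) s hs hi ≫ projStructure σ k =
      Spec.map (CommRingCat.ofHom ((HomogeneousLocalization.fromZeroRingHom
        (homogeneousSubmodule σ k) (.powers s)).comp
          (algebraMap k (homogeneousSubmodule σ k 0)))) := by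
  rw [projStructure, Proj.awayι_toSpecZero_assoc, ← Spec.map_comp]
  rfl

theorem projMap_projStructure : projMap σ k K ≫ projStructure σ k =
    projStructure σ K ≫ Spec.map (CommRingCat.ofHom (algebraMap k K)) := by
  have key {i : ℕ} (hi : 0 < i) {s : MvPolynomial σ k} (hs : s ∈ homogeneousSubmodule σ k i) :
      Proj.awayι (homogeneousSubmodule σ K) (gradedMap σ k K s) ((gradedMap σ k K).2 hs) hi ≫
        projMap σ k K ≫ projStructure σ k =
      Proj.awayι (homogeneousSubmodule σ K) (gradedMap σ k K s) ((gradedMap σ k K).2 hs) hi ≫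
        projStructure σ K ≫ Spec.map (CommRingCat.ofHom (algebraMap k K)) := by
    rw [← Category.assoc, awayι_projMap σ k K hi hs, Category.assoc, awayι_projStructure, ← Category.assoc,
      awayι_projStructure, ← Spec.map_comp, ← Spec.map_comp]
    congr 1
    refine CommRingCat.hom_ext (RingHom.ext fun c ↦ ?_)
    exact awayMap_fromZeroRingHom σ k K s c
  exact (Proj.mapAffineOpenCover _ (irrelevant_le_map σ k K)).openCover.hom_ext _ _ fun s ↦
    key s.1.2 s.2.2

theorem constants_projStructure (K : Type u) [Field K] {i : ℕ} (hi : 0 < i) {s : MvPolynomial σ K}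
    (hs : s ∈ homogeneousSubmodule σ K i) :
    constants (projStructure σ K) (Proj.basicOpen (homogeneousSubmodule σ K) s) =
      CommRingCat.ofHom ((HomogeneousLocalization.fromZeroRingHom
        (homogeneousSubmodule σ K) (.powers s)).comp
          (algebraMap K (homogeneousSubmodule σ K 0))) ≫
        Proj.awayToSection (homogeneousSubmodule σ K) s := by
  have hU := Proj.isAffineOpen_basicOpen (homogeneousSubmodule σ K) s hs hi
  have h : (Proj.basicOpen (homogeneousSubmodule σ K) s).toSpecΓ ≫
      Spec.map (Proj.awayToSection (homogeneousSubmodule σ K) s) ≫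
        Proj.awayι (homogeneousSubmodule σ K) s hs hi = Scheme.Opens.ι _ := by
    have h1 := Proj.basicOpenIsoSpec_hom (homogeneousSubmodule σ K) s hs hi
    rw [Proj.basicOpenToSpec] at h1
    rw [← Category.assoc, ← h1, Proj.awayι, Iso.hom_inv_id_assoc]
  apply Spec.map_injective
  rw [← cancel_epi hU.isoSpec.hom, hU.isoSpec_hom, toSpecΓ_map_constants, Spec.map_comp,
    ← awayι_projStructure σ K hi hs, ← h, Category.assoc, Category.assoc]

/-- A fraction with denominator a power of `s` is a sum of monomial fractions, each a constant of
`K` times a fraction with coefficients in `k`. -/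
theorem awayMk_mem_of_forall {K : Type u} [Field K] {k : Type u} [Field k] [Algebra k K] {i : ℕ}
    {s : MvPolynomial σ k} (hs : s ∈ homogeneousSubmodule σ k i)
    (S : Subring (HomogeneousLocalization.Away (homogeneousSubmodule σ K) (gradedMap σ k K s)))
    (h₁ : ∀ x, HomogeneousLocalization.Away.map (gradedMap σ k K) s x ∈ S)
    (h₂ : ∀ c, HomogeneousLocalization.fromZeroRingHom (homogeneousSubmodule σ K) _
      (algebraMap K (homogeneousSubmodule σ K 0) c) ∈ S) (n : ℕ) (a : MvPolynomial σ K)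
    (ha : a ∈ homogeneousSubmodule σ K (n • i)) :
    HomogeneousLocalization.Away.mk _ ((gradedMap σ k K).2 hs) n a ha ∈ S := by
  suffices ∃ ha, HomogeneousLocalization.Away.mk (homogeneousSubmodule σ K)
    ((gradedMap σ k K).2 hs) n a ha ∈ S from this.2
  rw [← a.support_sum_monomial_coeff]
  refine Finset.sum_induction _ (fun a ↦ ∃ ha, HomogeneousLocalization.Away.mk
    (homogeneousSubmodule σ K) ((gradedMap σ k K).2 hs) n a ha ∈ S) ?_ ?_ fun m hm ↦ ?_
  · rintro a b ⟨ha, ha'⟩ ⟨hb, hb'⟩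
    refine ⟨add_mem ha hb, ?_⟩
    convert add_mem ha' hb' using 1
    ext
    simp [Localization.add_mk_self]
  · refine ⟨zero_mem _, ?_⟩
    convert zero_mem S
    ext
    simpa using Localization.mk_zero _
  · have hm' : m.degree = n • i := by
      rw [Finsupp.degree_eq_weight_one]
      exact ha (mem_support_iff.mp hm)
    have hK : monomial m (coeff m a) ∈ homogeneousSubmodule σ K (n • i) :=
      isHomogeneous_monomial _ hm'
    have hk : monomial m 1 ∈ homogeneousSubmodule σ k (n • i) := isHomogeneous_monomial _ hm'
    refine ⟨hK, ?_⟩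
    convert mul_mem (h₂ (coeff m a)) (h₁ (HomogeneousLocalization.Away.mk _ hs n _ hk)) using 1
    rw [HomogeneousLocalization.Away.map_mk]
    ext
    rw [HomogeneousLocalization.val_mul, HomogeneousLocalization.Away.val_mk,
      HomogeneousLocalization.Away.val_mk]
    change _ = Localization.mk (C (coeff m a)) 1 * _
    rw [Localization.mk_mul, one_mul]
    congr 1
    change _ = C (coeff m a) * MvPolynomial.map (algebraMap k K) (monomial m 1)
    rw [map_monomial, map_one, C_mul_monomial, mul_one]

theorem awayToSection_appLE_projMap {i : ℕ} {s : MvPolynomial σ k}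
    (hs : s ∈ homogeneousSubmodule σ k i) :
    Proj.awayToSection (homogeneousSubmodule σ k) s ≫
      (projMap σ k K).appLE (Proj.basicOpen (homogeneousSubmodule σ k) s)
        (Proj.basicOpen (homogeneousSubmodule σ K) (gradedMap σ k K s)) le_rfl =
      CommRingCat.ofHom (HomogeneousLocalization.Away.map (gradedMap σ k K) s) ≫
        Proj.awayToSection (homogeneousSubmodule σ K) (gradedMap σ k K s) :=
  Proj.awayToSection_comp_appLE _ (irrelevant_le_map σ k K) hs

theorem closure_range_projMap (k K : Type u) [Field k] [Field K] [Algebra k K] {i : ℕ} (hi : 0 < i)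
    {s : MvPolynomial σ k} (hs : s ∈ homogeneousSubmodule σ k i) :
    Subring.closure (Set.range ((projMap σ k K).appLE
      (Proj.basicOpen (homogeneousSubmodule σ k) s)
      (Proj.basicOpen (homogeneousSubmodule σ K) (gradedMap σ k K s)) le_rfl) ∪
      Set.range (constants (projStructure σ K)
        (Proj.basicOpen (homogeneousSubmodule σ K) (gradedMap σ k K s)))) = ⊤ := by
  have hs' := (gradedMap σ k K).2 hs
  set S := Subring.closure (Set.range ((projMap σ k K).appLE
    (Proj.basicOpen (homogeneousSubmodule σ k) s)
    (Proj.basicOpen (homogeneousSubmodule σ K) (gradedMap σ k K s)) le_rfl) ∪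
    Set.range (constants (projStructure σ K)
      (Proj.basicOpen (homogeneousSubmodule σ K) (gradedMap σ k K s)))) with hS
  let S' : Subring (HomogeneousLocalization.Away (homogeneousSubmodule σ K) (gradedMap σ k K s)) :=
    S.comap (Proj.awayToSection (homogeneousSubmodule σ K) (gradedMap σ k K s)).hom
  have h₁ (y) : HomogeneousLocalization.Away.map (gradedMap σ k K) s y ∈ S' := by
    have h1 := ConcreteCategory.congr_hom (awayToSection_appLE_projMap σ k K hs) y
    exact Subring.subset_closure (.inl ⟨_, h1⟩)
  have h₂ (c) : HomogeneousLocalization.fromZeroRingHom (homogeneousSubmodule σ K) _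
      (algebraMap K (homogeneousSubmodule σ K 0) c) ∈ S' := by
    have h1 := ConcreteCategory.congr_hom (constants_projStructure σ K hi hs') c
    exact Subring.subset_closure (.inr ⟨_, h1⟩)
  refine top_le_iff.mp fun x _ ↦ ?_
  have hbij := ConcreteCategory.bijective_of_isIso (Proj.basicOpenIsoAway
    (homogeneousSubmodule σ K) (gradedMap σ k K s) hs' hi).hom
  rw [Proj.basicOpenIsoAway_hom] at hbij
  obtain ⟨y, rfl⟩ := hbij.surjective x
  obtain ⟨n, a, ha, rfl⟩ := HomogeneousLocalization.Away.mk_surjective _ hs' y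
  exact awayMk_mem_of_forall σ hs S' h₁ h₂ n a ha

/-- On the charts `X i ≠ 0` the functions over `K` are generated by those over `k` and constants. A
closed immersion into the base change of projective space over `k` suffices for embedding
quasi-projective schemes there. -/
theorem isClosedImmersion_of_projMap (k K : Type u) [Field k] [Field K] [Algebra k K]
    (m : Proj (homogeneousSubmodule σ K) ⟶
      pullback (projStructure σ k) (Spec.map (CommRingCat.ofHom (algebraMap k K))))
    (h₁ : m ≫ pullback.fst _ _ = projMap σ k K) (h₂ : m ≫ pullback.snd _ _ = projStructure σ K) :
    IsClosedImmersion m := by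
  refine isClosedImmersion_of_closure_eq_top m h₁ h₂
    (fun i : σ ↦ Proj.basicOpen (homogeneousSubmodule σ k) (X i))
    (fun i ↦ Proj.isAffineOpen_basicOpen _ _ (isHomogeneous_X k i) one_pos)
    (Proj.iSup_basicOpen_eq_top _ _ (irrelevant_le_span_X k))
    (fun i ↦ Proj.isAffineOpen_basicOpen _ _ ((gradedMap σ k K).2 (isHomogeneous_X k i)) one_pos)
    fun i ↦ ?_
  refine top_le_iff.mp ((closure_range_projMap σ k K one_pos (isHomogeneous_X k i)).ge.trans
    (Subring.closure_mono (Set.union_subset_union_right _ ?_)))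
  rintro _ ⟨c, rfl⟩
  exact ⟨_, rfl⟩

instance : IsClosedImmersion (Spec.map (CommRingCat.ofHom
    (algebraMap k (homogeneousSubmodule σ k 0)))) := by
  refine IsClosedImmersion.spec_of_surjective _ fun x ↦ ?_
  obtain ⟨c, hc⟩ := Submodule.mem_one.mp ((homogeneousSubmodule_zero (σ := σ) (R := k)).le x.2)
  exact ⟨c, Subtype.ext hc⟩

instance [Finite σ] : Algebra.FiniteType (homogeneousSubmodule σ k 0) (MvPolynomial σ k) :=
  have : IsScalarTower k (homogeneousSubmodule σ k 0) (MvPolynomial σ k) :=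
    ⟨fun a b c ↦ smul_mul_assoc a (b : MvPolynomial σ k) c⟩
  Algebra.FiniteType.of_restrictScalars_finiteType k _ _

instance [Finite σ] : LocallyOfFiniteType (projStructure σ k) :=
  inferInstanceAs (LocallyOfFiniteType (_ ≫ _))

instance [Finite σ] : QuasiCompact (projStructure σ k) :=
  inferInstanceAs (QuasiCompact (_ ≫ _))

/-- The immersion into the base change of projective space over `k` spreads out to some `C`. The
model `X'` then inherits finiteness, separatedness and affine neighbourhoods of finite sets from
projective space; `C` being noetherian yields finite presentation. -/
theorem WeilDescent.IsQuasiProjective.exists_model {k K : Type u} [Field k] [Infinite k] [Field K]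
    [Algebra k K] {X : Over (Spec (.of K))} (hX : IsQuasiProjective X) :
    ∃ (C : FGSubalgebra k K) (X' : Scheme.{u}) (h : X' ⟶ Spec (.of C.1)) (r : X.left ⟶ X'),
      IsPullback r X.hom h C.fromSpec ∧ X'.FiniteInAffine ∧ LocallyOfFinitePresentation h ∧
        CompactSpace X' ∧ QuasiSeparatedSpace X' ∧ X'.IsSeparated := by
  obtain ⟨n, i, hi⟩ := hX
  let f := projStructure (Fin (n + 1)) k
  let b : Spec (.of K) ⟶ Spec (.of k) := Spec.map (CommRingCat.ofHom (algebraMap k K))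
  let m : (projectiveSpace K n).left ⟶ pullback f b :=
    pullback.lift (projMap (Fin (n + 1)) k K) (projStructure (Fin (n + 1)) K)
      (projMap_projStructure _ _ _)
  have hm : IsClosedImmersion m :=
    isClosedImmersion_of_projMap (Fin (n + 1)) k K m (pullback.lift_fst _ _ _) (pullback.lift_snd _ _ _)
  have : CompactSpace (Proj (MvPolynomial.homogeneousSubmodule (Fin (n + 1)) k)) :=
    QuasiCompact.compactSpace_of_compactSpace f
  have : LocallyOfFiniteType (pullback.snd f b) := inferInstance
  have : IsLocallyNoetherian (pullback f b) :=
    LocallyOfFiniteType.isLocallyNoetherian (pullback.snd f b)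
  obtain ⟨C, X', i', r, hi', H⟩ := FGSubalgebra.exists_isImmersion_isPullback
    (IsPullback.of_hasPullback f b) (i.left ≫ m)
  have H' := H.paste_vert (FGSubalgebra.isPullback_baseProj (IsPullback.of_hasPullback f b) C)
  have hw : (i.left ≫ m) ≫ pullback.snd f b = X.hom := by
    rw [Category.assoc]
    exact (congrArg (i.left ≫ ·) (pullback.lift_snd _ _ _)).trans (Over.w i)
  rw [hw] at H'
  have hC : Algebra.FiniteType k C.1 := C.1.fg_iff_finiteType.mp C.2
  have hN : IsNoetherianRing C.1 := Algebra.FiniteType.isNoetherianRing k C.1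
  have hN' : IsLocallyNoetherian (Spec (.of C.1)) :=
    have : IsNoetherianRing (CommRingCat.of C.1) := hN
    inferInstance
  have hN'' : IsLocallyNoetherian (pullback f C.toSpec) :=
    LocallyOfFiniteType.isLocallyNoetherian (pullback.snd f C.toSpec)
  have hN''' : IsNoetherian (pullback f C.toSpec) := { }
  have : QuasiCompact i' := by
    rw [← i'.liftCoborder_ι]
    infer_instance
  have : LocallyOfFiniteType (i' ≫ pullback.snd f C.toSpec) := inferInstance
  have : IsLocallyNoetherian X' :=
    LocallyOfFiniteType.isLocallyNoetherian (i' ≫ pullback.snd f C.toSpec)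
  refine ⟨C, X', i' ≫ pullback.snd f C.toSpec, r, H', ((finiteInAffine_proj k).of_isAffineHom
    (pullback.fst f C.toSpec)).of_isImmersion i',
    LocallyOfFinitePresentation.iff_locallyOfFiniteType.mpr inferInstance,
    QuasiCompact.compactSpace_of_compactSpace i', inferInstance, ⟨?_⟩⟩
  have : terminal.from X' = (i' ≫ pullback.fst f C.toSpec) ≫ terminal.from _ :=
    terminalIsTerminal.hom_ext _ _
  rw [this]
  infer_instance

end ProjectiveSpace

/-! ### Descent of separatedness and of morphisms -/

section Algebra

variable {k K G : Type*} [Field k] [Field K] [Algebra k K] [Group G] [MulSemiringAction G K]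

/-- Linear independence over the fixed field can be tested on all conjugates simultaneously. -/
theorem eq_zero_of_forall_sum_smul_eq_zero
    (hK : ∀ x : K, (∀ σ : G, σ • x = x) → x ∈ Set.range (algebraMap k K)) {ι : Type*} {c : ι → K}
    (hc : LinearIndependent k c) {M : Type*} [AddCommGroup M] [Module K M] (a : ι →₀ M)
    (h : ∀ σ : G, a.sum (fun i m ↦ (σ • c i) • m) = 0) : a = 0 := by
  -- For this twisted translation action the functions `σ ↦ σ • c i` are fixed, so their
  -- independence over `k`, visible at `σ = 1`, gives independence over `K`.
  let ρ (τ : G) : (G → K) →+* (G → K) :=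
    { toFun F σ := τ • F (τ⁻¹ * σ)
      map_one' := funext fun _ ↦ smul_one τ
      map_mul' F F' := funext fun _ ↦ MulSemiringAction.smul_mul τ _ _
      map_zero' := funext fun _ ↦ smul_zero τ
      map_add' F F' := funext fun _ ↦ smul_add τ _ _ }
  have hli : LinearIndependent K (fun i (σ : G) ↦ σ • c i) := by
    refine LinearIndependent.of_semilinear hK ρ (fun σ c ↦ rfl) ?_ fun τ i ↦ funext fun σ ↦ ?_
    · refine LinearIndependent.of_comp (LinearMap.proj (1 : G) : (G → K) →ₗ[k] K) ?_
      convert hc using 1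
      ext i
      exact one_smul G (c i)
    · change τ • (τ⁻¹ * σ) • c i = σ • c i
      rw [smul_smul, mul_inv_cancel_left]
  ext i
  refine (Module.forall_dual_apply_eq_zero_iff K (a i)).mp fun d ↦ ?_
  refine DFunLike.congr_fun (linearIndependent_iff.mp hli (a.mapRange d (map_zero d)) ?_) i
  rw [Finsupp.linearCombination_apply, Finsupp.sum_mapRange_index (by intro; exact zero_smul K _)]
  funext σ
  have h1 := congrArg d (h σ)
  rw [map_zero, Finsupp.sum, map_sum] at h1
  rw [Finsupp.sum, Finset.sum_apply, Pi.zero_apply, ← h1]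
  refine Finset.sum_congr rfl fun i _ ↦ ?_
  rw [map_smul, smul_eq_mul, mul_comm]
  rfl

/-- Think of `T` as `R ⊗ K` over `k`: writing `t = ∑ aᵢ ⊗ bᵢ` in a `k`-basis of `K`, the sections
give `∑ (σ • bᵢ) aᵢ = 0` for all `σ`, which forces all `aᵢ = 0`. Geometrically, the graphs of a
semilinear action are schematically dense. -/
theorem eq_zero_of_forall_semilinear_section
    (hK : ∀ x : K, (∀ σ : G, σ • x = x) → x ∈ Set.range (algebraMap k K))
    {R T : Type*} [CommRing R] [CommRing T] [Algebra K R] [Algebra R T] (q : K →+* T)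
    (hq : ∀ c : k, q (algebraMap k K c) = algebraMap R T (algebraMap K R (algebraMap k K c)))
    (hgen : Subring.closure (Set.range (algebraMap R T) ∪ Set.range q) = ⊤)
    (s : G → T →+* R) (hs : ∀ σ a, s σ (algebraMap R T a) = a)
    (hsq : ∀ σ c, s σ (q c) = algebraMap K R (σ • c)) {t : T} (ht : ∀ σ, s σ t = 0) : t = 0 := by
  let b := Module.Basis.ofVectorSpace k K
  have hspan : t ∈ Submodule.span R (Set.range fun i ↦ q (b i)) := by
    have h1 : Submodule.span R (Set.range q) = ⊤ := by
      have h2 : (Submonoid.closure (Set.range q) : Set T) = Set.range q :=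
        congrArg (fun S : Submonoid T ↦ (S : Set T)) (Submonoid.closure_eq (MonoidHom.mrange q))
      rw [← h2, ← Algebra.adjoin_eq_span, eq_top_iff]
      rintro x -
      have h3 : Subring.closure (Set.range (algebraMap R T) ∪ Set.range q) ≤
          (Algebra.adjoin R (Set.range q)).toSubring := by
        rw [Subring.closure_le]
        rintro _ (⟨c, rfl⟩ | hy)
        · exact (Algebra.adjoin R _).algebraMap_mem c
        · exact Algebra.subset_adjoin hy
      exact h3 (hgen.ge (Subring.mem_top x))
    have h4 : Submodule.span R (Set.range q) ≤ Submodule.span R (Set.range fun i ↦ q (b i)) := by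
      rw [Submodule.span_le]
      rintro _ ⟨c, rfl⟩
      rw [← b.linearCombination_repr c, Finsupp.linearCombination_apply, Finsupp.sum, map_sum]
      refine Submodule.sum_mem _ fun i _ ↦ ?_
      rw [Algebra.smul_def, map_mul, hq, ← Algebra.smul_def]
      exact Submodule.smul_mem _ _ (Submodule.subset_span ⟨i, rfl⟩)
    exact h4 (h1 ▸ Submodule.mem_top)
  obtain ⟨a, rfl⟩ := Finsupp.mem_span_range_iff_exists_finsupp.mp hspan
  suffices a = 0 by rw [this, Finsupp.sum_zero_index]
  refine eq_zero_of_forall_sum_smul_eq_zero (k := k) hK b.linearIndependent a fun σ ↦ ?_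
  rw [← ht σ, Finsupp.sum, Finsupp.sum, map_sum]
  refine Finset.sum_congr rfl fun i _ ↦ ?_
  rw [Algebra.smul_def, Algebra.smul_def, map_mul, hs, hsq, mul_comm]

end Algebra

/-- Separatedness can be checked after a field extension. -/
theorem isSeparated_of_isPullback_algebraMap {k K : Type u} [Field k] [Field K] [Algebra k K]
    {Y Y₀ : Scheme.{u}} {p : Y ⟶ Y₀} {hY : Y ⟶ Spec (.of K)} {hY₀ : Y₀ ⟶ Spec (.of k)}
    (H : IsPullback p hY hY₀ (Spec.map (CommRingCat.ofHom (algebraMap k K)))) [IsSeparated hY] :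
    IsSeparated hY₀ := by
  -- The diagonal is always an immersion, so separatedness amounts to its being universally closed,
  -- a property that descends along the field extension.
  have h1 : MorphismProperty.diagonal @UniversallyClosed hY :=
    (inferInstance : UniversallyClosed (pullback.diagonal hY))
  have hdes : MorphismProperty.DescendsAlong
      (MorphismProperty.diagonal (@UniversallyClosed : MorphismProperty Scheme.{u}))
      (@Surjective ⊓ @Flat ⊓ @QuasiCompact : MorphismProperty Scheme.{u}) := by
    have h4 := universallyClosed_respectsIso.{u}
    have h5 : MorphismProperty.IsStableUnderBaseChange
        (@Surjective ⊓ @Flat ⊓ @QuasiCompact : MorphismProperty Scheme.{u}) :=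
      ⟨fun h hf ↦ ⟨⟨MorphismProperty.of_isPullback h hf.1.1, MorphismProperty.of_isPullback h hf.1.2⟩,
        MorphismProperty.of_isPullback h hf.2⟩⟩
    exact MorphismProperty.instDescendsAlongDiagonalOfRespectsIsoOfIsStableUnderBaseChange _ _
  have h2 : MorphismProperty.diagonal @UniversallyClosed hY₀ :=
    MorphismProperty.of_isPullback_of_descendsAlong (Q := @Surjective ⊓ @Flat ⊓ @QuasiCompact)
      H.flip (surjective_flat_quasiCompact_specMap k K) h1
  have h3 : UniversallyClosed (pullback.diagonal hY₀) := h2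
  exact ⟨.of_isPreimmersion _ (by
    rw [← Set.image_univ]
    exact (pullback.diagonal hY₀).isClosedMap _ isClosed_univ)⟩

/-- Sections of a morphism that are jointly injective on functions over an affine cover are
jointly epimorphic with respect to separated schemes. -/
theorem hom_ext_of_forall_section {S R X Y : Scheme.{u}} {hY : Y ⟶ S} [IsSeparated hY]
    {u v : R ⟶ Y} (huv : u ≫ hY = v ≫ hY) {I J : Type*} (s : I → (X ⟶ R))
    (hs : ∀ i, s i ≫ u = s i ≫ v) (W : J → R.affineOpens) (hW : ⨆ j, (W j : R.Opens) = ⊤)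
    (hsW : ∀ j (t : Γ(R, W j)), (∀ i, (s i).app (W j) t = 0) → t = 0) : u = v := by
  let a : Over.mk (u ≫ hY) ⟶ Over.mk hY := Over.homMk u rfl
  let b : Over.mk (u ≫ hY) ⟶ Over.mk hY := Over.homMk v huv.symm
  have : IsSeparated (Over.mk hY).hom := ‹IsSeparated hY›
  have hcl : IsClosedImmersion (equalizer.ι a b).left := inferInstance
  let ι : (equalizer a b).left ⟶ R := (equalizer.ι a b).left
  have hι : ι ≫ u = ι ≫ v := congrArg (·.left) (equalizer.condition a b)
  have hlift (i : I) : ∃ l, l ≫ ι = s i := by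
    let c : Over.mk (s i ≫ u ≫ hY) ⟶ Over.mk (u ≫ hY) := Over.homMk (s i) rfl
    have hc : c ≫ a = c ≫ b := Over.OverMorphism.ext (hs i)
    exact ⟨(equalizer.lift c hc).left, congrArg (·.left) (equalizer.lift_ι c hc)⟩
  choose l hl using hlift
  -- All sections factor through the equaliser, which is closed because the target is separated; a
  -- function vanishing on it is killed by every section.
  have hker : ι.ker = ⊥ := by
    refine Scheme.IdealSheafData.ext_of_iSup_eq_top W hW fun j ↦ ?_
    rw [Scheme.Hom.ker_apply, Scheme.IdealSheafData.ideal_bot, Pi.bot_apply, eq_bot_iff]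
    intro t ht
    refine hsW j t fun i ↦ ?_
    have h1 : ι.app (W j) t = 0 := ht
    have h2 (m : X ⟶ R) (hm : l i ≫ ι = m) : m.app (W j) t = 0 := by
      subst hm
      exact (ConcreteCategory.congr_hom (Scheme.Hom.comp_app (l i) ι (W j)) t).trans
        ((congrArg ((l i).app (ι ⁻¹ᵁ W j)).hom h1).trans (map_zero ((l i).app (ι ⁻¹ᵁ W j)).hom))
    exact h2 _ (hl i)
  have : IsIso ι := IsClosedImmersion.isIso_iff_ker_eq_bot.mpr hker
  rwa [cancel_epi] at hι

theorem constants_appLE_comp {K : Type u} [Field K] {X R : Scheme.{u}} (hX : X ⟶ Spec (.of K))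
    (g : R ⟶ X) (U : X.Opens) (W : R.Opens) (h : W ≤ g ⁻¹ᵁ U) (c : K) :
    g.appLE U W h (constants hX U c) = constants (g ≫ hX) W c := by
  have : constants hX U ≫ g.appLE U W h = constants (g ≫ hX) W := by
    rw [constants, constants, Category.assoc, Scheme.Hom.appLE_comp_appLE]
  exact congrArg (fun g ↦ g.hom c) this

theorem constants_apply_algebraMap_congr {k K : Type u} [Field k] [Field K] [Algebra k K]
    {R : Scheme.{u}} {f g : R ⟶ Spec (.of K)}
    (h : f ≫ Spec.map (CommRingCat.ofHom (algebraMap k K)) =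
      g ≫ Spec.map (CommRingCat.ofHom (algebraMap k K))) (W : R.Opens) (c : k) :
    constants f W (algebraMap k K c) = constants g W (algebraMap k K c) := by
  have key (f : R ⟶ Spec (.of K)) : CommRingCat.ofHom (algebraMap k K) ≫ constants f W =
      (Scheme.ΓSpecIso (.of k)).inv ≫ (f ≫ Spec.map (CommRingCat.ofHom (algebraMap k K))).appLE ⊤ W
        (le_top.trans_eq (Scheme.Hom.preimage_top _).symm) := by
    rw [constants, Scheme.ΓSpecIso_inv_naturality_assoc]
    exact congrArg (_ ≫ ·) (Scheme.Hom.comp_appLE _ _ ⊤ W _).symm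
  have h1 := key g
  simp_rw [← h] at h1
  exact congrArg (fun g ↦ g.hom c) ((key f).trans h1.symm)

/-- Descent of morphisms: a morphism invariant under a descent datum factors through the
descended scheme. -/
theorem exists_comp_eq_of_isSemilinear {k K : Type u} [Field k] [Field K] [Algebra k K]
    {G : Type*} [Group G] [MulSemiringAction G K]
    (hK : ∀ x : K, (∀ σ : G, σ • x = x) → x ∈ Set.range (algebraMap k K))
    {X X₀ : Scheme.{u}} {p : X ⟶ X₀} {hX : X ⟶ Spec (.of K)} {hX₀ : X₀ ⟶ Spec (.of k)}
    (H : IsPullback p hX hX₀ (Spec.map (CommRingCat.ofHom (algebraMap k K))))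
    {φ : G → (X ⟶ X)} (hφ : IsSemilinear hX φ) (hp : ∀ σ, φ σ ≫ p = p)
    {Y : Scheme.{u}} {hY : Y ⟶ Spec (.of k)} [IsSeparated hY] {h : X ⟶ Y}
    (hh : h ≫ hY = p ≫ hX₀) (hφh : ∀ σ, φ σ ≫ h = h) : ∃ g : X₀ ⟶ Y, p ≫ g = h ∧ g ≫ hY = hX₀ := by
  obtain ⟨⟨h1, h2⟩, h3⟩ := surjective_flat_quasiCompact_of_isPullback H
  have haff : IsAffineHom p := MorphismProperty.of_isPullback H.flip inferInstance
  have haff' : IsAffineHom (pullback.fst p p) := MorphismProperty.of_isPullback (IsPullback.of_hasPullback p p).flip haff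
  -- `p` is an effective epimorphism, so only this equality is needed. It is tested on the graphs
  -- `(1, φ σ)`, where it is the invariance of `h`.
  have key : pullback.fst p p ≫ h = pullback.snd p p ≫ h := by
    let s (σ : G) : X ⟶ pullback p p := pullback.lift (𝟙 X) (φ σ) (by rw [hp, Category.id_comp])
    have hs₁ (σ) : s σ ≫ pullback.fst p p = 𝟙 X := pullback.lift_fst _ _ _
    have hs₂ (σ) : s σ ≫ pullback.snd p p = φ σ := pullback.lift_snd _ _ _
    let W (V : X₀.affineOpens) : (pullback p p).affineOpens :=
      ⟨pullback.fst p p ⁻¹ᵁ (p ⁻¹ᵁ V.1), (V.2.preimage p).preimage (pullback.fst p p)⟩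
    refine hom_ext_of_forall_section (hY := hY) ?_ s (fun σ ↦ ?_) W ?_ fun V t ht ↦ ?_
    · rw [Category.assoc, Category.assoc, hh, pullback.condition_assoc]
    · rw [reassoc_of% hs₁ σ, reassoc_of% hs₂ σ, hφh]
    · have h4 : ⨆ V : X₀.affineOpens, V.1 = ⊤ := X₀.isBasis_affineOpens.isOpenCover.iSup_eq_top
      change ⨆ V : X₀.affineOpens, pullback.fst p p ⁻¹ᵁ (p ⁻¹ᵁ V.1) = ⊤
      rw [← Scheme.Hom.preimage_iSup, ← Scheme.Hom.preimage_iSup, h4]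
      rfl
    · have HR : IsPullback (pullback.fst p p) (pullback.snd p p ≫ hX) (p ≫ hX₀)
          (Spec.map (CommRingCat.ofHom (algebraMap k K))) := (IsPullback.of_hasPullback p p).paste_vert H
      have hW := (V.2.preimage p).preimage (pullback.fst p p)
      let U : X.Opens := p ⁻¹ᵁ V.1
      let W' : (pullback p p).Opens := pullback.fst p p ⁻¹ᵁ U
      have hsU (σ) : U ≤ s σ ⁻¹ᵁ W' := (by rw [← Scheme.Hom.comp_preimage, hs₁]; rfl)
      have hφU (σ) : U ≤ φ σ ⁻¹ᵁ U := by rw [← Scheme.Hom.comp_preimage, hp]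
      let := (constants hX U).hom.toAlgebra
      let := ((pullback.fst p p).app U).hom.toAlgebra
      let q : K →+* Γ(pullback p p, W') := (constants (pullback.snd p p ≫ hX) W').hom
      refine eq_zero_of_forall_semilinear_section (k := k) (K := K) (G := G) (R := Γ(X, U)) hK q
        (fun c ↦ ?_) ?_ (fun σ ↦ ((s σ⁻¹).appLE W' U (hsU _)).hom) (fun σ a ↦ ?_) (fun σ c ↦ ?_)
        fun σ ↦ ?_
      · have h4 : (pullback.fst p p ≫ hX) ≫ Spec.map (CommRingCat.ofHom (algebraMap k K)) =
            (pullback.snd p p ≫ hX) ≫ Spec.map (CommRingCat.ofHom (algebraMap k K)) := by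
          rw [Category.assoc, Category.assoc, ← H.w, pullback.condition_assoc]
        refine (constants_apply_algebraMap_congr h4 W' c).symm.trans
          ((constants_appLE_comp hX (pullback.fst p p) U W' le_rfl _).symm.trans ?_)
        rw [Scheme.Hom.appLE_eq_app]
        rfl
      · rw [← closure_range_appLE_eq_top HR (V.2.preimage p)]
        congr 2
        · rw [Scheme.Hom.appLE_eq_app]
          rfl
        · ext x
          constructor
          · rintro ⟨c, rfl⟩
            exact ⟨_, rfl⟩
          · rintro ⟨c, rfl⟩
            refine ⟨(Scheme.ΓSpecIso (.of K)).hom c, ?_⟩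
            exact congrArg ((pullback.snd p p ≫ hX).appLE ⊤ W' (le_top.trans_eq
              (Scheme.Hom.preimage_top _).symm))
              (ConcreteCategory.congr_hom (Scheme.ΓSpecIso (.of K)).hom_inv_id c)
      · have h4 : (pullback.fst p p).appLE U W' le_rfl ≫ (s σ⁻¹).appLE W' U (hsU _) = 𝟙 _ := by
          rw [Scheme.Hom.appLE_comp_appLE]
          simp_rw [hs₁]
          exact (Scheme.Hom.appLE_eq_app (𝟙 X)).trans (Scheme.Hom.id_app U)
        rw [Scheme.Hom.appLE_eq_app] at h4
        exact ConcreteCategory.congr_hom h4 a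
      · have h4 := hφ.constants_appLE σ⁻¹ U U (hφU _) c
        rw [inv_inv] at h4
        refine .trans ?_ h4
        refine (constants_appLE_comp (pullback.snd p p ≫ hX) (s σ⁻¹) W' U (hsU _) c).trans
          (.trans ?_ (constants_appLE_comp hX (φ σ⁻¹) U U (hφU _) c).symm)
        rw [← Category.assoc, hs₂]
      · exact (congrArg (X.presheaf.map (homOfLE (hsU σ⁻¹)).op).hom (ht σ⁻¹)).trans
          (map_zero (X.presheaf.map (homOfLE (hsU σ⁻¹)).op).hom)
  refine ⟨EffectiveEpi.desc p h fun {Z} g₁ g₂ hg ↦ ?_, EffectiveEpi.fac _ _ _, ?_⟩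
  · rw [← pullback.lift_fst g₁ g₂ hg, Category.assoc, key, pullback.lift_snd_assoc]
  · rw [← cancel_epi p, EffectiveEpi.fac_assoc, hh]

theorem exists_isPullback_of_comp_eq {X Y S S' T : Scheme.{u}} {r : X ⟶ Y} {hX : X ⟶ T} {h : Y ⟶ S}
    {c : T ⟶ S} {a : T ⟶ S'} {b : S' ⟶ S} (H : IsPullback r hX h c) (hc : a ≫ b = c) :
    ∃ l : X ⟶ pullback h b, l ≫ pullback.fst h b = r ∧ l ≫ pullback.snd h b = hX ≫ a ∧
      IsPullback l hX (pullback.snd h b) a := by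
  refine ⟨pullback.lift r (hX ≫ a) (by rw [Category.assoc, hc, H.w]), pullback.lift_fst _ _ _,
    pullback.lift_snd _ _ _, IsPullback.of_right (h₁₂ := pullback.fst h b) (v₁₃ := h) (h₂₂ := b) ?_
    (pullback.lift_snd _ _ _) (IsPullback.of_hasPullback h b)⟩
  rw [pullback.lift_fst, hc]
  exact H

/-! ### Families of models and their specialisation -/

namespace FGSubalgebra

section

variable {R K : Type u} [CommRing R] [CommRing K] [Algebra R K] {ι J : Type*} [Finite J]
  {s t : J → ι} {X Y : ι → Scheme.{u}} {hX : ∀ i, X i ⟶ Spec (.of K)}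
  {h : ∀ i, Y i ⟶ Spec (.of R)} {r : ∀ i, X i ⟶ Y i}
  (H : ∀ i, IsPullback (r i) (hX i) (h i) (Spec.map (CommRingCat.ofHom (algebraMap R K))))
  {f : ∀ j, X (s j) ⟶ X (t j)} [∀ i, CompactSpace (Y i)] [∀ i, QuasiSeparatedSpace (Y i)]
  [∀ i, LocallyOfFinitePresentation (h i)]

/-- Finitely many morphisms over `K` are defined over a finitely generated subalgebra. -/
theorem exists_forall_baseProj_comp_eq (hf : ∀ j, f j ≫ hX (t j) = hX (s j)) :
    ∃ (C : FGSubalgebra R K) (F : ∀ j, baseScheme (h (s j)) C ⟶ baseScheme (h (t j)) C),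
      (∀ j, F j ≫ pullback.snd _ _ = pullback.snd _ _) ∧
      ∀ j, baseProj (H (s j)) C ≫ F j = f j ≫ baseProj (H (t j)) C := by
  have h1 (j : J) := exists_baseProj_comp_eq (H (s j)) (h (s j)) (f j ≫ r (t j)) (g := h (t j))
    (by rw [Category.assoc, (H (t j)).w, reassoc_of% hf j, (H (s j)).w])
  choose C₁ ρ hρ hρ' using h1
  obtain ⟨C, hC⟩ := exists_forall_of_finite (P := fun j C ↦ C₁ j ≤ C) fun j ↦ ⟨C₁ j, fun _ h ↦ h⟩
  have hC := hC C le_rfl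
  refine ⟨C, fun j ↦ pullback.lift (baseMap _ (hC j) ≫ ρ j) (pullback.snd _ _) ?_,
    fun j ↦ pullback.lift_snd _ _ _, fun j ↦ ?_⟩
  · rw [Category.assoc, hρ', baseMap_fst_assoc, pullback.condition]
  · apply pullback.hom_ext
    · rw [Category.assoc, pullback.lift_fst, baseProj_baseMap_assoc, hρ, Category.assoc,
        baseProj_fst]
    · rw [Category.assoc, pullback.lift_snd, baseProj_snd, Category.assoc, baseProj_snd,
        reassoc_of% hf j]

include H in
/-- Finitely many isomorphisms over `K`, compatible with finitely many morphisms, are defined over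
a finitely generated subalgebra. -/
theorem exists_forall_isPullback_baseProj_comp_eq [Finite ι]
    (hf : ∀ j, f j ≫ hX (t j) = hX (s j)) {Z : ι → Scheme.{u}}
    [∀ i, CompactSpace (Z i)] [∀ i, QuasiSeparatedSpace (Z i)] {g : ∀ i, Z i ⟶ Spec (.of R)}
    [∀ i, LocallyOfFinitePresentation (g i)] {b : ∀ i, X i ⟶ Z i}
    (H' : ∀ i, IsPullback (b i) (hX i) (g i) (Spec.map (CommRingCat.ofHom (algebraMap R K))))
    (F : ∀ j, Y (s j) ⟶ Y (t j)) (hF : ∀ j, F j ≫ h (t j) = h (s j))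
    (hF' : ∀ j, r (s j) ≫ F j = f j ≫ r (t j))
    (G : ∀ j, Z (s j) ⟶ Z (t j)) (hG : ∀ j, G j ≫ g (t j) = g (s j))
    (hG' : ∀ j, b (s j) ≫ G j = f j ≫ b (t j)) :
    ∃ (C : FGSubalgebra R K) (ρ : ∀ i, baseScheme (h i) C ⟶ Z i),
      (∀ i, IsPullback (ρ i) (pullback.snd _ _) (g i) C.toSpec) ∧
      ∀ j (v : baseScheme (h (s j)) C ⟶ baseScheme (h (t j)) C),
        v ≫ pullback.fst _ _ = pullback.fst _ _ ≫ F j → v ≫ pullback.snd _ _ = pullback.snd _ _ →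
          ρ (s j) ≫ G j = v ≫ ρ (t j) := by
  choose C₁ ρ hρ hρ' using fun i ↦ exists_isPullback_baseProj_comp_eq (R := R) (K := K) (H i) (H' i)
  obtain ⟨C₂, hC₂⟩ := exists_forall_of_finite (P := fun i C ↦ C₁ i ≤ C) fun i ↦ ⟨C₁ i, fun _ h ↦ h⟩
  have hC₂ := hC₂ C₂ le_rfl
  let ρ₂ (C) (hC : C₂ ≤ C) (i : ι) : baseScheme (h i) C ⟶ Z i := baseMap _ ((hC₂ i).trans hC) ≫ ρ i
  have hρ₂ (C) (hC) (i : ι) : IsPullback (ρ₂ C hC i) (pullback.snd _ _) (g i) C.toSpec := by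
    have := (isPullback_baseMap (h i) ((hC₂ i).trans hC)).paste_horiz (hρ i)
    rwa [specMap_toSpec] at this
  let u (C : FGSubalgebra R K) (j : J) : baseScheme (h (s j)) C ⟶ baseScheme (h (t j)) C :=
    pullback.lift (pullback.fst _ _ ≫ F j) (pullback.snd _ _)
      (by rw [Category.assoc, hF, pullback.condition])
  have hu₁ (C : FGSubalgebra R K) (j : J) : u C j ≫ pullback.fst (h (t j)) C.toSpec = pullback.fst (h (s j)) C.toSpec ≫ F j :=
    pullback.lift_fst _ _ _
  have hu₂ (C : FGSubalgebra R K) (j : J) : u C j ≫ pullback.snd (h (t j)) C.toSpec = pullback.snd (h (s j)) C.toSpec :=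
    pullback.lift_snd _ _ _
  -- The isomorphisms commute with the morphisms over `K`, because both models induce `f j` there;
  -- hence they commute over a larger finitely generated subalgebra.
  have key (j : J) : ∃ C₃, ∀ C, C₃ ≤ C → ∀ hC : C₂ ≤ C,
      ρ₂ C hC (s j) ≫ G j = u C j ≫ ρ₂ C hC (t j) := by
    obtain ⟨C₃, hC₃, e⟩ := exists_baseMap_comp_eq (H (s j)) (h (s j)) (g := g (t j))
      (ρ₂ C₂ le_rfl (s j) ≫ G j) (u C₂ j ≫ ρ₂ C₂ le_rfl (t j))
      (by rw [Category.assoc, hG, (hρ₂ C₂ le_rfl (s j)).w, pullback.condition])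
      (by rw [Category.assoc, (hρ₂ C₂ le_rfl (t j)).w, reassoc_of% hu₂, pullback.condition]) (by
        have h1 : baseProj (H (s j)) C₂ ≫ u C₂ j = f j ≫ baseProj (H (t j)) C₂ := by
          apply pullback.hom_ext
          · rw [Category.assoc, hu₁, baseProj_fst_assoc, hF', Category.assoc, baseProj_fst]
          · rw [Category.assoc, hu₂, baseProj_snd, Category.assoc, baseProj_snd, reassoc_of% hf j]
        have h2 (i) : baseProj (H i) C₂ ≫ ρ₂ C₂ le_rfl i = b i := by
          rw [baseProj_baseMap_assoc, hρ']
        rw [reassoc_of% h1, h2, reassoc_of% h2 (s j), hG'])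
    refine ⟨C₃, fun C h₃ hC ↦ ?_⟩
    have h1 : baseMap (h (s j)) hC ≫ u C₂ j = u C j ≫ baseMap (h (t j)) hC := by
      apply pullback.hom_ext
      · rw [Category.assoc, Category.assoc, hu₁, baseMap_fst, hu₁, baseMap_fst_assoc]
      · rw [Category.assoc, Category.assoc, hu₂, baseMap_snd, baseMap_snd,
          reassoc_of% hu₂]
    have h2 (i) : ρ₂ C hC i = baseMap _ hC ≫ ρ₂ C₂ le_rfl i := (baseMap_baseMap_assoc _ _ _ _).symm
    rw [h2, h2, ← reassoc_of% h1, ← baseMap_baseMap _ hC₃ h₃, Category.assoc, Category.assoc, e,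
      Category.assoc]
  obtain ⟨C, hC⟩ := exists_forall_of_finite key
  refine ⟨C ⊔ C₂, ρ₂ (C ⊔ C₂) le_sup_right, hρ₂ _ le_sup_right, fun j v hv₁ hv₂ ↦ ?_⟩
  rw [hC (C ⊔ C₂) le_sup_left j le_sup_right]
  congr 1
  apply pullback.hom_ext
  · rw [hu₁, hv₁]
  · rw [hu₂, hv₂]

end

/-- A finitely generated subalgebra over a finitely generated subalgebra is finitely generated. -/
def restrictScalars {k K : Type u} [CommRing k] [CommRing K] [Algebra k K] {B : FGSubalgebra k K}
    (C : FGSubalgebra B.1 K) : FGSubalgebra k K :=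
  ⟨C.1.restrictScalars k, by
    have h1 : Algebra.FiniteType k B.1 := B.1.fg_iff_finiteType.mp B.2
    have h2 : Algebra.FiniteType B.1 C.1 := C.1.fg_iff_finiteType.mp C.2
    have h3 : Algebra.FiniteType k C.1 := h1.trans h2
    exact (C.1.restrictScalars k).fg_iff_finiteType.mpr h3⟩

section

variable {k K : Type u} [Field k] [Field K] [Algebra k K] {ι J : Type*} [Finite ι] [Finite J]
  {s t : J → ι} {X : ι → Over (Spec (.of K))}

/-- The separate models are first brought over a common algebra `B`; the finitely many morphisms are
then defined over a further finitely generated extension of it. -/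
theorem exists_model_family [Infinite k] (h : ∀ i, WeilDescent.IsQuasiProjective (X i))
    (f : ∀ j, X (s j) ⟶ X (t j)) :
    ∃ (C : FGSubalgebra k K) (Y : ι → Scheme.{u}) (h : ∀ i, Y i ⟶ Spec (.of C.1))
      (r : ∀ i, (X i).left ⟶ Y i) (F : ∀ j, Y (s j) ⟶ Y (t j)),
      (∀ i, IsPullback (r i) (X i).hom (h i) C.fromSpec) ∧ (∀ i, (Y i).FiniteInAffine) ∧
      (∀ i, LocallyOfFinitePresentation (h i)) ∧ (∀ i, CompactSpace (Y i)) ∧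
      (∀ i, QuasiSeparatedSpace (Y i)) ∧ (∀ j, F j ≫ h (t j) = h (s j)) ∧
      ∀ j, r (s j) ≫ F j = (f j).left ≫ r (t j) := by
  choose C₁ Y h r H haf hfp hc hqs hsep using fun i ↦ (h i).exists_model (k := k)
  obtain ⟨B, hB⟩ := exists_forall_of_finite (P := fun i C ↦ C₁ i ≤ C) fun i ↦ ⟨C₁ i, fun _ h ↦ h⟩
  have hB := hB B le_rfl
  have haff (i) : IsAffineHom (pullback.fst (h i) (specMap (hB i))) :=
    MorphismProperty.of_isPullback (IsPullback.of_hasPullback _ _).flip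
      (inferInstanceAs (IsAffineHom (Spec.map _)))
  have hfp' (i) : LocallyOfFinitePresentation (pullback.snd (h i) (specMap (hB i))) := inferInstance
  have hc' (i) : CompactSpace ↑(pullback (h i) (specMap (hB i))) :=
    QuasiCompact.compactSpace_of_compactSpace (pullback.fst (h i) (specMap (hB i)))
  have hqs' (i) : QuasiSeparatedSpace ↑(pullback (h i) (specMap (hB i))) :=
    quasiSeparatedSpace_of_quasiSeparated (pullback.fst (h i) (specMap (hB i)))
  choose l hl₁ hl₂ H' using fun i ↦ exists_isPullback_of_comp_eq (H i) (fromSpec_specMap (hB i))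
  obtain ⟨C, F, hF, hF'⟩ := exists_forall_baseProj_comp_eq (R := B.1) (K := K) (fun i ↦ H' i)
    (f := fun j ↦ (f j).left) (fun j ↦ Over.w (f j))
  refine ⟨restrictScalars C, fun i ↦ baseScheme (pullback.snd (h i) (specMap (hB i))) C,
    fun i ↦ pullback.snd _ _, fun i ↦ baseProj (H' i) C, F, fun i ↦ isPullback_baseProj (H' i) C,
    fun i ↦ ((haf i).of_isAffineHom (pullback.fst (h i) (specMap (hB i)))).of_isAffineHom
      (pullback.fst (pullback.snd (h i) (specMap (hB i))) C.toSpec),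
    fun i ↦ MorphismProperty.of_isPullback (IsPullback.of_hasPullback _ C.toSpec) (hfp' i),
    fun i ↦ inferInstance, fun i ↦ inferInstance, hF, hF'⟩

/-- A family of schemes over `K` with a descent datum that is defined over a finitely generated
`k`-algebra is defined over a finite extension of `k`. -/
theorem exists_isPullback_forall_isAlgebraic (htr : Cardinal.aleph0 ≤ Algebra.trdeg k K)
    [IsAlgClosed K] [CharZero k] {X : ι → Scheme.{u}} {hX : ∀ i, X i ⟶ Spec (.of K)}
    {f : ∀ j, X (s j) ⟶ X (t j)} (hf : ∀ j, f j ≫ hX (t j) = hX (s j))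
    (hdesc : ∀ σ : K ≃ₐ[k] K, ∃ φ : ∀ i, X i ⟶ X i, (∀ i, IsIso (φ i)) ∧
      (∀ i, φ i ≫ hX i = hX i ≫ Spec.map (CommRingCat.ofHom (σ : K →+* K))) ∧
      ∀ j, φ (s j) ≫ f j = f j ≫ φ (t j))
    (B : FGSubalgebra k K) {Y : ι → Scheme.{u}} {h : ∀ i, Y i ⟶ Spec (.of B.1)}
    {r : ∀ i, X i ⟶ Y i} {F : ∀ j, Y (s j) ⟶ Y (t j)}
    (H : ∀ i, IsPullback (r i) (hX i) (h i) B.fromSpec)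
    [∀ i, LocallyOfFinitePresentation (h i)] [∀ i, CompactSpace (Y i)]
    [∀ i, QuasiSeparatedSpace (Y i)] (hF : ∀ j, F j ≫ h (t j) = h (s j))
    (hrF : ∀ j, r (s j) ≫ F j = f j ≫ r (t j)) :
    ∃ (x : B.1 →ₐ[k] K) (r' : ∀ i, X i ⟶ Y i), (∀ b, IsAlgebraic k (x b)) ∧
      (∀ i, IsPullback (r' i) (hX i) (h i) (Spec.map (CommRingCat.ofHom (x : B.1 →+* K)))) ∧
      ∀ j, r' (s j) ≫ F j = f j ≫ r' (t j) := by
  obtain ⟨σ, hσ⟩ := exists_algEquiv_specialization htr B.2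
  obtain ⟨φ, hφ, hφX, hφf⟩ := hdesc σ
  -- Over `C₁` the scheme `Y i` has two base changes, along the inclusion of `B` and along `σ`. Both
  -- become `X i` over `K`, the second through the isomorphism `φ i`.
  let C₁ : FGSubalgebra k K := ⟨B.1 ⊔ B.1.map σ.toAlgHom, B.2.sup (B.2.map _)⟩
  have hB₁ : B ≤ C₁ := le_sup_left (α := Subalgebra k K)
  let σB : B.1 →ₐ[k] C₁.1 := (σ.toAlgHom.comp B.1.val).codRestrict C₁.1 fun b ↦
    (le_sup_right : _ ≤ B.1 ⊔ B.1.map σ.toAlgHom) ⟨b, b.2, rfl⟩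
  let b₁ : Spec (.of C₁.1) ⟶ Spec (.of B.1) := specMap hB₁
  let b₂ : Spec (.of C₁.1) ⟶ Spec (.of B.1) := Spec.map (CommRingCat.ofHom σB.toRingHom)
  have Hσ (i) : IsPullback (φ i ≫ r i) (hX i) (h i)
      (Spec.map (CommRingCat.ofHom (σ : K →+* K)) ≫ B.fromSpec) := by
    have hσ : IsIso (Spec.map (CommRingCat.ofHom (σ : K →+* K))) :=
      ⟨_, WeilDescent.spec_comp_specInv σ, WeilDescent.specInv_comp_spec σ⟩
    have := hφ i
    exact (IsPullback.of_horiz_isIso ⟨hφX i⟩).paste_horiz (H i)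
  have hb₁ : C₁.fromSpec ≫ b₁ = B.fromSpec := fromSpec_specMap hB₁
  have hb₂ : C₁.fromSpec ≫ b₂ = Spec.map (CommRingCat.ofHom (σ : K →+* K)) ≫ B.fromSpec := by
    rw [fromSpec, fromSpec, ← Spec.map_comp, ← Spec.map_comp]
    rfl
  have hc (b) (i) : CompactSpace ↑(pullback (h i) (Spec.map b : Spec (.of C₁.1) ⟶ _)) :=
    QuasiCompact.compactSpace_of_compactSpace (pullback.fst (h i) (Spec.map b))
  have hqs (b) (i) : QuasiSeparatedSpace ↑(pullback (h i) (Spec.map b : Spec (.of C₁.1) ⟶ _)) :=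
    quasiSeparatedSpace_of_quasiSeparated (pullback.fst (h i) (Spec.map b))
  choose l₁ hl₁ hl₁' H₁ using fun i ↦ exists_isPullback_of_comp_eq (H i) hb₁
  choose l₂ hl₂ hl₂' H₂ using fun i ↦ exists_isPullback_of_comp_eq (Hσ i) hb₂
  let G (b : Spec (.of C₁.1) ⟶ Spec (.of B.1)) (j : J) :
      pullback (h (s j)) b ⟶ pullback (h (t j)) b :=
    pullback.lift (pullback.fst _ _ ≫ F j) (pullback.snd _ _)
      (by rw [Category.assoc, hF, pullback.condition])
  have hG₁ (b j) : G b j ≫ pullback.fst (h (t j)) b = pullback.fst (h (s j)) b ≫ F j :=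
    pullback.lift_fst _ _ _
  have hG₂ (b j) : G b j ≫ pullback.snd (h (t j)) b = pullback.snd (h (s j)) b :=
    pullback.lift_snd _ _ _
  have hc₁ (i) : CompactSpace ↑(pullback (h i) b₁) := hc _ i
  have hc₂ (i) : CompactSpace ↑(pullback (h i) b₂) := hc _ i
  have hqs₁ (i) : QuasiSeparatedSpace ↑(pullback (h i) b₁) := hqs _ i
  have hqs₂ (i) : QuasiSeparatedSpace ↑(pullback (h i) b₂) := hqs _ i
  -- The two base changes are thus identified over a finitely generated `C₂`, compatibly with the `F
  -- j`.
  obtain ⟨C₂, ρ, hρ, hρG⟩ := exists_forall_isPullback_baseProj_comp_eq (R := C₁.1) (K := K)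
    H₁ hf H₂ (G b₁) (hG₂ b₁) (fun j ↦ by
      apply pullback.hom_ext
      · rw [Category.assoc, hG₁, reassoc_of% hl₁, hrF, Category.assoc, hl₁]
      · rw [Category.assoc, hG₂, hl₁', Category.assoc, hl₁', reassoc_of% hf j]) (G b₂) (hG₂ b₂) (fun j ↦ by
      apply pullback.hom_ext
      · rw [Category.assoc, hG₁, reassoc_of% hl₂, hrF, reassoc_of% hφf j, Category.assoc, hl₂]
      · rw [Category.assoc, hG₂, hl₂', Category.assoc, hl₂', reassoc_of% hf j])
  have hC₁₂ : C₁.1 ≤ (restrictScalars C₂).1 := fun c hc ↦ C₂.1.algebraMap_mem ⟨c, hc⟩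
  -- Along `π` the first base change is still `X i`, as `B` is fixed, and the second is the base
  -- change of `Y i` along the algebraic point `x = π ∘ σ`.
  obtain ⟨π, hπB, hπσ⟩ := hσ (restrictScalars C₂).1 (restrictScalars C₂).2 (hB₁.trans hC₁₂)
    fun b ↦ hC₁₂ (σB b).2
  let π' : Spec (.of K) ⟶ Spec (.of C₂.1) := Spec.map (CommRingCat.ofHom π.toRingHom)
  have hπ₁ : (π' ≫ C₂.toSpec) ≫ b₁ = B.fromSpec := by
    rw [toSpec, fromSpec, ← Spec.map_comp]
    refine (Spec.map_comp _ _).symm.trans ?_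
    congr 1
    ext b
    exact hπB b
  let x : B.1 →ₐ[k] K := π.comp ((Subalgebra.inclusion hC₁₂).comp σB)
  have hπ₂ : (π' ≫ C₂.toSpec) ≫ b₂ = Spec.map (CommRingCat.ofHom (x : B.1 →+* K)) := by
    rw [toSpec, ← Spec.map_comp, ← Spec.map_comp]
    rfl
  choose l₃ hl₃ hl₃' H₃ using fun i ↦ exists_isPullback_of_comp_eq (H i) hπ₁
  choose l₄ hl₄ hl₄' H₄ using fun i ↦ exists_isPullback_of_comp_eq (H₃ i) (rfl : π' ≫ C₂.toSpec = _)
  have H₅ (i) := ((H₄ i).paste_horiz (hρ i)).paste_horiz (IsPullback.of_hasPullback (h i) b₂)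
  let G' (j : J) : baseScheme (pullback.snd (h (s j)) b₁) C₂ ⟶
      baseScheme (pullback.snd (h (t j)) b₁) C₂ :=
    pullback.lift (pullback.fst _ _ ≫ G b₁ j) (pullback.snd _ _)
      (by rw [Category.assoc, hG₂, pullback.condition])
  have hG'₁ (j) : G' j ≫ pullback.fst _ _ = pullback.fst _ _ ≫ G b₁ j := pullback.lift_fst _ _ _
  have hG'₂ (j) : G' j ≫ pullback.snd _ _ = pullback.snd _ _ := pullback.lift_snd _ _ _
  have key (j) : l₄ (s j) ≫ G' j = f j ≫ l₄ (t j) := by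
    have key₃ : l₃ (s j) ≫ G b₁ j = f j ≫ l₃ (t j) := by
      apply pullback.hom_ext
      · rw [Category.assoc, hG₁, reassoc_of% hl₃, hrF, Category.assoc, hl₃]
      · rw [Category.assoc, hG₂, hl₃', Category.assoc, hl₃', reassoc_of% hf j]
    apply pullback.hom_ext
    · rw [Category.assoc, hG'₁, reassoc_of% hl₄, key₃, Category.assoc, hl₄]
    · rw [Category.assoc, hG'₂, hl₄', Category.assoc, hl₄', reassoc_of% hf j]
  rw [hπ₂] at H₅
  refine ⟨x, fun i ↦ (l₄ i ≫ ρ i) ≫ pullback.fst (h i) b₂, fun b ↦ hπσ b, H₅, fun j ↦ ?_⟩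
  change ((l₄ (s j) ≫ ρ (s j)) ≫ pullback.fst (h (s j)) b₂) ≫ F j =
    f j ≫ (l₄ (t j) ≫ ρ (t j)) ≫ pullback.fst (h (t j)) b₂
  rw [Category.assoc, Category.assoc, ← hG₁, reassoc_of% hρG j (G' j) (hG'₁ j) (hG'₂ j),
    reassoc_of% key, Category.assoc]

end

end FGSubalgebra

/-- A finite set of algebraic elements of an algebraically closed field lies in a finite normal
extension. -/
theorem exists_normal_intermediateField {k K : Type*} [Field k] [Field K] [Algebra k K]
    [IsAlgClosed K] {s : Set K} (hs : s.Finite) (halg : ∀ x ∈ s, IsAlgebraic k x) :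
    ∃ k' : IntermediateField k K, FiniteDimensional k k' ∧ Normal k k' ∧ s ⊆ k' := by
  classical
  let P : Polynomial k := ∏ x ∈ hs.toFinset, minpoly k x
  have hP : P ≠ 0 := Finset.prod_ne_zero_iff.mpr fun x hx ↦
    minpoly.ne_zero (halg x (hs.mem_toFinset.mp hx)).isIntegral
  have hsplit : P.IsSplittingField k (IntermediateField.adjoin k (P.rootSet K)) :=
    IntermediateField.adjoin_rootSet_isSplittingField (IsAlgClosed.splits _)
  refine ⟨IntermediateField.adjoin k (P.rootSet K), Polynomial.IsSplittingField.finiteDimensional _ P, Normal.of_isSplittingField P,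
    fun x hx ↦ IntermediateField.subset_adjoin k _ ?_⟩
  rw [Polynomial.mem_rootSet]
  refine ⟨hP, ?_⟩
  rw [map_prod]
  exact Finset.prod_eq_zero (hs.mem_toFinset.mpr hx) (minpoly.aeval k x)

/-! ### Descent data on rigid families -/

namespace WeilDescent

variable {k K : Type u} [Field k] [Field K] [Algebra k K]

namespace DescentDatum

variable {Y : Over (Spec (.of K))} (D : DescentDatum k Y)

theorem underlying_comp_hom (σ : K ≃ₐ[k] K) : D.underlying σ ≫ Y.hom = Y.hom ≫ specInv σ :=
  Over.w (D.φ σ).hom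

theorem underlying_mul (σ τ : K ≃ₐ[k] K) :
    D.underlying (σ * τ) = D.underlying τ ≫ D.underlying σ :=
  (Category.id_comp _).symm.trans (congrArg (·.left) (D.cocycle σ τ))

instance (σ : K ≃ₐ[k] K) : IsIso (D.underlying σ) :=
  inferInstanceAs (IsIso ((Over.forget _).map (D.φ σ).hom))

/-- The cocycle relation makes it idempotent, and it is invertible. -/
theorem underlying_one : D.underlying 1 = 𝟙 _ := by
  have h := D.underlying_mul 1 1
  rw [mul_one] at h
  rw [← cancel_epi (D.underlying 1), ← h, Category.comp_id]

theorem isSemilinear : IsSemilinear Y.hom D.underlying := D.underlying_comp_hom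

variable {D} in
theorem Commutes.underlying_comp {Y' : Over (Spec (.of K))} {D' : DescentDatum k Y'} {f : Y ⟶ Y'}
    (h : D.Commutes D' f) (σ : K ≃ₐ[k] K) :
    D.underlying σ ≫ f.left = f.left ≫ D'.underlying σ :=
  (congrArg (·.left) (h σ)).symm

end DescentDatum

/-- With base field `K` itself, `X` is affine over a separated model. -/
theorem IsQuasiProjective.isSeparated [Infinite K] {X : Over (Spec (.of K))} (h : IsQuasiProjective X) :
    X.left.IsSeparated := by
  obtain ⟨C, Y, h, r, H, -, -, -, -, hsep⟩ := h.exists_model (k := K)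
  have hr : IsAffineHom r := MorphismProperty.of_isPullback H.flip
    (inferInstanceAs (IsAffineHom (Spec.map _)))
  have : terminal.from X.left = r ≫ terminal.from _ := terminalIsTerminal.hom_ext _ _
  rw [Scheme.isSeparated_iff, this]
  infer_instance

theorem IsQuasiProjective.compactSpace [Infinite K] {X : Over (Spec (.of K))}
    (h : IsQuasiProjective X) : CompactSpace X.left := by
  obtain ⟨C, Y, h, r, H, -, -, hc, -⟩ := h.exists_model (k := K)
  have hr : IsAffineHom r := MorphismProperty.of_isPullback H.flip
    (inferInstanceAs (IsAffineHom (Spec.map _)))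
  exact QuasiCompact.compactSpace_of_compactSpace r

theorem IsQuasiProjective.locallyOfFiniteType [Infinite K] {X : Over (Spec (.of K))}
    (h : IsQuasiProjective X) : LocallyOfFiniteType X.hom := by
  obtain ⟨C, Y, h, r, H, -, hfp, -⟩ := h.exists_model (k := K)
  exact MorphismProperty.of_isPullback H (inferInstanceAs (LocallyOfFiniteType h))

/-- Specialisation places the model over a finite normal `k'`, and rigidity forces the datum over
`k'` to be the canonical one. Triviality is demanded only at `i₀`, which is what survives the
passage from an infinite rigid family to a finite part of it. -/
theorem exists_isPullback_of_finite [CharZero k] [IsAlgClosed K]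
    (htr : Cardinal.aleph0 ≤ Algebra.trdeg k K) {ι J : Type*} [Finite ι] [Finite J]
    (X : ι → Over (Spec (.of K))) (hX : ∀ i, IsQuasiProjective (X i)) (s t : J → ι)
    (f : ∀ j, X (s j) ⟶ X (t j)) (i₀ : ι)
    (htriv : ∀ ψ : ∀ i, Aut (X i),
      (∀ j, (ψ (s j)).hom ≫ f j = f j ≫ (ψ (t j)).hom) → ψ i₀ = 1)
    (D : ∀ i, DescentDatum k (X i)) (hD : ∀ j, (D (s j)).Commutes (D (t j)) (f j)) :
    ∃ (X₀ : Scheme.{u}) (hX₀ : X₀ ⟶ Spec (.of k)) (p : (X i₀).left ⟶ X₀),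
      IsPullback p (X i₀).hom hX₀ (specBase k K) ∧ ∀ σ, (D i₀).underlying σ ≫ p = p := by
  obtain ⟨B, Y, h, r, F, H, haf, hfp, hc, hqs, hF, hrF⟩ :=
    FGSubalgebra.exists_model_family (k := k) hX f
  obtain ⟨x, r', halg, H', hr'⟩ := FGSubalgebra.exists_isPullback_forall_isAlgebraic htr
    (hX := fun i ↦ (X i).hom) (f := fun j ↦ (f j).left) (fun j ↦ Over.w (f j))
    (fun σ ↦ ⟨fun i ↦ (D i).underlying σ⁻¹, fun i ↦ inferInstance,
      fun i ↦ (D i).underlying_comp_hom σ⁻¹, fun j ↦ (hD j).underlying_comp σ⁻¹⟩) B H hF hrF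
  obtain ⟨k', hfin, hnorm, hk'⟩ : ∃ k' : IntermediateField k K,
      FiniteDimensional k k' ∧ Normal k k' ∧ ∀ b, x b ∈ k' := by
    obtain ⟨S, hS⟩ := B.1.fg_iff_finiteType.mp B.2
    obtain ⟨k', h1, h2, h3⟩ := exists_normal_intermediateField (k := k) (S.finite_toSet.image x)
      (by rintro _ ⟨b, -, rfl⟩; exact halg b)
    refine ⟨k', h1, h2, fun b ↦ ?_⟩
    have h4 : (⊤ : Subalgebra k B.1) ≤ k'.toSubalgebra.comap x := by
      rw [← hS, Algebra.adjoin_le_iff]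
      exact fun b hb ↦ h3 ⟨b, hb, rfl⟩
    exact h4 (Algebra.mem_top (x := b))
  let x' : Spec (.of K) ⟶ Spec (.of B.1) := Spec.map (CommRingCat.ofHom (x : B.1 →+* K))
  have hx' (τ) (hτ : τ ∈ k'.fixingSubgroup) : specInv τ ≫ x' = x' := by
    rw [specInv, ← Spec.map_comp, ← CommRingCat.ofHom_comp]
    congr 2
    ext b
    exact (inv_mem hτ) ⟨x b, hk' b⟩
  have hq (τ) (hτ : τ ∈ k'.fixingSubgroup) : (D i₀).underlying τ ≫ r' i₀ = r' i₀ := by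
    -- `c ν i` is the canonical automorphism of the base change: the identity on the model over the
    -- point `x`, and `specInv ν` on `Spec K`.
    have hc (ν : k'.fixingSubgroup) (i) : ∃ c : (X i).left ⟶ (X i).left, c ≫ r' i = r' i ∧
        c ≫ (X i).hom = (X i).hom ≫ specInv ν.1 := by
      have hw : r' i ≫ h i = ((X i).hom ≫ specInv ν.1) ≫ x' := by
        rw [Category.assoc, hx' ν ν.2, (H' i).w]
      exact ⟨(H' i).lift _ _ hw, (H' i).lift_fst _ _ _, (H' i).lift_snd _ _ _⟩
    choose c hc₁ hc₂ using hc
    let τ' : k'.fixingSubgroup := ⟨τ, hτ⟩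
    have hcc (ν : k'.fixingSubgroup) (i) : c ν i ≫ c ν⁻¹ i = 𝟙 _ := by
      apply (H' i).hom_ext
      · rw [Category.assoc, hc₁, hc₁, Category.id_comp]
      · rw [Category.assoc, hc₂, reassoc_of% hc₂ ν, ← specInv_mul, Category.id_comp]
        refine (congrArg ((X i).hom ≫ ·) ?_).trans (Category.comp_id _)
        rw [show (ν⁻¹ : k'.fixingSubgroup).1 * ν.1 = 1 from inv_mul_cancel ν.1]
        exact Spec.map_id _
    have hcf (ν) (j) : c ν (s j) ≫ (f j).left = (f j).left ≫ c ν (t j) := by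
      apply (H' (t j)).hom_ext
      · rw [Category.assoc, ← hr', reassoc_of% hc₁, hr', Category.assoc, hc₁]
      · rw [Category.assoc, Over.w, hc₂, Category.assoc, hc₂, reassoc_of% Over.w (f j)]
    have hww (i) : ((D i).underlying τ ≫ c τ'⁻¹ i) ≫ (X i).hom = (X i).hom := by
      rw [Category.assoc, hc₂, reassoc_of% (D i).underlying_comp_hom τ, ← specInv_mul]
      refine (congrArg ((X i).hom ≫ ·) ?_).trans (Category.comp_id _)
      rw [show (τ'⁻¹ : k'.fixingSubgroup).1 * τ = 1 from inv_mul_cancel τ]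
      exact Spec.map_id _
    have hinv₁ (i) : (c τ' i ≫ (D i).underlying τ⁻¹) ≫ (D i).underlying τ ≫ c τ'⁻¹ i = 𝟙 _ := by
      rw [Category.assoc, ← Category.assoc ((D i).underlying τ⁻¹), ← (D i).underlying_mul,
        mul_inv_cancel, (D i).underlying_one, Category.id_comp, hcc]
    have hinv₂ (i) : ((D i).underlying τ ≫ c τ'⁻¹ i) ≫ c τ' i ≫ (D i).underlying τ⁻¹ = 𝟙 _ := by
      have := hcc τ'⁻¹ i
      rw [inv_inv] at this
      rw [Category.assoc, reassoc_of% this, ← (D i).underlying_mul, inv_mul_cancel,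
        (D i).underlying_one]
    -- The discrepancy between the given and the canonical isomorphisms is `K`-linear and commutes
    -- with all `f j`, hence is trivial at `i₀`.
    let ψ (i) : Aut (X i) := Over.isoMk ⟨_, _, hinv₂ i, hinv₁ i⟩ (hww i)
    have h1 := htriv ψ fun j ↦ Over.OverMorphism.ext (by
      change ((D (s j)).underlying τ ≫ c τ'⁻¹ (s j)) ≫ (f j).left =
        (f j).left ≫ (D (t j)).underlying τ ≫ c τ'⁻¹ (t j)
      rw [Category.assoc, hcf, reassoc_of% (hD j).underlying_comp τ])
    have h2 : (D i₀).underlying τ ≫ c τ'⁻¹ i₀ = 𝟙 _ :=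
      congrArg (fun a : Aut (X i₀) ↦ a.hom.left) h1
    have h3 := h2 =≫ r' i₀
    rwa [Category.assoc, hc₁, Category.id_comp] at h3
  have hK (a : K) (ha : ∀ σ : K ≃ₐ[k] K, σ • a = a) : a ∈ Set.range (algebraMap k K) :=
    mem_range_algebraMap_of_forall_algEquiv htr ha
  have hsep := (hX i₀).isSeparated
  exact exists_isPullback_of_isGood (D i₀).isSemilinear hK fun y ↦
    exists_isGood_mem (D i₀).isSemilinear (D i₀).underlying_one (D i₀).underlying_mul k' (H' i₀) hq
      (haf i₀) y

/-- Rigidity of a family of objects with finite automorphism groups is a condition on a finite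
subfamily of the morphisms. -/
theorem exists_finset_of_forall_eq_one {A B C : Type*} [Category C] {X : A → C}
    [∀ a, Finite (Aut (X a))] {s t : B → A} (f : ∀ b, X (s b) ⟶ X (t b)) (a₀ : A)
    (h : ∀ ψ : ∀ a, Aut (X a),
      (∀ b, (ψ (s b)).hom ≫ f b = f b ≫ (ψ (t b)).hom) → ψ a₀ = 1) :
    ∃ S : Finset B, ∀ ψ : ∀ a, Aut (X a),
      (∀ b ∈ S, (ψ (s b)).hom ≫ f b = f b ≫ (ψ (t b)).hom) → ψ a₀ = 1 := by
  -- Finite discrete factors make the product compact. The closed set `ψ a₀ ≠ 1` misses the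
  -- intersection of the closed sets `Z b`, hence a finite subintersection.
  let τ (a) : TopologicalSpace (Aut (X a)) := ⊥
  have hτ (a) : DiscreteTopology (Aut (X a)) := ⟨rfl⟩
  let Z (b : B) : Set (∀ a, Aut (X a)) := {ψ | (ψ (s b)).hom ≫ f b = f b ≫ (ψ (t b)).hom}
  have hZ (b : B) : IsClosed (Z b) :=
    IsClosed.preimage (f := fun ψ : ∀ a, Aut (X a) ↦ (ψ (s b), ψ (t b))) (by fun_prop)
      (isClosed_discrete {p : Aut (X (s b)) × Aut (X (t b)) | p.1.hom ≫ f b = f b ≫ p.2.hom})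
  have hN : IsClosed {ψ : ∀ a, Aut (X a) | ψ a₀ ≠ 1} :=
    IsClosed.preimage (f := fun ψ : ∀ a, Aut (X a) ↦ ψ a₀) (by fun_prop)
      (isClosed_discrete {p : Aut (X a₀) | p ≠ 1})
  obtain ⟨S, hS⟩ := hN.isCompact.elim_finite_subfamily_closed Z hZ (by
    ext ψ
    simp only [Set.mem_inter_iff, Set.mem_ofPred_eq, Set.mem_iInter, Set.mem_empty_iff_false,
      iff_false, not_and]
    exact fun h1 h2 ↦ h1 (h ψ h2))
  refine ⟨S, fun ψ hψ ↦ ?_⟩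
  by_contra h1
  exact hS.subset ⟨h1, Set.mem_iInter₂.mpr hψ⟩

/-- Keep only the finitely many morphisms that force triviality at `α`, with their sources and
targets and `α` itself. A family on this part extends by the identity, which disturbs none of the
retained conditions. -/
theorem exists_isPullback_of_rigid [CharZero k] [IsAlgClosed K]
    (htr : Cardinal.aleph0 ≤ Algebra.trdeg k K) {A B : Type*}
    (X : A → Over (Spec (.of K))) (hX : ∀ α, IsQuasiProjective (X α)) (s t : B → A)
    (f : ∀ β, X (s β) ⟶ X (t β)) (hfin : ∀ α, Finite (Aut (X α)))
    (htriv : ∀ ψ : ∀ α, Aut (X α),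
      (∀ β, (ψ (s β)).hom ≫ f β = f β ≫ (ψ (t β)).hom) → ∀ α, ψ α = 1)
    (D : ∀ α, DescentDatum k (X α)) (hD : ∀ β, (D (s β)).Commutes (D (t β)) (f β)) (α : A) :
    ∃ (X₀ : Scheme.{u}) (hX₀ : X₀ ⟶ Spec (.of k)) (p : (X α).left ⟶ X₀),
      IsPullback p (X α).hom hX₀ (specBase k K) ∧ ∀ σ, (D α).underlying σ ≫ p = p := by
  classical
  obtain ⟨S, hS⟩ := exists_finset_of_forall_eq_one f α fun ψ h ↦ htriv ψ h α
  let T : Finset A := insert α (S.image s ∪ S.image t)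
  have hs (b : S) : s b ∈ T :=
    Finset.mem_insert_of_mem (Finset.mem_union_left _ (Finset.mem_image_of_mem s b.2))
  have ht (b : S) : t b ∈ T :=
    Finset.mem_insert_of_mem (Finset.mem_union_right _ (Finset.mem_image_of_mem t b.2))
  refine exists_isPullback_of_finite htr (fun i : T ↦ X i) (fun i ↦ hX i)
    (fun b : S ↦ ⟨s b, hs b⟩) (fun b ↦ ⟨t b, ht b⟩) (fun b ↦ f b) ⟨α, Finset.mem_insert_self _ _⟩
    (fun ψ hψ ↦ ?_) (fun i ↦ D i) fun b ↦ hD b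
  have h1 := hS (fun a ↦ if h : a ∈ T then ψ ⟨a, h⟩ else 1) fun b hb ↦ by
    rw [dif_pos (hs ⟨b, hb⟩), dif_pos (ht ⟨b, hb⟩)]
    exact hψ ⟨b, hb⟩
  rwa [dif_pos (Finset.mem_insert_self _ _)] at h1

end WeilDescent

/-! ### Continuity and effectivity -/

namespace WeilDescent

variable {k K : Type u} [Field k] [Field K] [Algebra k K]

theorem specInv_fromSpec {R : Type u} [CommRing R] [Algebra R K] (C : FGSubalgebra R K)
    {σ : K ≃ₐ[k] K} (h : ∀ c ∈ C.1, σ c = c) : specInv σ ≫ C.fromSpec = C.fromSpec := by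
  rw [specInv, FGSubalgebra.fromSpec, ← Spec.map_comp, ← CommRingCat.ofHom_comp]
  congr 2
  ext c
  exact σ.symm_apply_eq.mpr (h c c.2).symm

/-- A section over a compact open subset of a scheme defined over `k` is fixed by the automorphisms
over a finitely generated subfield. -/
theorem exists_fg_forall_appLE_eq {X X₀ : Scheme.{u}} {p : X ⟶ X₀} {hX : X ⟶ Spec (.of K)}
    {hX₀ : X₀ ⟶ Spec (.of k)}
    (H : IsPullback p hX hX₀ (Spec.map (CommRingCat.ofHom (algebraMap k K)))) [CompactSpace X₀]
    [QuasiSeparatedSpace X₀] {U : X.Opens} (hU : IsCompact (U : Set X)) (f : Γ(X, U)) :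
    ∃ L : IntermediateField k K, L.FG ∧ ∀ σ ∈ L.fixingSubgroup, ∀ u : X ⟶ X, u ≫ p = p →
      u ≫ hX = hX ≫ specInv σ → ∃ h : U ≤ u ⁻¹ᵁ U, u.appLE U U h f = f := by
  classical
  obtain ⟨C, V, rfl⟩ := FGSubalgebra.exists_baseProj_preimage_eq H hU
  let a : X ⟶ FGSubalgebra.baseScheme hX₀ C := FGSubalgebra.baseProj H C
  have Ha : IsPullback a hX (pullback.snd hX₀ C.toSpec)
      (Spec.map (CommRingCat.ofHom (algebraMap C.1 K))) := FGSubalgebra.isPullback_baseProj H C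
  let I := {V' : (FGSubalgebra.baseScheme hX₀ C).Opens // IsAffineOpen V' ∧ V' ≤ V}
  obtain ⟨T, hT⟩ := hU.elim_finite_subcover (fun i : I ↦ ((a ⁻¹ᵁ i.1 : X.Opens) : Set X))
    (fun i ↦ (a ⁻¹ᵁ i.1).2) fun x hx ↦ by
      obtain ⟨_, ⟨V', hV', rfl⟩, hxV, hVV⟩ := (FGSubalgebra.baseScheme hX₀ C).isBasis_affineOpens
        |>.exists_subset_of_mem_open (show a x ∈ V from hx) V.2
      exact Set.mem_iUnion.mpr ⟨⟨V', hV', hVV⟩, hxV⟩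
  have hle (i : I) : a ⁻¹ᵁ i.1 ≤ a ⁻¹ᵁ V := a.preimage_mono i.2.2
  obtain ⟨C', hC'⟩ := FGSubalgebra.exists_forall_of_finite (ι := T) fun i ↦
    FGSubalgebra.exists_appLE_baseProj_eq Ha i.1.2.1
      (X.presheaf.map (homOfLE (hle i.1)).op f)
  have hC' := hC' C' le_rfl
  -- The open subset and, locally on a finite cover, the section come from the model over `C'`. A
  -- semilinear `u` over `p` whose `σ` fixes these generators commutes with the projection to that
  -- model.
  obtain ⟨S, hS⟩ := (FGSubalgebra.restrictScalars C').2
  refine ⟨IntermediateField.adjoin k S, ⟨S, rfl⟩, fun σ hσ u hup huX ↦ ?_⟩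
  have hσC' (c) (hc : c ∈ C'.1) : σ c = c := by
    have h1 : (FGSubalgebra.restrictScalars C').1 ≤
        (IntermediateField.adjoin k (S : Set K)).toSubalgebra := by
      rw [← hS]
      exact IntermediateField.algebra_adjoin_le_adjoin k _
    exact hσ ⟨c, h1 hc⟩
  have hua : u ≫ a = a := by
    apply pullback.hom_ext
    · exact (Category.assoc _ _ _).trans ((congrArg (u ≫ ·) (FGSubalgebra.baseProj_fst H C)).trans
        (hup.trans (FGSubalgebra.baseProj_fst H C).symm))
    · have h1 : a ≫ pullback.snd hX₀ C.toSpec = hX ≫ C.fromSpec := FGSubalgebra.baseProj_snd H C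
      rw [Category.assoc, h1, reassoc_of% huX,
        specInv_fromSpec C fun c hc ↦ hσC' c (C'.1.algebraMap_mem ⟨c, hc⟩)]
  have hua' : u ≫ FGSubalgebra.baseProj Ha C' = FGSubalgebra.baseProj Ha C' := by
    apply pullback.hom_ext
    · rw [Category.assoc, FGSubalgebra.baseProj_fst, hua]
    · rw [Category.assoc, FGSubalgebra.baseProj_snd, reassoc_of% huX, specInv_fromSpec C' hσC']
  have hV (V') : a ⁻¹ᵁ V' ≤ u ⁻¹ᵁ (a ⁻¹ᵁ V') := by rw [← Scheme.Hom.comp_preimage, hua]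
  refine ⟨hV V, X.IsSheaf.section_ext fun x hx ↦ ?_⟩
  obtain ⟨i, hi, hxi⟩ := Set.mem_iUnion₂.mp (hT hx)
  refine ⟨a ⁻¹ᵁ i.1, hle i, hxi, ?_⟩
  obtain ⟨g, hg⟩ := hC' ⟨i, hi⟩
  have h1 : u.appLE (a ⁻¹ᵁ V) (a ⁻¹ᵁ V) (hV V) ≫ X.presheaf.map (homOfLE (hle i)).op =
      X.presheaf.map (homOfLE (hle i)).op ≫ u.appLE (a ⁻¹ᵁ i.1) (a ⁻¹ᵁ i.1) (hV i.1) := by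
    rw [Scheme.Hom.appLE_map, Scheme.Hom.map_appLE]
  refine (ConcreteCategory.congr_hom h1 f).trans ?_
  refine (congrArg (u.appLE (a ⁻¹ᵁ i.1) (a ⁻¹ᵁ i.1) (hV i.1)) hg).symm.trans (.trans ?_ hg)
  have h2 : (FGSubalgebra.baseProj Ha C').appLE
      (pullback.fst (pullback.snd hX₀ C.toSpec) C'.toSpec ⁻¹ᵁ i.1) (a ⁻¹ᵁ i.1)
        (FGSubalgebra.preimage_eq_baseProj_preimage Ha C' i.1).le ≫
        u.appLE (a ⁻¹ᵁ i.1) (a ⁻¹ᵁ i.1) (hV i.1) = (FGSubalgebra.baseProj Ha C').appLE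
      (pullback.fst (pullback.snd hX₀ C.toSpec) C'.toSpec ⁻¹ᵁ i.1) (a ⁻¹ᵁ i.1)
        (FGSubalgebra.preimage_eq_baseProj_preimage Ha C' i.1).le := by
    rw [Scheme.Hom.appLE_comp_appLE]
    simp_rw [hua']
  exact ConcreteCategory.congr_hom h2 g

/-- As `Y` is noetherian, every dense open `U` is compact, and the section over it is defined over a
finitely generated subfield. It is then fixed on all of `U`, with no shrinking. -/
theorem DescentDatum.isContinuous_of_isPullback {Y : Over (Spec (.of K))} (D : DescentDatum k Y)
    {X₀ : Scheme.{u}} {p : Y.left ⟶ X₀} {hX₀ : X₀ ⟶ Spec (.of k)}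
    (H : IsPullback p Y.hom hX₀ (specBase k K)) (hp : ∀ σ, D.underlying σ ≫ p = p)
    [CompactSpace X₀] [QuasiSeparatedSpace X₀] [IsNoetherian Y.left] : D.IsContinuous := by
  intro U hU f
  obtain ⟨L, hL, h⟩ := exists_fg_forall_appLE_eq H
    (TopologicalSpace.NoetherianSpace.isCompact (U : Set Y.left)) f
  refine ⟨L, hL, fun σ hσ ↦ ?_⟩
  obtain ⟨h', e⟩ := h σ⁻¹ (inv_mem hσ) _ (hp σ⁻¹) (D.underlying_comp_hom σ⁻¹)
  refine ⟨U, le_rfl, h', hU, e.trans ?_⟩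
  exact (ConcreteCategory.congr_hom (Y.left.presheaf.map_id (.op U)) f).symm

/-- Once each scheme descends separately, the morphisms follow: `f β` followed by the projection of
its target is invariant, and the descended target is separated. -/
theorem isEffective_of_isPullback [Infinite K] {A B : Type*} {X : A → Over (Spec (.of K))}
    (hX : ∀ α, IsQuasiProjective (X α)) {s t : B → A} (f : ∀ β, X (s β) ⟶ X (t β))
    (hK : ∀ x : K, (∀ σ : K ≃ₐ[k] K, σ x = x) → x ∈ Set.range (algebraMap k K))
    (D : ∀ α, DescentDatum k (X α)) (hD : ∀ β, (D (s β)).Commutes (D (t β)) (f β))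
    (h : ∀ α, ∃ (X₀ : Scheme.{u}) (hX₀ : X₀ ⟶ Spec (.of k)) (p : (X α).left ⟶ X₀),
      IsPullback p (X α).hom hX₀ (specBase k K) ∧ ∀ σ, (D α).underlying σ ≫ p = p) :
    IsEffective f D := by
  choose X₀ hX₀ p H hp using h
  have hsep (α) : IsSeparated (hX₀ α) := by
    have := (hX α).isSeparated
    exact isSeparated_of_isPullback_algebraMap (H α)
  refine ⟨fun α ↦ ?_, fun α ↦ Over.mk (hX₀ α), fun α ↦ Over.isoMk (H α).isoPullback.symm
    (H α).isoPullback_inv_snd, fun α σ ↦ ?_, fun β ↦ ?_⟩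
  · have := (hX α).compactSpace
    have := (hX α).locallyOfFiniteType
    have : IsLocallyNoetherian (X α).left := LocallyOfFiniteType.isLocallyNoetherian (X α).hom
    have : IsNoetherian (X α).left := { }
    have : CompactSpace (X₀ α) := by
      have h1 : Surjective (p α) := (surjective_flat_quasiCompact_of_isPullback (H α)).1.1
      exact h1.surj.compactSpace (p α).continuous
    have : QuasiSeparatedSpace (X₀ α) := quasiSeparatedSpace_of_quasiSeparated (hX₀ α)
    exact (D α).isContinuous_of_isPullback (H α) (hp α)
  · apply Over.OverMorphism.ext
    change (H α).isoPullback.inv ≫ (D α).underlying σ = twist (Over.mk (hX₀ α)) σ ≫ (H α).isoPullback.inv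
    apply (H α).hom_ext
    · rw [Category.assoc, hp, Category.assoc, (H α).isoPullback_inv_fst]
      exact (twist_fst (Over.mk (hX₀ α)) σ).symm
    · rw [Category.assoc, (D α).underlying_comp_hom, Category.assoc, (H α).isoPullback_inv_snd,
        reassoc_of% (H α).isoPullback_inv_snd]
      exact (twist_snd (Over.mk (hX₀ α)) σ).symm
  · obtain ⟨g, hg, hg'⟩ := exists_comp_eq_of_isSemilinear hK (H (s β)) (D (s β)).isSemilinear
      (hp (s β)) (hY := hX₀ (t β)) (h := (f β).left ≫ p (t β)) (by
        rw [Category.assoc, (H (t β)).w, reassoc_of% Over.w (f β), (H (s β)).w]) fun σ ↦ by rw [reassoc_of% (hD β).underlying_comp σ, hp]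
    refine ⟨Over.homMk g hg', Over.OverMorphism.ext ?_⟩
    let m : pullback (hX₀ (s β)) (specBase k K) ⟶ pullback (hX₀ (t β)) (specBase k K) :=
      pullback.lift (pullback.fst _ _ ≫ g) (pullback.snd _ _)
        (by rw [Category.assoc, hg', pullback.condition])
    change m ≫ (H (t β)).isoPullback.inv = (H (s β)).isoPullback.inv ≫ (f β).left
    apply (H (t β)).hom_ext
    · rw [Category.assoc, (H (t β)).isoPullback_inv_fst, Category.assoc, ← hg,
        reassoc_of% (H (s β)).isoPullback_inv_fst]
      exact pullback.lift_fst _ _ _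
    · rw [Category.assoc, (H (t β)).isoPullback_inv_snd, Category.assoc, Over.w,
        (H (s β)).isoPullback_inv_snd]
      exact pullback.lift_snd _ _ _

end WeilDescent

end

theorem mainTheorem7 {k K : Type u} [Field k] [CharZero k] [Field K] [IsAlgClosed K] [Algebra k K]
    (htr : Cardinal.aleph0 ≤ Algebra.trdeg k K)
    {A : Type*} {B : Type*}
    (X : A → Over (Spec (.of K)))
    (hX : ∀ α, WeilDescent.IsQuasiProjective (X α))
    (s t : B → A) (f : ∀ β, X (s β) ⟶ X (t β))
    (hfin : ∀ α, Finite (Aut (X α)))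
    (htriv : ∀ ψ : ∀ α, Aut (X α),
      (∀ β, (ψ (s β)).hom ≫ f β = f β ≫ (ψ (t β)).hom) → ∀ α, ψ α = 1)
    (D : ∀ α, WeilDescent.DescentDatum k (X α))
    (hD : ∀ β, (D (s β)).Commutes (D (t β)) (f β)) :
    WeilDescent.IsEffective f D := by
  have : CharZero K := charZero_of_injective_algebraMap (algebraMap k K).injective
  exact WeilDescent.isEffective_of_isPullback hX f
    (fun _ h ↦ mem_range_algebraMap_of_forall_algEquiv htr h) D hD
    (WeilDescent.exists_isPullback_of_rigid htr X hX s t f hfin htriv D hD)
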